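/- **Theorem.** Let $a>0$, $x_0,A\in\mathbb R$, $\bar Q=[0,\infty)\times\mathbb R$, and write $\square=\partial_t^2-a^2\partial_x^2$. Let $F\in C^1(\bar Q)$ and $f\in C^1(\bar Q\times\mathbb R^3)$, where, for some constant $L$, $$|f(t,x,z_1,z_2,z_3)-f(t,x,w_1,w_2,w_3)|\le L\,(|z_1-w_1|+|z_2-w_2|+|z_3-w_3|)$$ for all $(t,x)\in\bar Q$ and all $z,w\in\mathbb R^3$. Let $\varphi_1\in C^2((-\infty,x_0])$, $\varphi_2\in C^2([x_0,\infty))$, $\psi_1\in C^1((-\infty,x_0])$, $\psi_2\in C^1([x_0,\infty))$, and put $\varphi=\varphi_1$, $\psi=\psi_1$ on $(-\infty,x_0)$, $\varphi=\varphi_2$, $\psi=\psi_2$ on $(x_0,\infty)$, $\varphi(x_0)=A$. Consider the Cauchy problem $$\square u+f(t,x,u,\partial_tu,\partial_xu)=F(t,x),\qquad u(0,x)=\varphi(x),\quad \partial_tu(0,x)=\psi(x).$$ Let $\bar Q_1=\{t\ge 0,\ x+at\le x_0\}$, $\bar Q_2=\{t\ge0,\ x-at\ge x_0\}$, $\bar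 Q_3=\{t\ge0,\ x-at\le x_0\le x+at\}$, and $Q_1^*=\bar Q_1\setminus\bar Q_3$, $Q_2^*=\bar Q_2\setminus\bar Q_3$, $Q_3^*=\bar Q_3$. A function $u:\bar Q\to\mathbb R$ is called a *classical solution* with pieces $u^{(1)},u^{(2)},u^{(3)}$ if 1. $u=u^{(j)}$ on $Q_j^*$ and $u^{(j)}\in C^2(\bar Q_j)$ for $j=1,2,3$ (derivatives at boundary points being one-sided); 2. $\square u^{(j)}+f(t,x,u^{(j)},\partial_tu^{(j)},\partial_xu^{(j)})=F$ on $Q_j^*$ for $j=1,2,3$; 3. $u(0,x)=\varphi(x)$ for all $x\in\mathbb R$; 4. $\partial_tu(0,x)=\psi(x)$ for all $x\ne x_0$; 5. for all $t\ge0$, $u^{(3)}(t,x_0-at)=u^{(1)}(t,x_0-at)+A-\varphi_1(x_0)$ and $u^{(3)}(t,x_0+at)=u^{(2)}(t,x_0+at)+A-\varphi_2(x_0)$. Then there is exactly one classical solution $u$ on $\bar Q$. It is determined by the following integro-differential representations: functions $u,u^{(1)},u^{(2)},u^{(3)}$ satisfying condition 1 form a classical solution with its pieces if and only if, for $j=1,2$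 and $(t,x)\in\bar Q_j$, $$u^{(j)}(t,x)=\frac{\varphi_j(x-at)+\varphi_j(x+at)}2+\frac1{2a}\int_{x-at}^{x+at}\psi_j(\xi)\,d\xi+\frac1{2a}\int_0^t d\tau\int_{x-a(t-\tau)}^{x+a(t-\tau)}\Big(F(\tau,\xi)-f\big(\tau,\xi,u^{(j)}(\tau,\xi),\partial_tu^{(j)}(\tau,\xi),\partial_xu^{(j)}(\tau,\xi)\big)\Big)d\xi,$$ and, for $(t,x)\in\bar Q_3$, $$u^{(3)}(t,x)=u^{(1)}\Big(\tfrac{x_0+at-x}{2a},\tfrac{x_0-at+x}2\Big)+A-\varphi_1(x_0)-\varphi_2(x_0)+u^{(2)}\Big(\tfrac{at+x-x_0}{2a},\tfrac{at+x+x_0}2\Big)-\frac1{4a^2}\int_{x_0}^{x-at}dy\int_{x_0}^{x+at}G_3\Big(\tfrac{z-y}{2a},\tfrac{z+y}2\Big)dz,$$ where $G_3(t,x)=F(t,x)-f\big(t,x,u^{(3)}(t,x),\partial_tu^{(3)}(t,x),\partial_xu^{(3)}(t,x)\big)$. -/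

import Mathlib

open Set MeasureTheory

namespace QLWave

/-- The closed upper half-plane `[0, ∞) × ℝ` of points `(t, x)`. -/
def Qbar : Set (ℝ × ℝ) := {p | 0 ≤ p.1}

/-- The open region to the left of the characteristic `x + a t = x₀`. -/
def Q1 (a x₀ : ℝ) : Set (ℝ × ℝ) := {p | 0 < p.1 ∧ p.2 + a * p.1 < x₀}

/-- The open region to the right of the characteristic `x - a t = x₀`. -/
def Q2 (a x₀ : ℝ) : Set (ℝ × ℝ) := {p | 0 < p.1 ∧ x₀ < p.2 - a * p.1}

/-- The open region between the two characteristics. -/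
def Q3 (a x₀ : ℝ) : Set (ℝ × ℝ) :=
  {p | 0 < p.1 ∧ x₀ < p.2 + a * p.1 ∧ p.2 - a * p.1 < x₀}

/-- The pieces `Q̄₁ \ Q̄₃`, `Q̄₂ \ Q̄₃`, `Q̄₃`, which partition the closed half-plane; their closures
are `Q̄₁`, `Q̄₂`, `Q̄₃`. -/
def Qstar1 (a x₀ : ℝ) : Set (ℝ × ℝ) := closure (Q1 a x₀) \ closure (Q3 a x₀)

/-- See `Qstar1`. -/
def Qstar2 (a x₀ : ℝ) : Set (ℝ × ℝ) := closure (Q2 a x₀) \ closure (Q3 a x₀)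

/-- See `Qstar1`. -/
def Qstar3 (a x₀ : ℝ) : Set (ℝ × ℝ) := closure (Q3 a x₀)

/-- `∂ₜ v` relative to the set `S` (one-sided at boundary points of a closed region). -/
noncomputable def dt (S : Set (ℝ × ℝ)) (v : ℝ × ℝ → ℝ) (p : ℝ × ℝ) : ℝ :=
  fderivWithin ℝ v S p (1, 0)

/-- `∂ₓ v` relative to the set `S`. -/
noncomputable def dx (S : Set (ℝ × ℝ)) (v : ℝ × ℝ → ℝ) (p : ℝ × ℝ) : ℝ :=
  fderivWithin ℝ v S p (0, 1)

/-- The d'Alembert operator `∂ₜ² - a² ∂ₓ²`, derivatives being taken relative to `S`. -/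
noncomputable def box (a : ℝ) (S : Set (ℝ × ℝ)) (v : ℝ × ℝ → ℝ) (p : ℝ × ℝ) : ℝ :=
  dt S (dt S v) p - a ^ 2 * dx S (dx S v) p

/-- The composition `f(t, x, v, ∂ₜ v, ∂ₓ v)` at the point `p = (t, x)`. -/
noncomputable def nonlin (f : ℝ × ℝ × ℝ × ℝ × ℝ → ℝ) (S : Set (ℝ × ℝ)) (v : ℝ × ℝ → ℝ)
    (p : ℝ × ℝ) : ℝ :=
  f (p.1, p.2, v p, dt S v p, dx S v p)

/-- The initial displacement: `φ₁` on the left of `x₀`, `A` at `x₀`, `φ₂` on the right. -/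
noncomputable def phi (x₀ A : ℝ) (φ₁ φ₂ : ℝ → ℝ) (x : ℝ) : ℝ :=
  if x < x₀ then φ₁ x else if x = x₀ then A else φ₂ x

/-- The initial velocity: `ψ₁` on the left of `x₀`, `ψ₂` on the right. It is only ever evaluated
at `x ≠ x₀`. -/
noncomputable def psi (x₀ : ℝ) (ψ₁ ψ₂ : ℝ → ℝ) (x : ℝ) : ℝ :=
  if x < x₀ then ψ₁ x else ψ₂ x

/-- `u` coincides with `u₁`, `u₂`, `u₃` on the three pieces of the closed half-plane, and each `uⱼ`
is `C²` up to the boundary of its region. -/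
structure HasC2Pieces (a x₀ : ℝ) (u u₁ u₂ u₃ : ℝ × ℝ → ℝ) : Prop where
  eq₁ : EqOn u u₁ (Qstar1 a x₀)
  eq₂ : EqOn u u₂ (Qstar2 a x₀)
  eq₃ : EqOn u u₃ (Qstar3 a x₀)
  smooth₁ : ContDiffOn ℝ 2 u₁ (closure (Q1 a x₀))
  smooth₂ : ContDiffOn ℝ 2 u₂ (closure (Q2 a x₀))
  smooth₃ : ContDiffOn ℝ 2 u₃ (closure (Q3 a x₀))

/-- `u`, with pieces `u₁`, `u₂`, `u₃`, is a classical solution of the Cauchy problem. -/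
structure IsClassicalSolutionWith (a x₀ A : ℝ) (φ₁ φ₂ ψ₁ ψ₂ : ℝ → ℝ)
    (F : ℝ × ℝ → ℝ) (f : ℝ × ℝ × ℝ × ℝ × ℝ → ℝ) (u u₁ u₂ u₃ : ℝ × ℝ → ℝ) : Prop
    extends HasC2Pieces a x₀ u u₁ u₂ u₃ where
  pde₁ : ∀ p ∈ Qstar1 a x₀,
    box a (closure (Q1 a x₀)) u₁ p + nonlin f (closure (Q1 a x₀)) u₁ p = F p
  pde₂ : ∀ p ∈ Qstar2 a x₀,
    box a (closure (Q2 a x₀)) u₂ p + nonlin f (closure (Q2 a x₀)) u₂ p = F p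
  pde₃ : ∀ p ∈ Qstar3 a x₀,
    box a (closure (Q3 a x₀)) u₃ p + nonlin f (closure (Q3 a x₀)) u₃ p = F p
  init : ∀ x : ℝ, u (0, x) = phi x₀ A φ₁ φ₂ x
  init_dt : ∀ x : ℝ, x ≠ x₀ →
    HasDerivWithinAt (fun t : ℝ => u (t, x)) (psi x₀ ψ₁ ψ₂ x) (Ici 0) 0
  goursat₁ : ∀ t : ℝ, 0 ≤ t → u₃ (t, x₀ - a * t) = u₁ (t, x₀ - a * t) + A - φ₁ x₀
  goursat₂ : ∀ t : ℝ, 0 ≤ t → u₃ (t, x₀ + a * t) = u₂ (t, x₀ + a * t) + A - φ₂ x₀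

/-- `u` is a classical solution of the Cauchy problem. -/
def IsClassicalSolution (a x₀ A : ℝ) (φ₁ φ₂ ψ₁ ψ₂ : ℝ → ℝ)
    (F : ℝ × ℝ → ℝ) (f : ℝ × ℝ × ℝ × ℝ × ℝ → ℝ) (u : ℝ × ℝ → ℝ) : Prop :=
  ∃ u₁ u₂ u₃ : ℝ × ℝ → ℝ, IsClassicalSolutionWith a x₀ A φ₁ φ₂ ψ₁ ψ₂ F f u u₁ u₂ u₃

/-- The d'Alembert-type integro-differential equation for `v` on the set `S`. -/
def DAlembert (a : ℝ) (φ ψ : ℝ → ℝ) (F : ℝ × ℝ → ℝ) (f : ℝ × ℝ × ℝ × ℝ × ℝ → ℝ)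
    (S : Set (ℝ × ℝ)) (v : ℝ × ℝ → ℝ) : Prop :=
  ∀ t x : ℝ, (t, x) ∈ S →
    v (t, x) = (φ (x - a * t) + φ (x + a * t)) / 2
      + 1 / (2 * a) * (∫ ξ in (x - a * t)..(x + a * t), ψ ξ)
      + 1 / (2 * a) * ∫ τ in (0 : ℝ)..t, ∫ ξ in (x - a * (t - τ))..(x + a * (t - τ)),
          (F (τ, ξ) - nonlin f S v (τ, ξ))

/-- The integro-differential equation for `u₃` on the closed middle region `S`, coming from the
parallelogram identity. -/
def Parallelogram (a x₀ A : ℝ) (φ₁ φ₂ : ℝ → ℝ) (F : ℝ × ℝ → ℝ)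
    (f : ℝ × ℝ × ℝ × ℝ × ℝ → ℝ) (S : Set (ℝ × ℝ)) (u₁ u₂ u₃ : ℝ × ℝ → ℝ) : Prop :=
  ∀ t x : ℝ, (t, x) ∈ S →
    u₃ (t, x) = u₁ ((x₀ + a * t - x) / (2 * a), (x₀ - a * t + x) / 2)
      + A - φ₁ x₀ - φ₂ x₀
      + u₂ ((a * t + x - x₀) / (2 * a), (a * t + x + x₀) / 2)
      - 1 / (4 * a ^ 2) * ∫ y in x₀..(x - a * t), ∫ z in x₀..(x + a * t),
          (F ((z - y) / (2 * a), (z + y) / 2)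
            - nonlin f S u₃ ((z - y) / (2 * a), (z + y) / 2))

/-- `u` is given by its `C²` pieces `u₁`, `u₂`, `u₃`, which satisfy the integro-differential
representations. -/
structure IsRepresentedBy (a x₀ A : ℝ) (φ₁ φ₂ ψ₁ ψ₂ : ℝ → ℝ)
    (F : ℝ × ℝ → ℝ) (f : ℝ × ℝ × ℝ × ℝ × ℝ → ℝ) (u u₁ u₂ u₃ : ℝ × ℝ → ℝ) : Prop
    extends HasC2Pieces a x₀ u u₁ u₂ u₃ where
  rep₁ : DAlembert a φ₁ ψ₁ F f (closure (Q1 a x₀)) u₁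
  rep₂ : DAlembert a φ₂ ψ₂ F f (closure (Q2 a x₀)) u₂
  rep₃ : Parallelogram a x₀ A φ₁ φ₂ F f (closure (Q3 a x₀)) u₁ u₂ u₃

end QLWave

/-!
The proof works in the characteristic coordinates `y = x - a t`, `z = x + a t`, in which
`□ = -4 a² ∂y ∂z` and the equation becomes `V_yz = g (y, z, V, V_y, V_z)` with `g` of class `C¹` and
Lipschitz in its last three arguments (`box_eq`, `charRhs`). The regions `Q̄₁` and `Q̄₂` are the
triangles `{y ≤ z, y ∈ J, z ∈ J}` over `J = (-∞, x₀]` and `J = [x₀, ∞)`, and `Q̄₃` is the quadrant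
`{y ≤ x₀ ≤ z}`.

A classical solution is then the same as a solution of the Cauchy problem over each of the two
half-lines together with a solution of the Goursat problem on the quadrant, whose data on the two
characteristics come from the outer pieces (`isClassicalSolutionWith_iff`). Since all data extend
smoothly, `φⱼ` and `ψⱼ` to the line and `F`, `f` to negative times by reflection
(`contDiff_reflectExt`), existence may be proved on the whole plane.

Both problems are treated at once. With data on a curve `z = c y`, where `c` is the identity or a
constant, the functions `V`, `V_y`, `V_z` are explicit integrals of `h = V_yz`, and the equation is
a fixed point equation `h = volMap h` for a single function. An exponential weight makes `volMap` a
contraction on every set that contains the segments joining its points to the data curve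
(`volMap_contraction`). This gives existence of a continuous fixed point on the plane
(`exists_volMap_fixedPoint`) and uniqueness on each of the three regions (`eqOn_of_data`).

That the solution is `C²`, and not only has a continuous mixed derivative, needs an argument: for
fixed `y` the function `V_y` solves an ordinary differential equation in `z` depending on the
parameter `y`, and its increments in `y` solve a linear equation, which is integrated explicitly
(`exists_hasSlope_of_ode`, `volV_regularity`).

For the integral representations, integrating `V_yz` twice from the data recovers any `C²` function
(`IsCauchyRegion.eq_integral`, `eq_integral_goursat`), so a classical solution satisfies them.
Conversely, if a `C²` function satisfies a representation, the integrals of the defect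
`V_yz - g` over all characteristic triangles or rectangles vanish, hence so does the defect
(`eq_zero_of_integral_triangle`, `eq_zero_of_integral_rectangle`).
-/

namespace QLWave

/-! ### Slopes and continuously differentiable functions of two variables -/

theorem continuous_integral_param {X E : Type*} [TopologicalSpace X] [NormedAddCommGroup E]
    [NormedSpace ℝ E] {f : X × ℝ → E} (hf : Continuous f) {a b : X → ℝ} (ha : Continuous a)
    (hb : Continuous b) : Continuous fun x => ∫ s in a x..b x, f (x, s) := by
  have key : ∀ {e : X → ℝ}, Continuous e → Continuous fun x => ∫ s in (0 : ℝ)..e x, f (x, s) :=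
    fun he => intervalIntegral.continuous_parametric_intervalIntegral_of_continuous
      (f := fun x s => f (x, s)) (by simpa [Function.uncurry_def] using hf) he
  have h : (fun x => ∫ s in a x..b x, f (x, s)) =
      fun x => (∫ s in (0 : ℝ)..b x, f (x, s)) - ∫ s in (0 : ℝ)..a x, f (x, s) := by
    funext x
    have hi : ∀ p q, IntervalIntegrable (fun s => f (x, s)) volume p q := fun p q =>
      (by fun_prop : Continuous fun s => f (x, s)).intervalIntegrable _ _
    rw [intervalIntegral.integral_interval_sub_left (hi _ _) (hi _ _)]
  rw [h]
  exact (key hb).sub (key ha)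

theorem integral_add_eq_mul (f : ℝ → ℝ) (y η : ℝ) :
    ∫ s in y..(y + η), f s = η * ∫ s in (0 : ℝ)..1, f (y + η * s) := by
  rw [intervalIntegral.mul_integral_comp_add_mul]
  simp

theorem sub_eq_mul_integral {f f' : ℝ → ℝ} (h : ∀ x, HasDerivAt f (f' x) x)
    (hc : Continuous f') (y η : ℝ) :
    f (y + η) - f y = η * ∫ s in (0 : ℝ)..1, f' (y + η * s) := by
  rw [← integral_add_eq_mul,
    intervalIntegral.integral_eq_sub_of_hasDerivAt (fun x _ => h x) (hc.intervalIntegrable _ _)]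

/-- `k` is a continuous slope of `P` in the first variable: a difference quotient
`(P (y + η, z) - P (y, z)) / η` that stays continuous at `η = 0`. The arguments of `k` are
`(y, η, z)`. -/
structure HasSlope (P : ℝ × ℝ → ℝ) (k : ℝ × ℝ × ℝ → ℝ) : Prop where
  cont : Continuous k
  sub_eq : ∀ y η z, P (y + η, z) - P (y, z) = η * k (y, η, z)

theorem HasSlope.of_hasDerivAt {P P' : ℝ × ℝ → ℝ}
    (h : ∀ y z, HasDerivAt (fun s => P (s, z)) (P' (y, z)) y) (hc : Continuous P') :
    HasSlope P fun q => ∫ s in (0 : ℝ)..1, P' (q.1 + q.2.1 * s, q.2.2) where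
  cont := continuous_integral_param
    (f := fun r : (ℝ × ℝ × ℝ) × ℝ => P' (r.1.1 + r.1.2.1 * r.2, r.1.2.2))
    (by fun_prop) continuous_const continuous_const
  sub_eq y η z := sub_eq_mul_integral (f := fun s => P (s, z)) (f' := fun s => P' (s, z))
    (fun x => h x z) (by fun_prop) y η

theorem HasSlope.hasDerivAt {P : ℝ × ℝ → ℝ} {k : ℝ × ℝ × ℝ → ℝ} (h : HasSlope P k) (y z : ℝ) :
    HasDerivAt (fun s => P (s, z)) (k (y, 0, z)) y := by
  rw [hasDerivAt_iff_tendsto_slope_zero]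
  have hk : Filter.Tendsto (fun η : ℝ => k (y, η, z)) (nhdsWithin 0 {0}ᶜ) (nhds (k (y, 0, z))) :=
    ((h.cont.comp (by fun_prop : Continuous fun η : ℝ => (y, η, z))).tendsto 0).mono_left
      nhdsWithin_le_nhds
  refine hk.congr' ?_
  filter_upwards [self_mem_nhdsWithin] with η hη
  have : η ≠ 0 := hη
  rw [h.sub_eq, smul_eq_mul, inv_mul_cancel_left₀ this]

theorem isLittleO_mul_sub {l A : ℝ × ℝ → ℝ} (hl : ∀ v, ‖l v‖ ≤ ‖v‖) (hA : Continuous A) :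
    (fun v => l v * (A v - A 0)) =o[nhds 0] fun v => v := by
  have h1 : (fun v => A v - A 0) =o[nhds 0] fun _ => (1 : ℝ) := by
    rw [Asymptotics.isLittleO_one_iff]
    exact (show Continuous fun v => A v - A 0 by fun_prop).tendsto' 0 0 (sub_self _)
  have h2 : l =O[nhds 0] fun v => ‖v‖ := (Asymptotics.isBigO_of_le _ hl).norm_right
  have h3 := h2.mul_isLittleO h1
  simp only [mul_one] at h3
  exact h3.of_norm_right

/-- A function of two variables with a continuous slope in the first variable and a continuous
derivative in the second one is `C¹`. -/
theorem HasSlope.hasFDerivAt {P h : ℝ × ℝ → ℝ} {k : ℝ × ℝ × ℝ → ℝ} (hk : HasSlope P k)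
    (hd : ∀ y z, HasDerivAt (fun s => P (y, s)) (h (y, z)) z) (hc : Continuous h) (w : ℝ × ℝ) :
    HasFDerivAt P (k (w.1, 0, w.2) • ContinuousLinearMap.fst ℝ ℝ ℝ
      + h w • ContinuousLinearMap.snd ℝ ℝ ℝ) w := by
  have hB : Continuous fun v : ℝ × ℝ => ∫ s in (0 : ℝ)..1, h (w.1, w.2 + v.2 * s) :=
    continuous_integral_param (f := fun r : (ℝ × ℝ) × ℝ => h (w.1, w.2 + r.1.2 * r.2))
      (by fun_prop) continuous_const continuous_const
  have hA : Continuous fun v : ℝ × ℝ => k (w.1, v.1, w.2 + v.2) :=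
    hk.cont.comp (by fun_prop)
  rw [hasFDerivAt_iff_isLittleO_nhds_zero]
  have e1 := isLittleO_mul_sub (fun v => norm_fst_le v) hA
  have e2 := isLittleO_mul_sub (fun v => norm_snd_le v) hB
  refine (e1.add e2).congr_left fun v => ?_
  have a1 := hk.sub_eq w.1 v.1 (w.2 + v.2)
  have a2 := sub_eq_mul_integral (f := fun s => P (w.1, s)) (f' := fun s => h (w.1, s))
    (fun x => hd w.1 x) (by fun_prop) w.2 v.2
  have a3 : P (w + v) = P (w.1 + v.1, w.2 + v.2) := rfl
  have a4 : P w = P (w.1, w.2) := rfl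
  have a5 : (∫ s in (0 : ℝ)..1, h (w.1, w.2 + (0 : ℝ × ℝ).2 * s)) = h w := by simp
  have a6 : k (w.1, (0 : ℝ × ℝ).1, w.2 + (0 : ℝ × ℝ).2) = k (w.1, 0, w.2) := by simp
  simp only [add_apply, smul_apply,
    ContinuousLinearMap.coe_fst', ContinuousLinearMap.coe_snd', smul_eq_mul]
  rw [a3, a4, a5, a6]
  linear_combination -a1 - a2

theorem contDiff_one_of_hasFDerivAt {P p q : ℝ × ℝ → ℝ} (hp : Continuous p) (hq : Continuous q)
    (h : ∀ w, HasFDerivAt P (p w • ContinuousLinearMap.fst ℝ ℝ ℝ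
      + q w • ContinuousLinearMap.snd ℝ ℝ ℝ) w) : ContDiff ℝ 1 P := by
  rw [contDiff_one_iff_fderiv]
  refine ⟨fun w => (h w).differentiableAt, ?_⟩
  have : fderiv ℝ P = fun w => p w • ContinuousLinearMap.fst ℝ ℝ ℝ
      + q w • ContinuousLinearMap.snd ℝ ℝ ℝ := funext fun w => (h w).fderiv
  rw [this]
  fun_prop

theorem contDiff_two_of_hasFDerivAt {P p q : ℝ × ℝ → ℝ} (hp : ContDiff ℝ 1 p)
    (hq : ContDiff ℝ 1 q) (h : ∀ w, HasFDerivAt P (p w • ContinuousLinearMap.fst ℝ ℝ ℝ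
      + q w • ContinuousLinearMap.snd ℝ ℝ ℝ) w) : ContDiff ℝ 2 P := by
  have : fderiv ℝ P = fun w => p w • ContinuousLinearMap.fst ℝ ℝ ℝ
      + q w • ContinuousLinearMap.snd ℝ ℝ ℝ := funext fun w => (h w).fderiv
  rw [show (2 : WithTop ℕ∞) = 1 + 1 by norm_num, contDiff_succ_iff_fderiv]
  refine ⟨fun w => (h w).differentiableAt, by simp, ?_⟩
  rw [this]
  fun_prop

/-- Leibniz rule, in slope form, for an integral whose lower limit moves with speed `κ`. -/
theorem HasSlope.integral {K : ℝ × ℝ → ℝ} {k : ℝ × ℝ × ℝ → ℝ} (hk : HasSlope K k)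
    (hK : Continuous K) {c : ℝ → ℝ} {κ : ℝ} (hcc : Continuous c)
    (hc : ∀ y η, c (y + η) = c y + κ * η) :
    HasSlope (fun w => ∫ s in c w.1..w.2, K (w.1, s)) fun q =>
      -(κ * ∫ s in (0 : ℝ)..1, K (q.1 + q.2.1, c q.1 + (κ * q.2.1) * s))
        + ∫ s in c q.1..q.2.2, k (q.1, q.2.1, s) where
  cont := by
    have hkc := hk.cont
    refine ((continuous_const.mul (continuous_integral_param
      (f := fun r : (ℝ × ℝ × ℝ) × ℝ => K (r.1.1 + r.1.2.1, c r.1.1 + (κ * r.1.2.1) * r.2))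
      (by fun_prop) continuous_const continuous_const)).neg).add (continuous_integral_param
      (f := fun r : (ℝ × ℝ × ℝ) × ℝ => k (r.1.1, r.1.2.1, r.2))
      (by fun_prop) (by fun_prop) (by fun_prop))
  sub_eq y η z := by
    have hi : ∀ y p q, IntervalIntegrable (fun s => K (y, s)) volume p q := fun y p q =>
      (by fun_prop : Continuous fun s => K (y, s)).intervalIntegrable _ _
    have h1 : ∫ s in c (y + η)..z, K (y + η, s) =
        (∫ s in c y..z, K (y + η, s)) - ∫ s in c y..c (y + η), K (y + η, s) := by
      rw [intervalIntegral.integral_interval_sub_left (hi _ _ _) (hi _ _ _)]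
    have h2 : (∫ s in c y..z, K (y + η, s)) - ∫ s in c y..z, K (y, s)
        = η * ∫ s in c y..z, k (y, η, s) := by
      rw [← intervalIntegral.integral_sub (hi _ _ _) (hi _ _ _),
        ← intervalIntegral.integral_const_mul]
      simp only [hk.sub_eq]
    simp only
    rw [h1, hc, integral_add_eq_mul]
    linear_combination h2

theorem hasSlope_of_contDiff {X₀ : ℝ → ℝ} (h : ContDiff ℝ 1 X₀) :
    HasSlope (fun w => X₀ w.1) fun q => ∫ s in (0 : ℝ)..1, deriv X₀ (q.1 + q.2.1 * s) :=
  HasSlope.of_hasDerivAt (P := fun w => X₀ w.1) (P' := fun w => deriv X₀ w.1)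
    (fun y _ => (h.differentiable one_ne_zero y).hasDerivAt)
    ((h.continuous_deriv le_rfl).comp continuous_fst)

theorem HasSlope.add {P R : ℝ × ℝ → ℝ} {k l : ℝ × ℝ × ℝ → ℝ} (hP : HasSlope P k)
    (hR : HasSlope R l) : HasSlope (fun w => P w + R w) fun q => k q + l q where
  cont := hP.cont.add hR.cont
  sub_eq y η z := by
    linear_combination hP.sub_eq y η z + hR.sub_eq y η z

/-- The mean value of the derivative of `G` along the segment from `v` to `w`. -/
noncomputable def meanDeriv {E : Type*} [NormedAddCommGroup E] [NormedSpace ℝ E] (G : E → ℝ)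
    (v w : E) : E →L[ℝ] ℝ :=
  ∫ s in (0 : ℝ)..1, fderiv ℝ G (v + s • (w - v))

theorem continuous_meanDeriv {E : Type*} [NormedAddCommGroup E] [NormedSpace ℝ E] {G : E → ℝ}
    (hG : ContDiff ℝ 1 G) : Continuous fun p : E × E => meanDeriv G p.1 p.2 := by
  have := hG.continuous_fderiv one_ne_zero
  exact continuous_integral_param
    (f := fun r : (E × E) × ℝ => fderiv ℝ G (r.1.1 + r.2 • (r.1.2 - r.1.1)))
    (by fun_prop) continuous_const continuous_const

theorem sub_eq_meanDeriv {E : Type*} [NormedAddCommGroup E] [NormedSpace ℝ E] {G : E → ℝ}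
    (hG : ContDiff ℝ 1 G) (v w : E) : G w - G v = meanDeriv G v w (w - v) := by
  have hc := hG.continuous_fderiv one_ne_zero
  have hd : ∀ s : ℝ, HasDerivAt (fun s : ℝ => G (v + s • (w - v)))
      (fderiv ℝ G (v + s • (w - v)) (w - v)) s := fun s => by
    have h1 : HasDerivAt (fun s : ℝ => v + s • (w - v)) (w - v) s := by
      simpa using ((hasDerivAt_id s).smul_const (w - v)).const_add v
    exact (hG.differentiable one_ne_zero _).hasFDerivAt.comp_hasDerivAt s h1
  have h2 := intervalIntegral.integral_eq_sub_of_hasDerivAt (a := 0) (b := 1) (fun s _ => hd s)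
    ((by fun_prop : Continuous fun s : ℝ =>
      fderiv ℝ G (v + s • (w - v)) (w - v)).intervalIntegrable _ _)
  rw [meanDeriv, ContinuousLinearMap.intervalIntegral_apply
    ((by fun_prop : Continuous fun s : ℝ => fderiv ℝ G (v + s • (w - v))).intervalIntegrable _ _),
    h2]
  simp

/-! ### Regularity of solutions of the integral equation -/

theorem linear_ode_formula {X A B : ℝ → ℝ} {η : ℝ} (hA : Continuous A) (hB : Continuous B)
    (hX : ∀ z, HasDerivAt X (η * A z + B z * X z) z) (c z : ℝ) :
    X z = Real.exp (∫ s in c..z, B s) *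
      (X c + η * ∫ s in c..z, Real.exp (-∫ r in c..s, B r) * A s) := by
  have hβ : ∀ s, HasDerivAt (fun s => ∫ r in c..s, B r) (B s) s := fun s =>
    intervalIntegral.integral_hasDerivAt_right (hB.intervalIntegrable _ _)
      hB.aestronglyMeasurable.stronglyMeasurableAtFilter hB.continuousAt
  have hβc : Continuous fun s => ∫ r in c..s, B r :=
    continuous_iff_continuousAt.2 fun s => (hβ s).continuousAt
  have hd : ∀ s, HasDerivAt (fun s => Real.exp (-∫ r in c..s, B r) * X s)
      (η * (Real.exp (-∫ r in c..s, B r) * A s)) s := fun s => by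
    have := (hβ s).neg.exp.mul (hX s)
    refine this.congr_deriv ?_
    rw [Pi.neg_apply]
    ring
  have := intervalIntegral.integral_eq_sub_of_hasDerivAt (a := c) (b := z) (fun s _ => hd s)
    ((by fun_prop : Continuous fun s =>
      η * (Real.exp (-∫ r in c..s, B r) * A s)).intervalIntegrable _ _)
  rw [intervalIntegral.integral_const_mul] at this
  simp only [intervalIntegral.integral_same, neg_zero, Real.exp_zero, one_mul] at this
  rw [this, add_sub_cancel, ← mul_assoc, ← Real.exp_add]
  simp

theorem hasDerivAt_integral_add_const {f : ℝ → ℝ} (hf : Continuous f) (C c z : ℝ) :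
    HasDerivAt (fun z => C + ∫ s in c..z, f s) (f z) z :=
  (intervalIntegral.integral_hasDerivAt_right (hf.intervalIntegrable _ _)
      hf.aestronglyMeasurable.stronglyMeasurableAtFilter hf.continuousAt).const_add C

/-- Differentiable dependence on the parameter `y` for the scalar equation
`∂X/∂z = G (y, z, a, b, X)`: the increment of `X` in `y` solves a linear equation, which is
integrated explicitly. -/
theorem exists_hasSlope_of_ode {G : ℝ × ℝ × ℝ × ℝ × ℝ → ℝ} (hG : ContDiff ℝ 1 G)
    {a b X h : ℝ × ℝ → ℝ} {ka kb : ℝ × ℝ × ℝ → ℝ} {X₀ c : ℝ → ℝ} {κ : ℝ}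
    (ha : HasSlope a ka) (hb : HasSlope b kb) (hac : Continuous a) (hbc : Continuous b)
    (hXc : Continuous X) (hhc : Continuous h) (hcc : Continuous c)
    (hc : ∀ y η, c (y + η) = c y + κ * η) (hX₀ : ContDiff ℝ 1 X₀)
    (hX : ∀ y z, X (y, z) = X₀ y + ∫ s in c y..z, h (y, s))
    (hh : ∀ y z, h (y, z) = G (y, z, a (y, z), b (y, z), X (y, z))) :
    ∃ k, HasSlope X k := by
  have hac' := ha.cont
  have hbc' := hb.cont
  have hX₀s := hasSlope_of_contDiff hX₀
  have hX₀c := hX₀s.cont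
  set k₀ : ℝ × ℝ × ℝ → ℝ := fun q => ∫ s in (0 : ℝ)..1, deriv X₀ (q.1 + q.2.1 * s)
  let Λ : ℝ × ℝ × ℝ → ℝ × ℝ × ℝ × ℝ × ℝ →L[ℝ] ℝ := fun q =>
    meanDeriv G (q.1, q.2.2, a (q.1, q.2.2), b (q.1, q.2.2), X (q.1, q.2.2))
      (q.1 + q.2.1, q.2.2, a (q.1 + q.2.1, q.2.2), b (q.1 + q.2.1, q.2.2), X (q.1 + q.2.1, q.2.2))
  have hΛ : Continuous Λ := (continuous_meanDeriv hG).comp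
    (f := fun q : ℝ × ℝ × ℝ =>
      ((q.1, q.2.2, a (q.1, q.2.2), b (q.1, q.2.2), X (q.1, q.2.2)),
      (q.1 + q.2.1, q.2.2, a (q.1 + q.2.1, q.2.2), b (q.1 + q.2.1, q.2.2),
        X (q.1 + q.2.1, q.2.2)))) (by fun_prop)
  let A : ℝ × ℝ × ℝ → ℝ := fun q => Λ q (1, 0, ka q, kb q, 0)
  let B : ℝ × ℝ × ℝ → ℝ := fun q => Λ q (0, 0, 0, 0, 1)
  have hA : Continuous A := hΛ.clm_apply (by fun_prop)
  have hB : Continuous B := hΛ.clm_apply (by fun_prop)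
  let β : (ℝ × ℝ × ℝ) → ℝ := fun q => ∫ s in c q.1..q.2.2, B (q.1, q.2.1, s)
  have hβ : Continuous β := continuous_integral_param
    (f := fun r : (ℝ × ℝ × ℝ) × ℝ => B (r.1.1, r.1.2.1, r.2))
    (by fun_prop) (by fun_prop) (by fun_prop)
  let I : (ℝ × ℝ × ℝ) → ℝ := fun q => ∫ s in c q.1..q.2.2,
    Real.exp (-β (q.1, q.2.1, s)) * A (q.1, q.2.1, s)
  have hI : Continuous I := continuous_integral_param
    (f := fun r : (ℝ × ℝ × ℝ) × ℝ =>
      Real.exp (-β (r.1.1, r.1.2.1, r.2)) * A (r.1.1, r.1.2.1, r.2))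
    (by fun_prop) (by fun_prop) (by fun_prop)
  let J : (ℝ × ℝ × ℝ) → ℝ := fun q =>
    κ * ∫ s in (0 : ℝ)..1, h (q.1 + q.2.1, c q.1 + (κ * q.2.1) * s)
  have hJ : Continuous J := continuous_const.mul (continuous_integral_param
      (f := fun r : (ℝ × ℝ × ℝ) × ℝ => h (r.1.1 + r.1.2.1, c r.1.1 + (κ * r.1.2.1) * r.2))
      (by fun_prop) continuous_const continuous_const)
  refine ⟨fun q => Real.exp (β q) * (k₀ q - J q + I q), by fun_prop, fun y η z => ?_⟩
  have hXz : ∀ y z, HasDerivAt (fun z => X (y, z)) (h (y, z)) z := fun y z => by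
    simp only [hX]
    exact hasDerivAt_integral_add_const (f := fun s => h (y, s)) (by fun_prop) _ _ _
  have hode : ∀ z, HasDerivAt (fun z => X (y + η, z) - X (y, z))
      (η * A (y, η, z) + B (y, η, z) * (X (y + η, z) - X (y, z))) z := fun z => by
    refine ((hXz (y + η) z).sub (hXz y z)).congr_deriv (Eq.symm ?_)
    rw [hh, hh, sub_eq_meanDeriv hG, ← smul_eq_mul η, mul_comm (B _), ← smul_eq_mul (_ - _)]
    change η • Λ (y, η, z) _ + _ • Λ (y, η, z) _ = Λ (y, η, z) _
    rw [← map_smul, ← map_smul, ← map_add]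
    congr 1
    simp [ha.sub_eq, hb.sub_eq]
  have hform := linear_ode_formula (A := fun z => A (y, η, z)) (B := fun z => B (y, η, z))
    (by fun_prop) (by fun_prop) hode (c y) z
  -- the data curve moves by `κ η`, which contributes the term `J`
  have hstart : X (y + η, c y) - X (y, c y) = η * (k₀ (y, η, z) - J (y, η, z)) := by
    have h0 := hX₀s.sub_eq y η z
    have h1 : ∫ s in c (y + η)..c y, h (y + η, s) = -(η * J (y, η, z)) := by
      rw [intervalIntegral.integral_symm, hc, integral_add_eq_mul]
      simp only [J]
      ring
    rw [hX, hX, h1, intervalIntegral.integral_same]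
    linear_combination h0
  rw [hform, hstart]
  simp only [β, I]
  ring

/-- The integrated form of the hyperbolic equation `V_yz = g (y, z, V, V_y, V_z)`, as an equation
for `h = V_yz`: the three integrals are `V`, `V_y` and `V_z`, with data `V₀`, `P₀`, `Q₀` prescribed
on the curve `z = c y`. The curve is the initial line `z = y` for the Cauchy problem, and
`c` is the constant `x₀` for the Goursat problem. -/
noncomputable def volP (c P₀ : ℝ → ℝ) (h : ℝ × ℝ → ℝ) (w : ℝ × ℝ) : ℝ :=
  P₀ w.1 + ∫ s in c w.1..w.2, h (w.1, s)

/-- See `volP`. -/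
noncomputable def volQ (c Q₀ : ℝ → ℝ) (h : ℝ × ℝ → ℝ) (w : ℝ × ℝ) : ℝ :=
  Q₀ w.2 + ∫ s in c w.2..w.1, h (s, w.2)

/-- See `volP`. -/
noncomputable def volV (c V₀ Q₀ : ℝ → ℝ) (h : ℝ × ℝ → ℝ) (w : ℝ × ℝ) : ℝ :=
  V₀ w.1 + ∫ s in c w.1..w.2, volQ c Q₀ h (w.1, s)

/-- The map whose fixed points are the mixed derivatives `h = V_yz` of the solutions. -/
noncomputable def volMap (c V₀ P₀ Q₀ : ℝ → ℝ) (g : ℝ × ℝ × ℝ × ℝ × ℝ → ℝ) (h : ℝ × ℝ → ℝ)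
    (w : ℝ × ℝ) : ℝ :=
  g (w.1, w.2, volV c V₀ Q₀ h w, volP c P₀ h w, volQ c Q₀ h w)

section continuity
variable {c V₀ P₀ Q₀ : ℝ → ℝ} {g : ℝ × ℝ × ℝ × ℝ × ℝ → ℝ} {h : ℝ × ℝ → ℝ}

theorem continuous_volP (hc : Continuous c) (hP : Continuous P₀) (hh : Continuous h) :
    Continuous (volP c P₀ h) :=
  (hP.comp continuous_fst).add (continuous_integral_param
    (f := fun r : (ℝ × ℝ) × ℝ => h (r.1.1, r.2)) (by fun_prop) (by fun_prop) (by fun_prop))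

theorem continuous_volQ (hc : Continuous c) (hQ : Continuous Q₀) (hh : Continuous h) :
    Continuous (volQ c Q₀ h) :=
  (hQ.comp continuous_snd).add (continuous_integral_param
    (f := fun r : (ℝ × ℝ) × ℝ => h (r.2, r.1.2)) (by fun_prop) (by fun_prop) (by fun_prop))

theorem continuous_volV (hc : Continuous c) (hV : Continuous V₀) (hQ : Continuous Q₀)
    (hh : Continuous h) : Continuous (volV c V₀ Q₀ h) := by
  have := continuous_volQ hc hQ hh
  exact (hV.comp continuous_fst).add (continuous_integral_param
    (f := fun r : (ℝ × ℝ) × ℝ => volQ c Q₀ h (r.1.1, r.2))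
    (by fun_prop) (by fun_prop) (by fun_prop))

theorem continuous_volMap (hc : Continuous c) (hV : Continuous V₀) (hP : Continuous P₀)
    (hQ : Continuous Q₀) (hg : Continuous g) (hh : Continuous h) :
    Continuous (volMap c V₀ P₀ Q₀ g h) := by
  have h1 := continuous_volQ hc hQ hh
  have h2 := continuous_volP hc hP hh
  have h3 := continuous_volV hc hV hQ hh
  unfold volMap
  fun_prop

end continuity

/-- A continuous fixed point of `volMap` gives a `C²` function `V` with `V_y = P` and `V_z = Q`.
The condition `hcomp` makes the data compatible: it is the derivative of `V (y, c y) = V₀ y` along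
the data curve, of slope `κ`. -/
theorem volV_regularity {c V₀ P₀ Q₀ : ℝ → ℝ} {g : ℝ × ℝ × ℝ × ℝ × ℝ → ℝ} {h : ℝ × ℝ → ℝ} {κ : ℝ}
    (hcc : Continuous c) (hc : ∀ y η, c (y + η) = c y + κ * η) (hκ : ∀ y, κ = 0 ∨ c (c y) = y)
    (hV : ContDiff ℝ 2 V₀) (hP : ContDiff ℝ 1 P₀) (hQ : ContDiff ℝ 1 Q₀)
    (hcomp : ∀ y, P₀ y = deriv V₀ y - κ * Q₀ (c y)) (hg : ContDiff ℝ 1 g) (hh : Continuous h)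
    (hfix : ∀ w, volMap c V₀ P₀ Q₀ g h w = h w) :
    (∀ w, HasFDerivAt (volV c V₀ Q₀ h) (volP c P₀ h w • ContinuousLinearMap.fst ℝ ℝ ℝ
      + volQ c Q₀ h w • ContinuousLinearMap.snd ℝ ℝ ℝ) w) ∧
    ContDiff ℝ 1 (volP c P₀ h) ∧ ContDiff ℝ 1 (volQ c Q₀ h) ∧
    ContDiff ℝ 2 (volV c V₀ Q₀ h) := by
  have cQ := continuous_volQ hcc hQ.continuous hh
  have cP := continuous_volP hcc hP.continuous hh
  have cV := continuous_volV hcc hV.continuous hQ.continuous hh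
  have dPz : ∀ y z, HasDerivAt (fun s => volP c P₀ h (y, s)) (h (y, z)) z := fun y z =>
    hasDerivAt_integral_add_const (f := fun s => h (y, s)) (by fun_prop) (P₀ y) (c y) z
  have dQy : ∀ y z, HasDerivAt (fun s => volQ c Q₀ h (s, z)) (h (y, z)) y := fun y z =>
    hasDerivAt_integral_add_const (f := fun s => h (s, z)) (by fun_prop) (Q₀ z) (c z) y
  have dVz : ∀ y z, HasDerivAt (fun s => volV c V₀ Q₀ h (y, s)) (volQ c Q₀ h (y, z)) z :=
    fun y z => hasDerivAt_integral_add_const (f := fun s => volQ c Q₀ h (y, s))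
      (by fun_prop) (V₀ y) (c y) z
  have sQ := HasSlope.of_hasDerivAt dQy hh
  have sV : HasSlope (volV c V₀ Q₀ h) _ :=
    (hasSlope_of_contDiff (hV.of_le one_le_two)).add (sQ.integral cQ hcc hc)
  have eV := sV.hasFDerivAt dVz cQ
  have hVP : ∀ w, HasFDerivAt (volV c V₀ Q₀ h) (volP c P₀ h w • ContinuousLinearMap.fst ℝ ℝ ℝ
      + volQ c Q₀ h w • ContinuousLinearMap.snd ℝ ℝ ℝ) w := fun w => by
    convert eV w using 3
    have hz : κ * volQ c Q₀ h (w.1, c w.1) = κ * Q₀ (c w.1) := by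
      rcases hκ w.1 with h0 | h0
      · simp [h0]
      · simp [volQ, h0]
    simp [volP, hcomp, hz]
    ring
  have dVy : ∀ y z, HasDerivAt (fun s => volV c V₀ Q₀ h (s, z)) (volP c P₀ h (y, z)) y :=
    fun y z => by
      have h1 : HasDerivAt (fun s : ℝ => (s, z)) ((1 : ℝ), (0 : ℝ)) y :=
        (hasDerivAt_id y).prodMk (hasDerivAt_const y z)
      have h2 := (hVP (y, z)).comp_hasDerivAt y h1
      refine HasDerivAt.congr_deriv h2 ?_
      simp
  have sV' := HasSlope.of_hasDerivAt dVy cP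
  obtain ⟨kP, hkP⟩ := exists_hasSlope_of_ode
    (G := fun q => g (q.1, q.2.1, q.2.2.1, q.2.2.2.2, q.2.2.2.1)) (a := volV c V₀ Q₀ h)
    (b := volQ c Q₀ h) (X := volP c P₀ h) (by fun_prop) sV' sQ cV cQ cP hh hcc hc hP
    (fun y z => rfl) (fun y z => (hfix (y, z)).symm)
  -- the same argument with the roles of `y` and `z` exchanged gives the regularity of `V_z`
  have rV := HasSlope.of_hasDerivAt (P := fun w => volV c V₀ Q₀ h (w.2, w.1))
    (P' := fun w => volQ c Q₀ h (w.2, w.1)) (fun z y => dVz y z) (by fun_prop)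
  have rP := HasSlope.of_hasDerivAt (P := fun w => volP c P₀ h (w.2, w.1))
    (P' := fun w => h (w.2, w.1)) (fun z y => dPz y z) (by fun_prop)
  obtain ⟨kQ, hkQ⟩ := exists_hasSlope_of_ode
    (G := fun q => g (q.2.1, q.1, q.2.2.1, q.2.2.2.1, q.2.2.2.2))
    (a := fun w => volV c V₀ Q₀ h (w.2, w.1)) (h := fun w => h (w.2, w.1))
    (b := fun w => volP c P₀ h (w.2, w.1)) (X := fun w => volQ c Q₀ h (w.2, w.1))
    (by fun_prop) rV rP (by fun_prop) (by fun_prop) (by fun_prop) (by fun_prop) hcc hc hQ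
    (fun y z => rfl) (fun y z => (hfix (z, y)).symm)
  have kPc := hkP.cont
  have kQc := hkQ.cont
  have hP1 : ContDiff ℝ 1 (volP c P₀ h) :=
    contDiff_one_of_hasFDerivAt (by fun_prop) hh (hkP.hasFDerivAt dPz hh)
  have hQ1 : ContDiff ℝ 1 fun w : ℝ × ℝ => volQ c Q₀ h (w.2, w.1) :=
    contDiff_one_of_hasFDerivAt (q := fun w => h (w.2, w.1)) (by fun_prop) (by fun_prop)
      (hkQ.hasFDerivAt (h := fun w => h (w.2, w.1)) (fun z y => dQy y z) (by fun_prop))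
  have hQ2 : ContDiff ℝ 1 (volQ c Q₀ h) :=
    hQ1.comp (contDiff_snd.prodMk contDiff_fst : ContDiff ℝ 1 fun w : ℝ × ℝ => (w.2, w.1))
  exact ⟨hVP, hP1, hQ2, contDiff_two_of_hasFDerivAt hP1 hQ2 hVP⟩

/-! ### The contraction: uniqueness and existence of the fixed point -/

/-- `D` contains, with each of its points, the horizontal and the vertical segment that join it to
the data curve `z = c y` (which is also `y = c z` in both cases of interest). -/
def SegmentClosed (c : ℝ → ℝ) (D : Set (ℝ × ℝ)) : Prop :=
  ∀ y z, (y, z) ∈ D → (∀ s ∈ uIcc (c y) z, (y, s) ∈ D) ∧ ∀ s ∈ uIcc (c z) y, (s, z) ∈ D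

/-- A positive weight that loses a factor `K` under the integrations of `volP` and `volQ`. -/
structure IsWeight (c : ℝ → ℝ) (K : ℝ) (W : ℝ × ℝ → ℝ) : Prop where
  cont : Continuous W
  pos : ∀ w, 0 < W w
  abs_le_fst : ∀ y z, |∫ s in c y..z, W (y, s)| ≤ W (y, z) / K
  abs_le_snd : ∀ y z, |∫ s in c z..y, W (s, z)| ≤ W (y, z) / K

theorem abs_integral_exp_le {K : ℝ} (hK : 0 < K) (c z : ℝ) :
    |∫ s in c..z, Real.exp (K * |s - c|)| ≤ Real.exp (K * |z - c|) / K := by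
  have key : ∀ r : ℝ, 0 ≤ r → |∫ s in (0 : ℝ)..r, Real.exp (K * |s|)| ≤ Real.exp (K * r) / K := by
    intro r hr
    have h1 : ∫ s in (0 : ℝ)..r, Real.exp (K * |s|) = ∫ s in (0 : ℝ)..r, Real.exp (K * s) := by
      refine intervalIntegral.integral_congr fun s hs => ?_
      rw [uIcc_of_le hr] at hs
      simp only [abs_of_nonneg hs.1]
    have h2 : ∫ s in (0 : ℝ)..r, Real.exp (K * s) = (Real.exp (K * r) - 1) / K := by
      rw [intervalIntegral.integral_comp_mul_left _ hK.ne', integral_exp]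
      simp [div_eq_inv_mul]
    rw [h1, h2, abs_of_nonneg (div_nonneg
      (sub_nonneg.2 (Real.one_le_exp (by positivity))) hK.le)]
    gcongr
    linarith
  have h0 : ∫ s in c..z, Real.exp (K * |s - c|) = ∫ s in (0 : ℝ)..(z - c), Real.exp (K * |s|) := by
    rw [intervalIntegral.integral_comp_sub_right (fun s => Real.exp (K * |s|)), sub_self]
  rw [h0]
  rcases le_total 0 (z - c) with h | h
  · rw [abs_of_nonneg h]
    exact key _ h
  · have h3 : ∫ s in (0 : ℝ)..(z - c), Real.exp (K * |s|)
        = -∫ s in (0 : ℝ)..(-(z - c)), Real.exp (K * |s|) := by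
      have := intervalIntegral.integral_comp_neg (a := 0) (b := -(z - c))
        (fun s => Real.exp (K * |s|))
      simp only [abs_neg, neg_neg, neg_zero] at this
      rw [this, ← intervalIntegral.integral_symm]
    rw [h3, abs_neg, abs_of_nonpos h]
    exact key _ (by linarith)

theorem isWeight_cauchy {K : ℝ} (hK : 0 < K) :
    IsWeight id K fun w => Real.exp (K * |w.2 - w.1|) where
  cont := by fun_prop
  pos _ := Real.exp_pos _
  abs_le_fst y z := abs_integral_exp_le hK y z
  abs_le_snd y z := by
    simp only [abs_sub_comm z]
    exact abs_integral_exp_le hK z y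

theorem isWeight_goursat {K : ℝ} (hK : 0 < K) (m : ℝ) :
    IsWeight (fun _ => m) K fun w => Real.exp (K * |w.1 - m|) * Real.exp (K * |w.2 - m|) where
  cont := by fun_prop
  pos _ := by positivity
  abs_le_fst y z := by
    simp only
    rw [intervalIntegral.integral_const_mul, abs_mul, Real.abs_exp, mul_div_assoc]
    exact mul_le_mul_of_nonneg_left (abs_integral_exp_le hK m z) (Real.exp_pos _).le
  abs_le_snd y z := by
    simp only
    rw [intervalIntegral.integral_mul_const, abs_mul, Real.abs_exp, mul_div_right_comm]
    exact mul_le_mul_of_nonneg_right (abs_integral_exp_le hK m y) (Real.exp_pos _).le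

theorem abs_integral_le_weight {e W : ℝ → ℝ} {B M a b : ℝ} (hB : 0 ≤ B) (hW : Continuous W)
    (h : ∀ s ∈ uIcc a b, |e s| ≤ B * W s) (hM : |∫ s in a..b, W s| ≤ M) :
    |∫ s in a..b, e s| ≤ B * M := by
  have h1 : ‖∫ s in a..b, e s‖ ≤ |∫ s in a..b, B * W s| :=
    intervalIntegral.norm_integral_le_abs_of_norm_le
      ((ae_restrict_mem measurableSet_uIoc).mono fun s hs => h s (uIoc_subset_uIcc hs))
      ((hW.const_mul B).intervalIntegrable _ _)
  rw [intervalIntegral.integral_const_mul, abs_mul, abs_of_nonneg hB, Real.norm_eq_abs] at h1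
  exact h1.trans (mul_le_mul_of_nonneg_left hM hB)

/-- `g` is Lipschitz with constant `Λ` in its last three arguments. -/
def LipschitzTail (Λ : ℝ) (g : ℝ × ℝ × ℝ × ℝ × ℝ → ℝ) : Prop :=
  ∀ y z u p q u' p' q', |g (y, z, u, p, q) - g (y, z, u', p', q')|
    ≤ Λ * (|u - u'| + |p - p'| + |q - q'|)

section contraction

variable {c V₀ P₀ Q₀ : ℝ → ℝ} {g : ℝ × ℝ × ℝ × ℝ × ℝ → ℝ} {Λ K : ℝ} {W : ℝ × ℝ → ℝ}
  {D : Set (ℝ × ℝ)}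

/-- If `K` is large compared with `Λ`, then `volMap` halves distances measured relative to the
weight. -/
theorem volMap_contraction {h k : ℝ × ℝ → ℝ} {B : ℝ} (hc : Continuous c) (hQ : Continuous Q₀)
    (hΛ : 0 ≤ Λ) (hg : LipschitzTail Λ g) (hK : 0 < K) (hΛK : Λ * (1 / K ^ 2 + 2 / K) ≤ 1 / 2)
    (hW : IsWeight c K W) (hD : SegmentClosed c D) (hh : Continuous h) (hk : Continuous k)
    (hB : 0 ≤ B) (hhk : ∀ w ∈ D, |h w - k w| ≤ B * W w) :
    ∀ w ∈ D, |volMap c V₀ P₀ Q₀ g h w - volMap c V₀ P₀ Q₀ g k w| ≤ B / 2 * W w := by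
  have hWc := hW.cont
  have hQQ : ∀ w ∈ D, |volQ c Q₀ h w - volQ c Q₀ k w| ≤ B / K * W w := by
    rintro ⟨y, z⟩ hw
    have h1 : volQ c Q₀ h (y, z) - volQ c Q₀ k (y, z) = ∫ s in c z..y, (h (s, z) - k (s, z)) := by
      rw [intervalIntegral.integral_sub]
      · simp [volQ]
      all_goals exact Continuous.intervalIntegrable (by fun_prop) _ _
    rw [h1]
    refine (abs_integral_le_weight (W := fun s => W (s, z)) hB (by fun_prop)
      (fun s hs => hhk _ ((hD y z hw).2 s hs)) (hW.abs_le_snd y z)).trans_eq ?_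
    ring
  have hPP : ∀ w ∈ D, |volP c P₀ h w - volP c P₀ k w| ≤ B / K * W w := by
    rintro ⟨y, z⟩ hw
    have h1 : volP c P₀ h (y, z) - volP c P₀ k (y, z) = ∫ s in c y..z, (h (y, s) - k (y, s)) := by
      rw [intervalIntegral.integral_sub]
      · simp [volP]
      all_goals exact Continuous.intervalIntegrable (by fun_prop) _ _
    rw [h1]
    refine (abs_integral_le_weight (W := fun s => W (y, s)) hB (by fun_prop)
      (fun s hs => hhk _ ((hD y z hw).1 s hs)) (hW.abs_le_fst y z)).trans_eq ?_
    ring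
  have hVV : ∀ w ∈ D, |volV c V₀ Q₀ h w - volV c V₀ Q₀ k w| ≤ B / K ^ 2 * W w := by
    rintro ⟨y, z⟩ hw
    have c1 := continuous_volQ hc hQ hh
    have c2 := continuous_volQ hc hQ hk
    have h1 : volV c V₀ Q₀ h (y, z) - volV c V₀ Q₀ k (y, z)
        = ∫ s in c y..z, (volQ c Q₀ h (y, s) - volQ c Q₀ k (y, s)) := by
      rw [intervalIntegral.integral_sub]
      · simp [volV]
      all_goals exact Continuous.intervalIntegrable (by fun_prop) _ _
    rw [h1]
    refine (abs_integral_le_weight (W := fun s => W (y, s)) (by positivity : 0 ≤ B / K)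
      (by fun_prop) (fun s hs => hQQ _ ((hD y z hw).1 s hs)) (hW.abs_le_fst y z)).trans_eq ?_
    field_simp
  intro w hw
  calc |volMap c V₀ P₀ Q₀ g h w - volMap c V₀ P₀ Q₀ g k w|
      ≤ Λ * (|volV c V₀ Q₀ h w - volV c V₀ Q₀ k w| + |volP c P₀ h w - volP c P₀ k w|
        + |volQ c Q₀ h w - volQ c Q₀ k w|) := hg _ _ _ _ _ _ _ _
    _ ≤ Λ * (B / K ^ 2 * W w + B / K * W w + B / K * W w) := by
        gcongr
        exacts [hVV w hw, hPP w hw, hQQ w hw]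
    _ = Λ * (1 / K ^ 2 + 2 / K) * (B * W w) := by ring
    _ ≤ 1 / 2 * (B * W w) := by
        have := (hW.pos w).le
        gcongr
    _ = B / 2 * W w := by ring

/-- On a compact set a continuous function is dominated by a multiple of the weight. -/
theorem IsWeight.exists_bound (hW : IsWeight c K W) {E : Set (ℝ × ℝ)} (hE : IsCompact E)
    {e : ℝ × ℝ → ℝ} (he : Continuous e) : ∃ B, 0 ≤ B ∧ ∀ w ∈ E, |e w| ≤ B * W w := by
  have hWc := hW.cont
  obtain ⟨B, hB⟩ := hE.exists_bound_of_continuousOn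
    (f := fun w => e w / W w) (he.div hWc fun w => (hW.pos w).ne').continuousOn
  refine ⟨|B|, abs_nonneg B, fun w hw => ?_⟩
  have := (hB w hw).trans (le_abs_self B)
  rwa [Real.norm_eq_abs, abs_div, abs_of_pos (hW.pos w), div_le_iff₀ (hW.pos w)] at this

/-- The square of half-side `R` about `(m, m)`. -/
def square (m R : ℝ) : Set (ℝ × ℝ) := Icc (m - R) (m + R) ×ˢ Icc (m - R) (m + R)

theorem isCompact_square (m R : ℝ) : IsCompact (square m R) := isCompact_Icc.prod isCompact_Icc

theorem mem_square {m R : ℝ} {w : ℝ × ℝ} : w ∈ square m R ↔ |w.1 - m| ≤ R ∧ |w.2 - m| ≤ R := by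
  simp only [square, mem_prod, mem_Icc, abs_le]
  constructor <;> rintro ⟨⟨h1, h2⟩, h3, h4⟩ <;> refine ⟨⟨?_, ?_⟩, ?_, ?_⟩ <;> linarith

theorem segmentClosed_square {m R : ℝ} (hc : ∀ y, |c y - m| ≤ |y - m|) :
    SegmentClosed c (square m R) := by
  have hcs : ∀ y ∈ Icc (m - R) (m + R), c y ∈ Icc (m - R) (m + R) := fun y hy => by
    have h1 : |y - m| ≤ R := abs_le.2 ⟨by linarith [hy.1], by linarith [hy.2]⟩
    have := abs_le.1 ((hc y).trans h1)
    exact ⟨by linarith, by linarith⟩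
  intro y z hw
  exact ⟨fun s hs => ⟨hw.1, ordConnected_Icc.uIcc_subset (hcs y hw.1) hw.2 hs⟩,
    fun s hs => ⟨ordConnected_Icc.uIcc_subset (hcs z hw.2) hw.1 hs, hw.2⟩⟩

theorem SegmentClosed.inter {E : Set (ℝ × ℝ)} (hD : SegmentClosed c D) (hE : SegmentClosed c E) :
    SegmentClosed c (D ∩ E) := fun y z hw =>
  ⟨fun s hs => ⟨(hD y z hw.1).1 s hs, (hE y z hw.2).1 s hs⟩,
    fun s hs => ⟨(hD y z hw.1).2 s hs, (hE y z hw.2).2 s hs⟩⟩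

theorem exists_mem_square (m : ℝ) (w : ℝ × ℝ) : ∃ R, w ∈ square m R :=
  ⟨|w.1 - m| + |w.2 - m|, mem_square.2 ⟨by simp, by simp⟩⟩

theorem exists_contraction_constant (hΛ : 0 ≤ Λ) :
    ∃ K, 0 < K ∧ Λ * (1 / K ^ 2 + 2 / K) ≤ 1 / 2 := by
  -- `K ≥ 1` bounds the bracket by `3 / K`, so that `K ≥ 6 Λ` is enough
  refine ⟨6 * (Λ + 1), by positivity, ?_⟩
  have h1 : 1 / (6 * (Λ + 1)) ^ 2 ≤ 1 / (6 * (Λ + 1)) := by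
    apply one_div_le_one_div_of_le (by positivity)
    nlinarith
  calc Λ * (1 / (6 * (Λ + 1)) ^ 2 + 2 / (6 * (Λ + 1)))
      ≤ Λ * (1 / (6 * (Λ + 1)) + 2 / (6 * (Λ + 1))) := by gcongr
    _ = Λ / (Λ + 1) * (1 / 2) := by field_simp; ring
    _ ≤ 1 * (1 / 2) := by
        gcongr
        exact (div_le_one (by positivity)).2 (by linarith)
    _ = 1 / 2 := one_mul _

theorem volMap_fixedPoint_unique {m : ℝ} {h k : ℝ × ℝ → ℝ} (hc : Continuous c)
    (hcm : ∀ y, |c y - m| ≤ |y - m|) (hQ : Continuous Q₀)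
    (hΛ : 0 ≤ Λ) (hg : LipschitzTail Λ g) (hweight : ∀ K, 0 < K → ∃ W, IsWeight c K W)
    (hD : SegmentClosed c D) (hh : Continuous h) (hk : Continuous k)
    (hfh : ∀ w ∈ D, volMap c V₀ P₀ Q₀ g h w = h w)
    (hfk : ∀ w ∈ D, volMap c V₀ P₀ Q₀ g k w = k w) : EqOn h k D := by
  intro w hw
  obtain ⟨K, hK, hΛK⟩ := exists_contraction_constant hΛ
  obtain ⟨W, hW⟩ := hweight K hK
  obtain ⟨R, hR⟩ := exists_mem_square m w
  obtain ⟨B, hB, hhk⟩ := hW.exists_bound (isCompact_square m R) (hh.sub hk)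
  have hDR := hD.inter (segmentClosed_square (R := R) hcm)
  have iter : ∀ n : ℕ, ∀ w ∈ D ∩ square m R, |h w - k w| ≤ B * (1 / 2) ^ n * W w := by
    intro n
    induction n with
    | zero => intro w hw; simpa using hhk w hw.2
    | succ n ih =>
      intro w hw
      have := volMap_contraction (V₀ := V₀) (P₀ := P₀) hc hQ hΛ hg hK hΛK hW hDR hh hk
        (by positivity) ih w hw
      rw [hfh w hw.1, hfk w hw.1] at this
      refine this.trans_eq ?_
      ring
  have hlim : Filter.Tendsto (fun n : ℕ => B * (1 / 2 : ℝ) ^ n * W w) Filter.atTop (nhds 0) := by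
    have := ((tendsto_pow_atTop_nhds_zero_of_lt_one (by norm_num : (0 : ℝ) ≤ 1 / 2)
      (by norm_num)).const_mul B).mul_const (W w)
    simpa using this
  have := ge_of_tendsto' hlim fun n => iter n w ⟨hw, hR⟩
  exact sub_eq_zero.1 (abs_nonpos_iff.1 this)

/-- Picard iteration: the telescoping series of the iterates of `volMap` converges uniformly on
each square, with geometric rate relative to the weight. -/
theorem exists_volMap_fixedPoint {m : ℝ} (hc : Continuous c)
    (hcm : ∀ y, |c y - m| ≤ |y - m|) (hV : Continuous V₀) (hP : Continuous P₀)
    (hQ : Continuous Q₀) (hgc : Continuous g)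
    (hΛ : 0 ≤ Λ) (hg : LipschitzTail Λ g) (hweight : ∀ K, 0 < K → ∃ W, IsWeight c K W) :
    ∃ h : ℝ × ℝ → ℝ, Continuous h ∧ ∀ w, volMap c V₀ P₀ Q₀ g h w = h w := by
  obtain ⟨K, hK, hΛK⟩ := exists_contraction_constant hΛ
  obtain ⟨W, hW⟩ := hweight K hK
  let Φ := volMap c V₀ P₀ Q₀ g
  let x : ℕ → ℝ × ℝ → ℝ := fun n => Φ^[n] 0
  have hx : ∀ n, x (n + 1) = Φ (x n) := fun n => Function.iterate_succ_apply' Φ n 0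
  have hxc : ∀ n, Continuous (x n) := by
    intro n
    induction n with
    | zero => exact continuous_const
    | succ n ih => rw [hx]; exact continuous_volMap hc hV hP hQ hgc ih
  have hstep : ∀ R, ∃ B, 0 ≤ B ∧ ∀ n, ∀ w ∈ square m R,
      |x (n + 1) w - x n w| ≤ B * (1 / 2) ^ n * W w := by
    intro R
    obtain ⟨B, hB, h0⟩ := hW.exists_bound (isCompact_square m R) ((hxc 1).sub (hxc 0))
    refine ⟨B, hB, fun n => ?_⟩
    induction n with
    | zero => intro w hw; simpa using h0 w hw
    | succ n ih =>
      intro w hw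
      rw [hx (n + 1), show x (n + 1) w = Φ (x n) w by rw [hx]]
      refine (volMap_contraction (V₀ := V₀) (P₀ := P₀) hc hQ hΛ hg hK hΛK hW
        (segmentClosed_square hcm) (hxc (n + 1)) (hxc n) (by positivity) ih w hw).trans_eq ?_
      ring
  have hgeo : Summable fun n : ℕ => (1 / 2 : ℝ) ^ n := summable_geometric_two
  let h : ℝ × ℝ → ℝ := fun w => ∑' n, (x (n + 1) w - x n w)
  have hsum : ∀ w, Summable fun n => x (n + 1) w - x n w := fun w => by
    obtain ⟨R, hR⟩ := exists_mem_square m w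
    obtain ⟨B, hB, hb⟩ := hstep R
    exact Summable.of_norm_bounded ((hgeo.mul_left B).mul_right (W w)) fun n => hb n w hR
  have hcont : Continuous h := by
    rw [continuous_iff_continuousAt]
    intro w
    obtain ⟨R, hR⟩ := exists_mem_square m w
    obtain ⟨B, hB, hb⟩ := hstep (R + 1)
    obtain ⟨M, hM⟩ := (isCompact_square m (R + 1)).exists_bound_of_continuousOn hW.cont.continuousOn
    have h1 : ContinuousOn h (square m (R + 1)) := by
      refine continuousOn_tsum (u := fun n => B * (1 / 2) ^ n * M)
        (fun n => ((hxc (n + 1)).sub (hxc n)).continuousOn)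
        ((hgeo.mul_left B).mul_right M) fun n w hw => (hb n w hw).trans ?_
      have := (le_abs_self _).trans (hM w hw)
      gcongr
    refine h1.continuousAt ?_
    rw [mem_square] at hR
    have hopen : IsOpen {v : ℝ × ℝ | |v.1 - m| < R + 1 ∧ |v.2 - m| < R + 1} :=
      (isOpen_lt (f := fun v : ℝ × ℝ => |v.1 - m|) (by fun_prop) continuous_const).inter
        (isOpen_lt (f := fun v : ℝ × ℝ => |v.2 - m|) (by fun_prop) continuous_const)
    exact Filter.mem_of_superset (hopen.mem_nhds ⟨by linarith [hR.1], by linarith [hR.2]⟩)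
      fun v hv => mem_square.2 ⟨hv.1.le, hv.2.le⟩
  have htail : ∀ R, ∃ B, 0 ≤ B ∧ ∀ n, ∀ w ∈ square m R, |h w - x n w| ≤ B * (1 / 2) ^ n * W w := by
    intro R
    obtain ⟨B, hB, hb⟩ := hstep R
    refine ⟨B * 2, by positivity, fun n w hw => ?_⟩
    have e1 : h w - x n w = ∑' i, (x (i + n + 1) w - x (i + n) w) := by
      have e2 := (hsum w).sum_add_tsum_nat_add n
      have e3 := Finset.sum_range_sub (fun i => x i w) n
      have e4 : x 0 w = 0 := rfl
      simp only [h]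
      rw [← e2, e3, e4]
      ring
    rw [e1, ← Real.norm_eq_abs]
    have hs : HasSum (fun i : ℕ => B * (1 / 2) ^ n * W w * (1 / 2) ^ i)
        (B * (1 / 2) ^ n * W w * 2) := hasSum_geometric_two.mul_left _
    refine (tsum_of_norm_bounded hs fun i => ?_).trans_eq (by ring)
    rw [Real.norm_eq_abs]
    refine (hb (i + n) w hw).trans_eq ?_
    ring
  refine ⟨h, hcont, fun w => ?_⟩
  obtain ⟨R, hR⟩ := exists_mem_square m w
  obtain ⟨B, hB, hb⟩ := htail R
  have hle : ∀ n, |Φ h w - h w| ≤ B * W w * (1 / 2) ^ n := fun n => by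
    have h1 := volMap_contraction (V₀ := V₀) (P₀ := P₀) hc hQ hΛ hg hK hΛK hW
        (segmentClosed_square hcm) hcont (hxc n) (by positivity) (hb n) w hR
    have h2 := hb (n + 1) w hR
    rw [hx] at h2
    have h3 := abs_sub_le (Φ h w) (Φ (x n) w) (h w)
    rw [abs_sub_comm (Φ (x n) w)] at h3
    change |Φ h w - Φ (x n) w| ≤ _ at h1
    have h4 : B * (1 / 2) ^ n / 2 * W w + B * (1 / 2) ^ (n + 1) * W w
      = B * W w * (1 / 2) ^ n := by ring
    linarith
  have hlim : Filter.Tendsto (fun n : ℕ => B * W w * (1 / 2 : ℝ) ^ n) Filter.atTop (nhds 0) := by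
    have := (tendsto_pow_atTop_nhds_zero_of_lt_one (by norm_num : (0 : ℝ) ≤ 1 / 2)
      (by norm_num)).const_mul (B * W w)
    simpa using this
  exact sub_eq_zero.1 (abs_nonpos_iff.1 (ge_of_tendsto' hlim hle))

end contraction

/-! ### Characteristic coordinates -/

theorem integral_eq_sub_of_hasDerivWithinAt_uIcc {f f' : ℝ → ℝ} {a b : ℝ}
    (h : ∀ x ∈ uIcc a b, HasDerivWithinAt f (f' x) (uIcc a b) x)
    (hc : ContinuousOn f' (uIcc a b)) : ∫ x in a..b, f' x = f b - f a := by
  refine intervalIntegral.integral_eq_sub_of_hasDeriv_right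
    (fun x hx => (h x hx).continuousWithinAt) (fun x hx => ?_) hc.intervalIntegrable
  have hx' : x ∈ uIcc a b := Ioo_subset_Icc_self hx
  exact ((h x hx').hasDerivAt (Icc_mem_nhds hx.1 hx.2)).hasDerivWithinAt

/-- The point `(t, x)` with characteristic coordinates `y = x - a t`, `z = x + a t`. -/
noncomputable def charPt (a : ℝ) (w : ℝ × ℝ) : ℝ × ℝ := ((w.2 - w.1) / (2 * a), (w.2 + w.1) / 2)

theorem charPt_eq {a : ℝ} (ha : 0 < a) (t x : ℝ) : charPt a (x - a * t, x + a * t) = (t, x) := by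
  ext
  · simp only [charPt]; field_simp; ring
  · simp only [charPt]; ring

theorem charPt_self (a s : ℝ) : charPt a (s, s) = (0, s) := by
  ext <;> simp [charPt]

@[fun_prop]
theorem continuous_charPt (a : ℝ) : Continuous (charPt a) := by
  unfold charPt; fun_prop

theorem exists_charPt {a : ℝ} (ha : 0 < a) (p : ℝ × ℝ) : ∃ y z, p = charPt a (y, z) :=
  ⟨_, _, (charPt_eq ha p.1 p.2).symm⟩

/-- The derivative relative to `S` in the characteristic coordinate `y = x - a t`. -/
noncomputable def dy (a : ℝ) (S : Set (ℝ × ℝ)) (v : ℝ × ℝ → ℝ) (p : ℝ × ℝ) : ℝ :=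
  dx S v p / 2 - dt S v p / (2 * a)

/-- The derivative relative to `S` in the characteristic coordinate `z = x + a t`. -/
noncomputable def dz (a : ℝ) (S : Set (ℝ × ℝ)) (v : ℝ × ℝ → ℝ) (p : ℝ × ℝ) : ℝ :=
  dx S v p / 2 + dt S v p / (2 * a)

section
variable {a : ℝ} {S : Set (ℝ × ℝ)} {v : ℝ × ℝ → ℝ}

theorem dx_eq (p : ℝ × ℝ) : dx S v p = dy a S v p + dz a S v p := by
  simp only [dy, dz]; ring

theorem dt_eq (ha : 0 < a) (p : ℝ × ℝ) : dt S v p = a * (dz a S v p - dy a S v p) := by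
  simp only [dy, dz]; field_simp; ring

theorem fderivWithin_apply (p e : ℝ × ℝ) :
    fderivWithin ℝ v S p e = e.1 * dt S v p + e.2 * dx S v p := by
  have : e = e.1 • ((1 : ℝ), (0 : ℝ)) + e.2 • ((0 : ℝ), (1 : ℝ)) := by ext <;> simp
  conv_lhs => rw [this]
  rw [map_add, map_smul, map_smul]
  rfl

theorem hasDerivWithinAt_charPt_fst (hv : DifferentiableOn ℝ v S) {y z : ℝ}
    (h : charPt a (y, z) ∈ S) :
    HasDerivWithinAt (fun s => v (charPt a (s, z))) (dy a S v (charPt a (y, z)))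
      {s | charPt a (s, z) ∈ S} y := by
  have h1 : HasDerivAt (fun s => charPt a (s, z)) (-1 / (2 * a), 1 / 2) y :=
    (((hasDerivAt_id y).const_sub z).div_const _).prodMk
      (((hasDerivAt_id y).const_add z).div_const _)
  refine HasDerivWithinAt.congr_deriv ((hv _ h).hasFDerivWithinAt.comp_hasDerivWithinAt y
    h1.hasDerivWithinAt fun s hs => hs) ?_
  rw [fderivWithin_apply, dy]
  ring

theorem hasDerivWithinAt_charPt_snd (hv : DifferentiableOn ℝ v S) {y z : ℝ}
    (h : charPt a (y, z) ∈ S) :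
    HasDerivWithinAt (fun s => v (charPt a (y, s))) (dz a S v (charPt a (y, z)))
      {s | charPt a (y, s) ∈ S} z := by
  have h1 : HasDerivAt (fun s => charPt a (y, s)) (1 / (2 * a), 1 / 2) z :=
    (((hasDerivAt_id z).sub_const y).div_const _).prodMk
      (((hasDerivAt_id z).add_const y).div_const _)
  refine HasDerivWithinAt.congr_deriv ((hv _ h).hasFDerivWithinAt.comp_hasDerivWithinAt z
    h1.hasDerivWithinAt fun s hs => hs) ?_
  rw [fderivWithin_apply, dz]
  ring

theorem integral_dy (hv : DifferentiableOn ℝ v S) (hc : ContinuousOn (dy a S v) S) {z b c : ℝ}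
    (h : ∀ s ∈ uIcc b c, charPt a (s, z) ∈ S) :
    ∫ s in b..c, dy a S v (charPt a (s, z)) = v (charPt a (c, z)) - v (charPt a (b, z)) :=
  integral_eq_sub_of_hasDerivWithinAt_uIcc (f := fun s => v (charPt a (s, z)))
    (fun s hs => (hasDerivWithinAt_charPt_fst hv (h s hs)).mono h)
    (hc.comp (by fun_prop) h)

theorem integral_dz (hv : DifferentiableOn ℝ v S) (hc : ContinuousOn (dz a S v) S) {y b c : ℝ}
    (h : ∀ s ∈ uIcc b c, charPt a (y, s) ∈ S) :
    ∫ s in b..c, dz a S v (charPt a (y, s)) = v (charPt a (y, c)) - v (charPt a (y, b)) :=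
  integral_eq_sub_of_hasDerivWithinAt_uIcc (f := fun s => v (charPt a (y, s)))
    (fun s hs => (hasDerivWithinAt_charPt_snd hv (h s hs)).mono h)
    (hc.comp (by fun_prop) h)

theorem contDiffOn_dt (hS : UniqueDiffOn ℝ S) {m n : WithTop ℕ∞} (hv : ContDiffOn ℝ n v S)
    (hmn : m + 1 ≤ n) : ContDiffOn ℝ m (dt S v) S :=
  (hv.fderivWithin hS hmn).clm_apply contDiffOn_const

theorem contDiffOn_dx (hS : UniqueDiffOn ℝ S) {m n : WithTop ℕ∞} (hv : ContDiffOn ℝ n v S)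
    (hmn : m + 1 ≤ n) : ContDiffOn ℝ m (dx S v) S :=
  (hv.fderivWithin hS hmn).clm_apply contDiffOn_const

theorem contDiffOn_dy (hS : UniqueDiffOn ℝ S) {m n : WithTop ℕ∞} (hv : ContDiffOn ℝ n v S)
    (hmn : m + 1 ≤ n) : ContDiffOn ℝ m (dy a S v) S :=
  ((contDiffOn_dx hS hv hmn).div_const _).sub ((contDiffOn_dt hS hv hmn).div_const _)

theorem contDiffOn_dz (hS : UniqueDiffOn ℝ S) {m n : WithTop ℕ∞} (hv : ContDiffOn ℝ n v S)
    (hmn : m + 1 ≤ n) : ContDiffOn ℝ m (dz a S v) S :=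
  ((contDiffOn_dx hS hv hmn).div_const _).add ((contDiffOn_dt hS hv hmn).div_const _)

theorem dt_linear (hS : UniqueDiffOn ℝ S) {v₁ v₂ : ℝ × ℝ → ℝ} (h₁ : DifferentiableOn ℝ v₁ S)
    (h₂ : DifferentiableOn ℝ v₂ S) {p : ℝ × ℝ} (hp : p ∈ S) (b c : ℝ) :
    dt S (fun q => b * v₁ q + c * v₂ q) p = b * dt S v₁ p + c * dt S v₂ p ∧
    dx S (fun q => b * v₁ q + c * v₂ q) p = b * dx S v₁ p + c * dx S v₂ p := by
  have := ((((h₁ p hp).hasFDerivWithinAt.const_mul b).add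
    ((h₂ p hp).hasFDerivWithinAt.const_mul c)).fderivWithin (hS p hp))
  have h3 : fderivWithin ℝ (fun q => b * v₁ q + c * v₂ q) S p =
    b • fderivWithin ℝ v₁ S p + c • fderivWithin ℝ v₂ S p := this
  constructor <;> simp [dt, dx, h3]

theorem dt_dx_comm (hS : UniqueDiffOn ℝ S) (hSi : S ⊆ closure (interior S))
    (hv : ContDiffOn ℝ 2 v S) {p : ℝ × ℝ} (hp : p ∈ S) : dt S (dx S v) p = dx S (dt S v) p := by
  have hsymm : IsSymmSndFDerivWithinAt ℝ v S p :=
    (hv p hp).isSymmSndFDerivWithinAt (by simp) hS (hSi hp) hp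
  have hd : DifferentiableWithinAt ℝ (fderivWithin ℝ v S) S p :=
    (hv.fderivWithin hS (m := 1) (by norm_num)).differentiableOn one_ne_zero p hp
  have key : ∀ e e' : ℝ × ℝ, fderivWithin ℝ (fun q => fderivWithin ℝ v S q e) S p e'
      = fderivWithin ℝ (fderivWithin ℝ v S) S p e' e := fun e e' => by
    have h := (hd.hasFDerivWithinAt.clm_apply
      (hasFDerivWithinAt_const e p S)).fderivWithin (hS p hp)
    rw [h]
    simp
  change fderivWithin ℝ (fun q => fderivWithin ℝ v S q (0, 1)) S p (1, 0)
    = fderivWithin ℝ (fun q => fderivWithin ℝ v S q (1, 0)) S p (0, 1)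
  rw [key, key]
  exact hsymm _ _

/-- In characteristic coordinates the wave operator is the mixed derivative `-4 a² ∂y ∂z`. -/
theorem box_eq (ha : 0 < a) (hS : UniqueDiffOn ℝ S) (hSi : S ⊆ closure (interior S))
    (hv : ContDiffOn ℝ 2 v S) {p : ℝ × ℝ} (hp : p ∈ S) :
    box a S v p = -(4 * a ^ 2) * dy a S (dz a S v) p ∧
    dz a S (dy a S v) p = dy a S (dz a S v) p := by
  have ht := (contDiffOn_dt hS hv (m := 1) (by norm_num)).differentiableOn one_ne_zero
  have hx := (contDiffOn_dx hS hv (m := 1) (by norm_num)).differentiableOn one_ne_zero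
  have hcomm := dt_dx_comm hS hSi hv hp
  have e1 : dz a S v = fun q => 1 / 2 * dx S v q + 1 / (2 * a) * dt S v q := by
    funext q; simp only [dz]; ring
  have e2 : dy a S v = fun q => 1 / 2 * dx S v q + (-1 / (2 * a)) * dt S v q := by
    funext q; simp only [dy]; ring
  have l1 := dt_linear hS hx ht hp (1 / 2) (1 / (2 * a))
  have l2 := dt_linear hS hx ht hp (1 / 2) (-1 / (2 * a))
  rw [e1, e2]
  simp only [dy, dz]
  rw [l1.1, l1.2, l2.1, l2.2, hcomm, box]
  constructor <;> field_simp <;> ring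

end

/-- A function continuous on `S`, read in characteristic coordinates and precomposed with a
retraction `r` onto `S`, is continuous on the whole plane. -/
theorem continuous_comp_charPt {a : ℝ} {S : Set (ℝ × ℝ)} {k : ℝ × ℝ → ℝ} {r : ℝ × ℝ → ℝ × ℝ}
    (hk : ContinuousOn k S) (hr : Continuous r) (hrS : ∀ w, charPt a (r w) ∈ S) :
    Continuous fun w => k (charPt a (r w)) :=
  hk.comp_continuous (by fun_prop) hrS

/-- The right-hand side of the wave equation written as `V_yz = g (y, z, V, V_y, V_z)`. -/
noncomputable def charRhs (a : ℝ) (F : ℝ × ℝ → ℝ) (f : ℝ × ℝ × ℝ × ℝ × ℝ → ℝ)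
    (q : ℝ × ℝ × ℝ × ℝ × ℝ) : ℝ :=
  (f ((charPt a (q.1, q.2.1)).1, (charPt a (q.1, q.2.1)).2, q.2.2.1,
    a * (q.2.2.2.2 - q.2.2.2.1), q.2.2.2.1 + q.2.2.2.2) - F (charPt a (q.1, q.2.1))) / (4 * a ^ 2)

theorem nonlin_sub_eq_charRhs {a : ℝ} (ha : 0 < a) {F : ℝ × ℝ → ℝ}
    {f : ℝ × ℝ × ℝ × ℝ × ℝ → ℝ} {S : Set (ℝ × ℝ)} {v : ℝ × ℝ → ℝ} (w : ℝ × ℝ) :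
    (nonlin f S v (charPt a w) - F (charPt a w)) / (4 * a ^ 2) =
      charRhs a F f (w.1, w.2, v (charPt a w), dy a S v (charPt a w), dz a S v (charPt a w)) := by
  rw [nonlin, dt_eq ha, dx_eq (a := a)]
  rfl

theorem contDiff_charRhs {a : ℝ} {F : ℝ × ℝ → ℝ} {f : ℝ × ℝ × ℝ × ℝ × ℝ → ℝ}
    (hF : ContDiff ℝ 1 F) (hf : ContDiff ℝ 1 f) : ContDiff ℝ 1 (charRhs a F f) := by
  unfold charRhs charPt
  fun_prop

theorem lipschitzTail_charRhs {a L : ℝ} (ha : 0 < a) {F : ℝ × ℝ → ℝ}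
    {f : ℝ × ℝ × ℝ × ℝ × ℝ → ℝ} (hL : 0 ≤ L) (hf : LipschitzTail L f) :
    LipschitzTail (L * (1 + a) / (4 * a ^ 2)) (charRhs a F f) := by
  intro y z u p q u' p' q'
  have h := hf (charPt a (y, z)).1 (charPt a (y, z)).2 u (a * (q - p)) (p + q) u' (a * (q' - p'))
    (p' + q')
  have h1 : |a * (q - p) - a * (q' - p')| ≤ a * (|p - p'| + |q - q'|) := by
    rw [← mul_sub, abs_mul, abs_of_pos ha]
    gcongr
    rw [show q - p - (q' - p') = (q - q') - (p - p') by ring, add_comm]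
    exact abs_sub _ _
  have h2 : |p + q - (p' + q')| ≤ |p - p'| + |q - q'| := by
    rw [show p + q - (p' + q') = (p - p') + (q - q') by ring]
    exact abs_add_le _ _
  simp only [charRhs]
  rw [← sub_div, sub_sub_sub_cancel_right, abs_div, abs_of_pos (by positivity : 0 < 4 * a ^ 2),
    div_le_iff₀ (by positivity)]
  refine h.trans ?_
  have h3 : L * (1 + a) / (4 * a ^ 2) * (|u - u'| + |p - p'| + |q - q'|) * (4 * a ^ 2)
    = L * ((1 + a) * (|u - u'| + |p - p'| + |q - q'|)) := by field_simp
  rw [h3]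
  gcongr
  nlinarith [abs_nonneg (u - u'), mul_nonneg ha.le (abs_nonneg (u - u'))]

/-! ### Triangle integrals, global solutions, and uniqueness on a region -/

/-- Fubini on a triangle: both sides have the same derivative in `y` and vanish at `y = z`. -/
theorem integral_triangle_swap {k : ℝ × ℝ → ℝ} (hk : Continuous k) (y z : ℝ) :
    ∫ σ in y..z, ∫ r in σ..z, k (σ, r) = ∫ r in y..z, ∫ σ in y..r, k (σ, r) := by
  have hΦ : Continuous fun σ => ∫ r in σ..z, k (σ, r) :=
    continuous_integral_param (f := fun q : ℝ × ℝ => k (q.1, q.2)) (by fun_prop) (by fun_prop)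
      (by fun_prop)
  let K : ℝ × ℝ → ℝ := fun w => ∫ σ in w.1..w.2, k (σ, w.2)
  have hK : Continuous K :=
    continuous_integral_param (f := fun q : (ℝ × ℝ) × ℝ => k (q.2, q.1.2)) (by fun_prop)
      (by fun_prop) (by fun_prop)
  have hKd : ∀ y r, HasDerivAt (fun s => K (s, r)) (-k (y, r)) y := fun y r => by
    have hc : Continuous fun s => k (s, r) := by fun_prop
    exact intervalIntegral.integral_hasDerivAt_left (hc.intervalIntegrable _ _)
      hc.aestronglyMeasurable.stronglyMeasurableAtFilter hc.continuousAt
  have h1 : ∀ y, HasDerivAt (fun y => ∫ σ in y..z, ∫ r in σ..z, k (σ, r))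
      (-∫ r in y..z, k (y, r)) y := fun y =>
    intervalIntegral.integral_hasDerivAt_left (hΦ.intervalIntegrable _ _)
      hΦ.aestronglyMeasurable.stronglyMeasurableAtFilter hΦ.continuousAt
  have h2 : ∀ y, HasDerivAt (fun y => ∫ r in y..z, ∫ σ in y..r, k (σ, r))
      (-∫ r in y..z, k (y, r)) y := fun y => by
    have hs := (HasSlope.of_hasDerivAt (P := K) (P' := fun w => -k w) hKd hk.neg).integral hK
      (c := id) (κ := 1) continuous_id (by simp)
    refine (hs.hasDerivAt y z).congr_deriv ?_
    simp [K]
  have h3 := is_const_of_deriv_eq_zero (fun y => ((h1 y).sub (h2 y)).differentiableAt)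
    (fun y => by rw [((h1 y).sub (h2 y)).deriv, sub_self]) y z
  simp only [Pi.sub_apply, intervalIntegral.integral_same, sub_zero] at h3
  exact sub_eq_zero.1 h3

/-- The integral over the backward characteristic triangle, in characteristic coordinates. -/
theorem integral_triangle {a : ℝ} (ha : 0 < a) {K : ℝ × ℝ → ℝ} (hK : Continuous K) (t x : ℝ) :
    ∫ τ in (0 : ℝ)..t, ∫ ξ in (x - a * (t - τ))..(x + a * (t - τ)), K (ξ - a * τ, ξ + a * τ) =
      1 / (2 * a) * ∫ r in (x - a * t)..(x + a * t), ∫ s in (x - a * t)..r, K (s, r) := by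
  set y := x - a * t with hy
  set z := x + a * t with hz
  have h1 : ∀ τ, ∫ ξ in (x - a * (t - τ))..(x + a * (t - τ)), K (ξ - a * τ, ξ + a * τ)
      = ∫ r in (y + 2 * a * τ)..z, K (r - (y + 2 * a * τ - y), r) := fun τ => by
    have := intervalIntegral.integral_comp_add_right (a := x - a * (t - τ))
      (b := x + a * (t - τ)) (fun r => K (r - (y + 2 * a * τ - y), r)) (a * τ)
    rw [show x - a * (t - τ) + a * τ = y + 2 * a * τ by rw [hy]; ring,
      show x + a * (t - τ) + a * τ = z by rw [hz]; ring] at this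
    rw [← this]
    congr 1
    funext ξ
    congr 2
    ring
  have h2 := intervalIntegral.mul_integral_comp_add_mul (a := 0) (b := t) (c := 2 * a)
    (f := fun σ => ∫ r in σ..z, K (r - (σ - y), r)) y
  rw [mul_zero, add_zero, show y + 2 * a * t = z by rw [hy, hz]; ring,
    integral_triangle_swap (k := fun q => K (q.2 - (q.1 - y), q.2)) (by fun_prop)] at h2
  have h3 : ∀ r, ∫ σ in y..r, K (r - (σ - y), r) = ∫ s in y..r, K (s, r) := fun r => by
    have := intervalIntegral.integral_comp_sub_left (a := y) (b := r) (fun s => K (s, r)) (r + y)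
    rw [add_sub_cancel_left, add_sub_cancel_right] at this
    rw [← this]
    congr 1
    funext σ
    congr 2
    ring
  simp only [h3] at h2
  simp only [h1]
  rw [← h2]
  field_simp

/-- `V` is a global `C²` solution of `V_yz = g (y, z, V, V_y, V_z)` with `V_y = P`, `V_z = Q`. -/
structure SolvesChar (g : ℝ × ℝ × ℝ × ℝ × ℝ → ℝ) (V P Q : ℝ × ℝ → ℝ) : Prop where
  contDiff : ContDiff ℝ 2 V
  hasFDerivAt : ∀ w, HasFDerivAt V (P w • ContinuousLinearMap.fst ℝ ℝ ℝ
    + Q w • ContinuousLinearMap.snd ℝ ℝ ℝ) w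
  contDiff_snd : ContDiff ℝ 1 Q
  hasDerivAt : ∀ y z, HasDerivAt (fun s => Q (s, z)) (g (y, z, V (y, z), P (y, z), Q (y, z))) y

section
variable {g : ℝ × ℝ × ℝ × ℝ × ℝ → ℝ} {Λ : ℝ}

theorem solvesChar_of_fixedPoint {c V₀ P₀ Q₀ : ℝ → ℝ} {h : ℝ × ℝ → ℝ} {κ : ℝ}
    (hcc : Continuous c) (hc : ∀ y η, c (y + η) = c y + κ * η) (hκ : ∀ y, κ = 0 ∨ c (c y) = y)
    (hV : ContDiff ℝ 2 V₀) (hP : ContDiff ℝ 1 P₀) (hQ : ContDiff ℝ 1 Q₀)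
    (hcomp : ∀ y, P₀ y = deriv V₀ y - κ * Q₀ (c y)) (hg : ContDiff ℝ 1 g) (hh : Continuous h)
    (hfix : ∀ w, volMap c V₀ P₀ Q₀ g h w = h w) :
    SolvesChar g (volV c V₀ Q₀ h) (volP c P₀ h) (volQ c Q₀ h) where
  contDiff := (volV_regularity hcc hc hκ hV hP hQ hcomp hg hh hfix).2.2.2
  hasFDerivAt := (volV_regularity hcc hc hκ hV hP hQ hcomp hg hh hfix).1
  contDiff_snd := (volV_regularity hcc hc hκ hV hP hQ hcomp hg hh hfix).2.2.1
  hasDerivAt y z := (hasDerivAt_integral_add_const (f := fun s => h (s, z)) (by fun_prop)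
    (Q₀ z) (c z) y).congr_deriv (hfix (y, z)).symm

/-- The Cauchy problem with `V = φ` and `(V_z - V_y) / 2 = χ` on the diagonal. -/
theorem exists_solvesChar_cauchy (hg : ContDiff ℝ 1 g) (hΛ : 0 ≤ Λ) (hL : LipschitzTail Λ g)
    {φ χ : ℝ → ℝ} (hφ : ContDiff ℝ 2 φ) (hχ : ContDiff ℝ 1 χ) :
    ∃ V P Q, SolvesChar g V P Q ∧ ∀ s, V (s, s) = φ s ∧ P (s, s) = deriv φ s / 2 - χ s ∧
      Q (s, s) = deriv φ s / 2 + χ s := by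
  have hφ' : ContDiff ℝ 1 (deriv φ) :=
    ((contDiff_succ_iff_deriv (n := 1)).1 (by simpa [one_add_one_eq_two] using hφ)).2.2
  obtain ⟨h, hh, hfix⟩ := exists_volMap_fixedPoint (c := id) (m := 0) (V₀ := φ)
    (P₀ := fun s => deriv φ s / 2 - χ s) (Q₀ := fun s => deriv φ s / 2 + χ s) continuous_id
    (fun _ => le_rfl) hφ.continuous (hφ'.continuous.div_const _ |>.sub hχ.continuous)
    (hφ'.continuous.div_const _ |>.add hχ.continuous) hg.continuous hΛ hL
    (fun K hK => ⟨_, isWeight_cauchy hK⟩)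
  refine ⟨_, _, _, solvesChar_of_fixedPoint (κ := 1) continuous_id (by simp) (by simp) hφ
    ((hφ'.div_const _).sub hχ) ((hφ'.div_const _).add hχ) (fun y => ?_) hg hh hfix, fun s => ?_⟩
  · simp only [id]; ring
  · simp [volV, volP, volQ]

/-- The Goursat problem with `V = α` on the line `z = m` and `V = β` on the line `y = m`. -/
theorem exists_solvesChar_goursat (hg : ContDiff ℝ 1 g) (hΛ : 0 ≤ Λ) (hL : LipschitzTail Λ g)
    {α β : ℝ → ℝ} (hα : ContDiff ℝ 2 α) (hβ : ContDiff ℝ 2 β) (m : ℝ) (hm : α m = β m) :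
    ∃ V P Q, SolvesChar g V P Q ∧ (∀ y, V (y, m) = α y) ∧ ∀ z, V (m, z) = β z := by
  have hα' : ContDiff ℝ 1 (deriv α) :=
    ((contDiff_succ_iff_deriv (n := 1)).1 (by simpa [one_add_one_eq_two] using hα)).2.2
  have hβ' : ContDiff ℝ 1 (deriv β) :=
    ((contDiff_succ_iff_deriv (n := 1)).1 (by simpa [one_add_one_eq_two] using hβ)).2.2
  obtain ⟨h, hh, hfix⟩ := exists_volMap_fixedPoint (c := fun _ => m) (m := m) (V₀ := α)
    (P₀ := deriv α) (Q₀ := deriv β) continuous_const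
    (fun _ => by simp) hα.continuous hα'.continuous hβ'.continuous hg.continuous hΛ hL
    (fun K hK => ⟨_, isWeight_goursat hK m⟩)
  refine ⟨_, _, _, solvesChar_of_fixedPoint (κ := 0) continuous_const (by simp) (by simp) hα
    hα' hβ' (by simp) hg hh hfix, fun y => by simp [volV], fun z => ?_⟩
  have h1 := intervalIntegral.integral_eq_sub_of_hasDerivAt (a := m) (b := z)
    (fun s _ => ((hβ.differentiable two_ne_zero) s).hasDerivAt)
    (hβ'.continuous.intervalIntegrable _ _)
  simp [volV, volQ, h1, hm]

end

/-- Uniqueness on a segment-closed region: two solutions that share their values and their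
characteristic derivatives along the data curve agree. -/
theorem eqOn_of_data {a Λ m : ℝ} {S : Set (ℝ × ℝ)} {c : ℝ → ℝ} {r : ℝ × ℝ → ℝ × ℝ} {F : ℝ × ℝ → ℝ}
    {f : ℝ × ℝ × ℝ × ℝ × ℝ → ℝ} {v v' : ℝ × ℝ → ℝ} (ha : 0 < a) (hS : UniqueDiffOn ℝ S)
    (hSi : S ⊆ closure (interior S)) (hc : Continuous c) (hcm : ∀ y, |c y - m| ≤ |y - m|)
    (hweight : ∀ K, 0 < K → ∃ W, IsWeight c K W)
    (hD : SegmentClosed c {w | charPt a w ∈ S}) (hr : Continuous r)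
    (hrS : ∀ w, charPt a (r w) ∈ S) (hrid : ∀ w, charPt a w ∈ S → r w = w)
    (hΛ : 0 ≤ Λ) (hg : LipschitzTail Λ (charRhs a F f))
    (hv : ContDiffOn ℝ 2 v S) (hv' : ContDiffOn ℝ 2 v' S)
    (hpde : ∀ p ∈ S, box a S v p + nonlin f S v p = F p)
    (hpde' : ∀ p ∈ S, box a S v' p + nonlin f S v' p = F p)
    (h0 : ∀ y, charPt a (y, c y) ∈ S → v (charPt a (y, c y)) = v' (charPt a (y, c y)))
    (hy : ∀ y, charPt a (y, c y) ∈ S → dy a S v (charPt a (y, c y)) = dy a S v' (charPt a (y, c y)))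
    (hz : ∀ z, charPt a (c z, z) ∈ S →
      dz a S v (charPt a (c z, z)) = dz a S v' (charPt a (c z, z))) :
    EqOn v v' S := by
  let V₀ : ℝ → ℝ := fun y => v (charPt a (r (y, c y)))
  let P₀ : ℝ → ℝ := fun y => dy a S v (charPt a (r (y, c y)))
  let Q₀ : ℝ → ℝ := fun z => dz a S v (charPt a (r (c z, z)))
  have hdz := contDiffOn_dz hS hv (a := a) (m := 1) (by norm_num)
  have hQ₀ : Continuous Q₀ :=
    (continuous_comp_charPt hdz.continuousOn hr hrS).comp (f := fun z => (c z, z)) (by fun_prop)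
  have hyz : ∀ u : ℝ × ℝ → ℝ, ContDiffOn ℝ 2 u S → ContinuousOn (dy a S (dz a S u)) S :=
    fun u hu => (contDiffOn_dy hS (contDiffOn_dz hS hu (m := 1) (by norm_num)) (m := 0)
      (by norm_num)).continuousOn
  -- the representation of a solution with the given data
  have rep : ∀ u : ℝ × ℝ → ℝ, ContDiffOn ℝ 2 u S →
      (∀ p ∈ S, box a S u p + nonlin f S u p = F p) →
      (∀ y, charPt a (y, c y) ∈ S → v (charPt a (y, c y)) = u (charPt a (y, c y))) →
      (∀ y, charPt a (y, c y) ∈ S →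
        dy a S v (charPt a (y, c y)) = dy a S u (charPt a (y, c y))) →
      (∀ z, charPt a (c z, z) ∈ S →
        dz a S v (charPt a (c z, z)) = dz a S u (charPt a (c z, z))) →
      ∀ w, charPt a w ∈ S →
        volV c V₀ Q₀ (fun w => dy a S (dz a S u) (charPt a (r w))) w = u (charPt a w) ∧
        volMap c V₀ P₀ Q₀ (charRhs a F f) (fun w => dy a S (dz a S u) (charPt a (r w))) w
          = dy a S (dz a S u) (charPt a (r w)) := by
    intro u hu hup hu0 huy huz
    have hu1 := hu.differentiableOn two_ne_zero
    have huz1 := contDiffOn_dz hS hu (a := a) (m := 1) (by norm_num)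
    have huy1 := contDiffOn_dy hS hu (a := a) (m := 1) (by norm_num)
    have hcomm : EqOn (dz a S (dy a S u)) (dy a S (dz a S u)) S := fun p hp =>
      (box_eq ha hS hSi hu hp).2
    have eQ : ∀ w, charPt a w ∈ S →
        volQ c Q₀ (fun w => dy a S (dz a S u) (charPt a (r w))) w = dz a S u (charPt a w) := by
      rintro ⟨y, z⟩ hw
      have hseg := (hD y z hw).2
      have h1 := integral_dy (huz1.differentiableOn one_ne_zero) (hyz u hu) hseg
      have h2 : ∫ s in c z..y, dy a S (dz a S u) (charPt a (r (s, z)))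
          = ∫ s in c z..y, dy a S (dz a S u) (charPt a (s, z)) :=
        intervalIntegral.integral_congr fun s hs => by
          simp only [hrid _ (hseg s hs)]
      have h3 := hseg _ left_mem_uIcc
      simp only [volQ, Q₀]
      rw [h2, h1, hrid _ h3, huz z h3]
      ring
    have eP : ∀ w, charPt a w ∈ S →
        volP c P₀ (fun w => dy a S (dz a S u) (charPt a (r w))) w = dy a S u (charPt a w) := by
      rintro ⟨y, z⟩ hw
      have hseg := (hD y z hw).1
      have h1 := integral_dz (huy1.differentiableOn one_ne_zero) ((hyz u hu).congr hcomm) hseg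
      have h2 : ∫ s in c y..z, dy a S (dz a S u) (charPt a (r (y, s)))
          = ∫ s in c y..z, dz a S (dy a S u) (charPt a (y, s)) :=
        intervalIntegral.integral_congr fun s hs => by
          simp only [hrid _ (hseg s hs), hcomm (hseg s hs)]
      have h3 := hseg _ left_mem_uIcc
      simp only [volP, P₀]
      rw [h2, h1, hrid _ h3, huy y h3]
      ring
    have eV : ∀ w, charPt a w ∈ S →
        volV c V₀ Q₀ (fun w => dy a S (dz a S u) (charPt a (r w))) w = u (charPt a w) := by
      rintro ⟨y, z⟩ hw
      have hseg := (hD y z hw).1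
      have h1 := integral_dz hu1 huz1.continuousOn hseg
      have h2 : ∫ s in c y..z, volQ c Q₀ (fun w => dy a S (dz a S u) (charPt a (r w))) (y, s)
          = ∫ s in c y..z, dz a S u (charPt a (y, s)) :=
        intervalIntegral.integral_congr fun s hs => eQ _ (hseg s hs)
      have h3 := hseg _ left_mem_uIcc
      simp only [volV, V₀]
      rw [h2, h1, hrid _ h3, hu0 y h3]
      ring
    intro w hw
    refine ⟨eV w hw, ?_⟩
    rw [volMap, eV w hw, eP w hw, eQ w hw, ← nonlin_sub_eq_charRhs ha, hrid w hw]
    have h1 := hup _ hw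
    rw [(box_eq ha hS hSi hu hw).1] at h1
    field_simp
    linarith
  have R := rep v hv hpde (fun _ _ => rfl) (fun _ _ => rfl) (fun _ _ => rfl)
  have R' := rep v' hv' hpde' h0 hy hz
  have huniq := volMap_fixedPoint_unique (V₀ := V₀) (P₀ := P₀) hc hcm hQ₀ hΛ hg hweight hD
    (continuous_comp_charPt (hyz v hv) hr hrS) (continuous_comp_charPt (hyz v' hv') hr hrS)
    (fun w hw => (R w hw).2) (fun w hw => (R' w hw).2)
  intro p hp
  obtain ⟨y, z, rfl⟩ := exists_charPt ha p
  rw [← (R _ hp).1, ← (R' _ hp).1]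
  simp only [volV]
  congr 1
  refine intervalIntegral.integral_congr fun s hs => ?_
  simp only [volQ]
  congr 1
  exact intervalIntegral.integral_congr fun s' hs' =>
    huniq ((hD _ _ ((hD y z hp).1 s hs)).2 s' hs')

/-! ### The Cauchy problem and d'Alembert's formula -/

/-- `Q` is the open triangular region, in characteristic coordinates
`{y < z, y ∈ interior J, z ∈ interior J}`, over the interval `J` of the initial line. -/
structure IsCauchyRegion (a : ℝ) (J : Set ℝ) (Q : Set (ℝ × ℝ)) : Prop where
  convex : Convex ℝ Q
  isOpen : IsOpen Q
  nonempty : Q.Nonempty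
  mem_iff : ∀ y z, charPt a (y, z) ∈ Q ↔ y ∈ interior J ∧ z ∈ interior J ∧ y < z
  mem_closure_iff : ∀ y z, charPt a (y, z) ∈ closure Q ↔ y ∈ J ∧ z ∈ J ∧ y ≤ z
  ordConnected : J.OrdConnected
  uniqueDiffOn : UniqueDiffOn ℝ J
  subset_closure_int : J ⊆ closure (interior J)
  exists_retraction : ∃ ρ : ℝ → ℝ, Continuous ρ ∧ Monotone ρ ∧ (∀ x, ρ x ∈ J) ∧ ∀ x ∈ J, ρ x = x

theorem uniqueDiffOn_closure {Q : Set (ℝ × ℝ)} (hc : Convex ℝ Q) (ho : IsOpen Q)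
    (hn : Q.Nonempty) : UniqueDiffOn ℝ (closure Q) :=
  uniqueDiffOn_convex hc.closure (hn.mono (interior_maximal subset_closure ho))

theorem closure_subset_closure_interior {Q : Set (ℝ × ℝ)} (ho : IsOpen Q) :
    closure Q ⊆ closure (interior (closure Q)) :=
  closure_mono (interior_maximal subset_closure ho)

/-- `v` solves the Cauchy problem on the region `S` over the interval `J`, in the one-sided sense
up to the boundary. -/
structure SolvesCauchy (a : ℝ) (φ ψ : ℝ → ℝ) (F : ℝ × ℝ → ℝ) (f : ℝ × ℝ × ℝ × ℝ × ℝ → ℝ)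
    (J : Set ℝ) (S : Set (ℝ × ℝ)) (v : ℝ × ℝ → ℝ) : Prop where
  pde : ∀ p ∈ S, box a S v p + nonlin f S v p = F p
  init : ∀ x ∈ J, v (0, x) = φ x
  init_dt : ∀ x ∈ J, dt S v (0, x) = ψ x

theorem continuousOn_nonlin {S : Set (ℝ × ℝ)} {v : ℝ × ℝ → ℝ} {f : ℝ × ℝ × ℝ × ℝ × ℝ → ℝ}
    (hf : Continuous f) (hS : UniqueDiffOn ℝ S) (hv : ContDiffOn ℝ 2 v S) :
    ContinuousOn (nonlin f S v) S := by
  have h1 := (contDiffOn_dt hS hv (m := 1) (by norm_num)).continuousOn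
  have h2 := (contDiffOn_dx hS hv (m := 1) (by norm_num)).continuousOn
  have h3 := hv.continuousOn
  unfold nonlin
  exact hf.comp_continuousOn (by fun_prop)

theorem continuousOn_dy_dz {a : ℝ} {S : Set (ℝ × ℝ)} {v : ℝ × ℝ → ℝ}
    (hS : UniqueDiffOn ℝ S) (hv : ContDiffOn ℝ 2 v S) : ContinuousOn (dy a S (dz a S v)) S :=
  (contDiffOn_dy hS (contDiffOn_dz hS hv (m := 1) (by norm_num)) (m := 0)
    (by norm_num)).continuousOn

/-- The equation extends from a dense subset to the closed region. -/
theorem pde_of_dense {a : ℝ} {S T : Set (ℝ × ℝ)} {v F : ℝ × ℝ → ℝ} {f : ℝ × ℝ × ℝ × ℝ × ℝ → ℝ}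
    (ha : 0 < a) (hF : ContinuousOn F S) (hf : Continuous f) (hS : UniqueDiffOn ℝ S)
    (hSi : S ⊆ closure (interior S)) (hv : ContDiffOn ℝ 2 v S) (hT : T ⊆ S) (hTS : S ⊆ closure T)
    (h : ∀ p ∈ T, box a S v p + nonlin f S v p = F p) :
    ∀ p ∈ S, box a S v p + nonlin f S v p = F p := by
  have hbox : ContinuousOn (box a S v) S :=
    (continuousOn_const.mul (continuousOn_dy_dz hS hv)).congr fun p hp =>
      (box_eq ha hS hSi hv hp).1
  exact Set.EqOn.of_subset_closure (s := T) h (hbox.add (continuousOn_nonlin hf hS hv)) hF hT hTS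

theorem pde_iff {a : ℝ} {S : Set (ℝ × ℝ)} {v F : ℝ × ℝ → ℝ} {f : ℝ × ℝ × ℝ × ℝ × ℝ → ℝ}
    (ha : 0 < a) (hS : UniqueDiffOn ℝ S) (hSi : S ⊆ closure (interior S))
    (hv : ContDiffOn ℝ 2 v S) {p : ℝ × ℝ} (hp : p ∈ S) :
    box a S v p + nonlin f S v p = F p ↔
      dy a S (dz a S v) p = (nonlin f S v p - F p) / (4 * a ^ 2) := by
  rw [(box_eq ha hS hSi hv hp).1, eq_div_iff (by positivity)]
  constructor <;> intro h <;> linarith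

theorem continuous_integral_fst {E : ℝ × ℝ → ℝ} (hE : Continuous E) (y : ℝ) :
    Continuous fun r => ∫ s in y..r, E (s, r) :=
  continuous_integral_param (f := fun q : ℝ × ℝ => E (q.2, q.1)) (by fun_prop) (by fun_prop)
    (by fun_prop)

/-- If the triangle integrals of `E` are single integrals of `M`, both vanish: differentiate in the
upper vertex, let the triangle shrink to it, and differentiate in the lower vertex. -/
theorem eq_zero_of_integral_triangle {J : Set ℝ} {M : ℝ → ℝ} {E : ℝ × ℝ → ℝ} (hM : Continuous M)
    (hE : Continuous E) (h : ∀ y ∈ J, ∀ z ∈ J, y ≤ z →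
      ∫ s in y..z, M s = ∫ r in y..z, ∫ s in y..r, E (s, r)) :
    (∀ z ∈ interior J, M z = 0) ∧ ∀ y ∈ interior J, ∀ z ∈ interior J, y < z → E (y, z) = 0 := by
  have hFTC : ∀ {k : ℝ → ℝ} (_ : Continuous k) (b c : ℝ),
      HasDerivAt (fun z => ∫ s in b..z, k s) (k c) c := fun hk b c => by
    simpa using hasDerivAt_integral_add_const hk 0 b c
  have h1 : ∀ y ∈ interior J, ∀ z ∈ interior J, y < z → M z = ∫ s in y..z, E (s, z) := by
    intro y hy z hz hyz
    have e1 := hFTC hM y z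
    have e2 := hFTC (continuous_integral_fst hE y) y z
    refine (e1.congr_of_eventuallyEq ?_).unique e2
    filter_upwards [isOpen_interior.mem_nhds hz, lt_mem_nhds hyz] with z' hz' hyz'
    exact (h y (interior_subset hy) z' (interior_subset hz') hyz'.le).symm
  have h2 : ∀ z ∈ interior J, M z = 0 := by
    intro z hz
    have hc : Continuous fun y => ∫ s in y..z, E (s, z) :=
      continuous_integral_param (f := fun q : ℝ × ℝ => E (q.2, z)) (by fun_prop) (by fun_prop)
        (by fun_prop)
    have hlim : Filter.Tendsto (fun y => ∫ s in y..z, E (s, z)) (nhdsWithin z (Iio z)) (nhds 0) :=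
      (hc.tendsto' z 0 (by simp)).mono_left nhdsWithin_le_nhds
    refine tendsto_nhds_unique (tendsto_const_nhds (x := M z)) (hlim.congr' ?_)
    filter_upwards [self_mem_nhdsWithin, nhdsWithin_le_nhds (isOpen_interior.mem_nhds hz)]
      with y hy hyJ
    exact (h1 y hyJ z hz hy).symm
  refine ⟨h2, fun y hy z hz hyz => ?_⟩
  have hk : Continuous fun s => E (s, z) := by fun_prop
  have e1 : HasDerivAt (fun y => ∫ s in y..z, E (s, z)) (-E (y, z)) y :=
    intervalIntegral.integral_hasDerivAt_left (hk.intervalIntegrable _ _)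
      hk.aestronglyMeasurable.stronglyMeasurableAtFilter hk.continuousAt
  have e2 : HasDerivAt (fun _ : ℝ => (0 : ℝ)) (-E (y, z)) y := by
    refine e1.congr_of_eventuallyEq ?_
    filter_upwards [isOpen_interior.mem_nhds hy, gt_mem_nhds hyz] with y' hy' hyz'
    rw [← h1 y' hy' z hz hyz', h2 z hz]
  simpa using e2.unique (hasDerivAt_const y (0 : ℝ))

namespace IsCauchyRegion

variable {a : ℝ} {J : Set ℝ} {Q : Set (ℝ × ℝ)} {v F : ℝ × ℝ → ℝ}
  {f : ℝ × ℝ × ℝ × ℝ × ℝ → ℝ} {φ ψ : ℝ → ℝ}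

theorem exists_retraction_prod (hQ : IsCauchyRegion a J Q) :
    ∃ r : ℝ × ℝ → ℝ × ℝ, Continuous r ∧ (∀ w, charPt a (r w) ∈ closure Q) ∧
      ∀ w, charPt a w ∈ closure Q → r w = w := by
  obtain ⟨ρ, hc, hm, hJ, hid⟩ := hQ.exists_retraction
  refine ⟨fun w => (ρ (min w.1 w.2), ρ w.2), by fun_prop, fun w =>
    (hQ.mem_closure_iff _ _).2 ⟨hJ _, hJ _, hm (min_le_right _ _)⟩, fun w hw => ?_⟩
  obtain ⟨h1, h2, h3⟩ := (hQ.mem_closure_iff w.1 w.2).1 hw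
  simp only [min_eq_left h3, hid _ h1, hid _ h2]

theorem zero_mem (hQ : IsCauchyRegion a J Q) {x : ℝ} (hx : x ∈ J) : ((0 : ℝ), x) ∈ closure Q := by
  rw [← charPt_self a, hQ.mem_closure_iff]
  exact ⟨hx, hx, le_rfl⟩

theorem segmentClosed (hQ : IsCauchyRegion a J Q) :
    SegmentClosed id {w | charPt a w ∈ closure Q} := by
  intro y z hw
  obtain ⟨h1, h2, h3⟩ := (hQ.mem_closure_iff y z).1 hw
  refine ⟨fun s hs => (hQ.mem_closure_iff _ _).2 ?_, fun s hs => (hQ.mem_closure_iff _ _).2 ?_⟩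
  · rw [id, uIcc_of_le h3] at hs
    exact ⟨h1, hQ.ordConnected.out h1 h2 hs, hs.1⟩
  · rw [id, uIcc_of_ge h3] at hs
    exact ⟨hQ.ordConnected.out h1 h2 hs, h2, hs.2⟩

theorem uniqueDiffOn_region (hQ : IsCauchyRegion a J Q) : UniqueDiffOn ℝ (closure Q) :=
  uniqueDiffOn_closure hQ.convex hQ.isOpen hQ.nonempty

theorem subset_closure_interior (hQ : IsCauchyRegion a J Q) :
    closure Q ⊆ closure (interior (closure Q)) :=
  closure_subset_closure_interior hQ.isOpen

theorem hasDerivWithinAt_init (hQ : IsCauchyRegion a J Q) (hv : ContDiffOn ℝ 2 v (closure Q))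
    {x : ℝ} (hx : x ∈ J) :
    HasDerivWithinAt (fun s => v (0, s)) (dx (closure Q) v (0, x)) J x := by
  have h1 : HasDerivAt (fun s : ℝ => ((0 : ℝ), s)) ((0 : ℝ), (1 : ℝ)) x :=
    (hasDerivAt_const x 0).prodMk (hasDerivAt_id x)
  exact (hv.differentiableOn two_ne_zero _
    (hQ.zero_mem hx)).hasFDerivWithinAt.comp_hasDerivWithinAt x h1.hasDerivWithinAt
    fun s hs => hQ.zero_mem hs

theorem dx_init (hQ : IsCauchyRegion a J Q) (hv : ContDiffOn ℝ 2 v (closure Q))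
    (hφ : ContDiff ℝ 2 φ) (h : ∀ x ∈ J, v (0, x) = φ x) {x : ℝ} (hx : x ∈ J) :
    dx (closure Q) v (0, x) = deriv φ x :=
  (hQ.uniqueDiffOn x hx).eq_deriv _ ((hQ.hasDerivWithinAt_init hv hx).congr
    (fun y hy => (h y hy).symm) (h x hx).symm)
    ((hφ.differentiable two_ne_zero x).hasDerivAt.hasDerivWithinAt)

/-- A `C²` function is recovered from its values and its `z`-derivative on the initial line and
from its mixed derivative. -/
theorem eq_integral (hQ : IsCauchyRegion a J Q) (hv : ContDiffOn ℝ 2 v (closure Q))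
    {H : ℝ × ℝ → ℝ} (hH : Continuous H) (hHv : ∀ w, charPt a w ∈ closure Q →
      H w = dy a (closure Q) (dz a (closure Q) v) (charPt a w))
    {M : ℝ → ℝ} (hM : Continuous M) (hMv : ∀ x ∈ J, M x = dz a (closure Q) v (0, x))
    {y z : ℝ} (hw : charPt a (y, z) ∈ closure Q) :
    v (charPt a (y, z)) = v (0, y) + (∫ s in y..z, M s)
      - ∫ r in y..z, ∫ s in y..r, H (s, r) := by
  have hS := hQ.uniqueDiffOn_region
  have hdz := contDiffOn_dz hS hv (a := a) (m := 1) (by norm_num)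
  have hseg : ∀ s ∈ uIcc y z, charPt a (y, s) ∈ closure Q := (hQ.segmentClosed y z hw).1
  have e1 := integral_dz (hv.differentiableOn two_ne_zero) hdz.continuousOn hseg
  have e2 : ∀ r ∈ uIcc y z, dz a (closure Q) v (charPt a (y, r))
      = M r - ∫ s in y..r, H (s, r) := by
    intro r hr
    have hseg' := (hQ.segmentClosed y r (hseg r hr)).2
    have e3 := integral_dy (hdz.differentiableOn one_ne_zero) (continuousOn_dy_dz hS hv) hseg'
    have e4 : ∫ s in r..y, H (s, r)
        = ∫ s in r..y, dy a (closure Q) (dz a (closure Q) v) (charPt a (s, r)) :=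
      intervalIntegral.integral_congr fun s hs => hHv _ (hseg' s hs)
    have hrJ := ((hQ.mem_closure_iff y r).1 (hseg r hr)).2.1
    have e5 : ∫ s in id r..y, dy a (closure Q) (dz a (closure Q) v) (charPt a (s, r))
        = -∫ s in y..r, H (s, r) := by
      rw [id, ← e4, intervalIntegral.integral_symm]
    rw [e5] at e3
    simp only [id, charPt_self, ← hMv r hrJ] at e3
    linarith
  rw [intervalIntegral.integral_congr e2, intervalIntegral.integral_sub
    (hM.intervalIntegrable _ _) ((continuous_integral_fst hH y).intervalIntegrable _ _)] at e1
  simp only [charPt_self] at e1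
  linarith

/-- The representation formula in characteristic coordinates. -/
theorem dAlembert_iff (hQ : IsCauchyRegion a J Q) (ha : 0 < a) {K : ℝ × ℝ → ℝ} (hK : Continuous K)
    (hKv : ∀ w, charPt a w ∈ closure Q →
      K w = (nonlin f (closure Q) v (charPt a w) - F (charPt a w)) / (4 * a ^ 2)) :
    DAlembert a φ ψ F f (closure Q) v ↔ ∀ y z, charPt a (y, z) ∈ closure Q →
      v (charPt a (y, z)) = (φ y + φ z) / 2 + 1 / (2 * a) * (∫ s in y..z, ψ s)
        - ∫ r in y..z, ∫ s in y..r, K (s, r) := by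
  have key : ∀ t x, (t, x) ∈ closure Q →
      1 / (2 * a) * ∫ τ in (0 : ℝ)..t, ∫ ξ in (x - a * (t - τ))..(x + a * (t - τ)),
          (F (τ, ξ) - nonlin f (closure Q) v (τ, ξ))
      = -∫ r in (x - a * t)..(x + a * t), ∫ s in (x - a * t)..r, K (s, r) := by
    intro t x hp
    rw [← charPt_eq ha t x, hQ.mem_closure_iff] at hp
    obtain ⟨h1, h2, h3⟩ := hp
    have ht : 0 ≤ t := by nlinarith
    have e1 : ∫ τ in (0 : ℝ)..t, ∫ ξ in (x - a * (t - τ))..(x + a * (t - τ)),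
          (F (τ, ξ) - nonlin f (closure Q) v (τ, ξ))
        = ∫ τ in (0 : ℝ)..t, ∫ ξ in (x - a * (t - τ))..(x + a * (t - τ)),
          -(4 * a ^ 2) * K (ξ - a * τ, ξ + a * τ) := by
      refine intervalIntegral.integral_congr fun τ hτ => ?_
      rw [uIcc_of_le ht] at hτ
      refine intervalIntegral.integral_congr fun ξ hξ => ?_
      have h4 : 0 ≤ a * (t - τ) := mul_nonneg ha.le (sub_nonneg.2 hτ.2)
      have h5 : 0 ≤ a * τ := mul_nonneg ha.le hτ.1
      rw [uIcc_of_le (by linarith)] at hξ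
      obtain ⟨hξ1, hξ2⟩ := hξ
      have hmem : charPt a (ξ - a * τ, ξ + a * τ) ∈ closure Q := by
        rw [hQ.mem_closure_iff]
        refine ⟨hQ.ordConnected.out h1 h2 ⟨?_, ?_⟩, hQ.ordConnected.out h1 h2 ⟨?_, ?_⟩, ?_⟩ <;>
          linarith
      rw [hKv _ hmem, charPt_eq ha]
      field_simp
      ring
    rw [e1, integral_triangle ha (K := fun w => -(4 * a ^ 2) * K w) (by fun_prop)]
    simp only [intervalIntegral.integral_const_mul]
    field_simp
    norm_num
  constructor
  · intro h y z hw
    have h1 := h (charPt a (y, z)).1 (charPt a (y, z)).2 hw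
    rw [key (charPt a (y, z)).1 (charPt a (y, z)).2 hw] at h1
    have hy : (charPt a (y, z)).2 - a * (charPt a (y, z)).1 = y := by
      simp only [charPt]; field_simp; ring
    have hz : (charPt a (y, z)).2 + a * (charPt a (y, z)).1 = z := by
      simp only [charPt]; field_simp; ring
    rw [hy, hz] at h1
    exact h1
  · intro h t x hp
    have h1 := h (x - a * t) (x + a * t) (by rwa [charPt_eq ha])
    rw [charPt_eq ha] at h1
    rw [key t x hp, h1]
    ring

/-- The Cauchy problem is equivalent to d'Alembert's formula. For the converse, subtracting the
formula from the identity `eq_integral`, valid for every `C²` function, leaves a vanishing triangle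
integral of the defect of the equation. -/
theorem solvesCauchy_iff_dAlembert (hQ : IsCauchyRegion a J Q) (ha : 0 < a)
    (hφ : ContDiff ℝ 2 φ) (hψ : Continuous ψ) (hF : Continuous F) (hf : Continuous f)
    (hv : ContDiffOn ℝ 2 v (closure Q)) :
    SolvesCauchy a φ ψ F f J (closure Q) v ↔ DAlembert a φ ψ F f (closure Q) v := by
  obtain ⟨r, hrc, hrS, hrid⟩ := hQ.exists_retraction_prod
  obtain ⟨ρ, hρc, -, hρJ, hρid⟩ := hQ.exists_retraction
  have hS := hQ.uniqueDiffOn_region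
  have hSi := hQ.subset_closure_interior
  set S := closure Q with hSdef
  have hφ' : Continuous (deriv φ) := hφ.continuous_deriv one_le_two
  let H : ℝ × ℝ → ℝ := fun w => dy a S (dz a S v) (charPt a (r w))
  let K : ℝ × ℝ → ℝ := fun w => (nonlin f S v (charPt a (r w)) - F (charPt a (r w))) / (4 * a ^ 2)
  let M : ℝ → ℝ := fun x => dz a S v (0, ρ x)
  have hH : Continuous H := continuous_comp_charPt (continuousOn_dy_dz hS hv) hrc hrS
  have hK : Continuous K :=
    ((continuous_comp_charPt (continuousOn_nonlin hf hS hv) hrc hrS).sub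
      (hF.comp (by fun_prop))).div_const _
  have hM : Continuous M :=
    (contDiffOn_dz hS hv (a := a) (m := 1) (by norm_num)).continuousOn.comp_continuous
      (by fun_prop) fun x => hQ.zero_mem (hρJ x)
  have hHv : ∀ w, charPt a w ∈ S → H w = dy a S (dz a S v) (charPt a w) := fun w hw => by
    simp only [H, hrid w hw]
  have hKv : ∀ w, charPt a w ∈ S →
      K w = (nonlin f S v (charPt a w) - F (charPt a w)) / (4 * a ^ 2) := fun w hw => by
    simp only [K, hrid w hw]
  have hMv : ∀ x ∈ J, M x = dz a S v (0, x) := fun x hx => by simp only [M, hρid x hx]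
  have hA := fun {y z : ℝ} (hw : charPt a (y, z) ∈ S) =>
    hQ.eq_integral hv hH hHv hM hMv hw
  have hdx : (∀ x ∈ J, v (0, x) = φ x) → ∀ x ∈ J, dx S v (0, x) = deriv φ x := fun h x hx =>
    hQ.dx_init hv hφ h hx
  rw [hQ.dAlembert_iff ha hK hKv]
  have hφI : ∀ y z, ∫ s in y..z, deriv φ s / 2 + ψ s / (2 * a)
      = (φ z - φ y) / 2 + 1 / (2 * a) * ∫ s in y..z, ψ s := by
    intro y z
    rw [intervalIntegral.integral_add ((hφ'.div_const 2).intervalIntegrable _ _)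
      ((hψ.div_const _).intervalIntegrable _ _), intervalIntegral.integral_div,
      intervalIntegral.integral_div, intervalIntegral.integral_eq_sub_of_hasDerivAt
        (fun s _ => (hφ.differentiable two_ne_zero s).hasDerivAt) (hφ'.intervalIntegrable _ _)]
    ring
  constructor
  · intro h y z hw
    obtain ⟨hy, hz, hyz⟩ := (hQ.mem_closure_iff y z).1 hw
    have e1 : ∫ s in y..z, M s = ∫ s in y..z, deriv φ s / 2 + ψ s / (2 * a) := by
      refine intervalIntegral.integral_congr fun s hs => ?_
      have hs' : s ∈ J := hQ.ordConnected.uIcc_subset hy hz hs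
      simp only [hMv s hs', dz, hdx h.init s hs', h.init_dt s hs']
    have e2 : ∫ q in y..z, ∫ s in y..q, H (s, q) = ∫ q in y..z, ∫ s in y..q, K (s, q) := by
      refine intervalIntegral.integral_congr fun q hq => intervalIntegral.integral_congr
        fun s hs => ?_
      rw [uIcc_of_le hyz] at hq
      rw [uIcc_of_le hq.1] at hs
      have hmem : charPt a (s, q) ∈ S := (hQ.mem_closure_iff _ _).2
        ⟨hQ.ordConnected.out hy hz ⟨hs.1, hs.2.trans hq.2⟩, hQ.ordConnected.out hy hz hq, hs.2⟩
      simp only [hHv _ hmem, hKv _ hmem]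
      exact (pde_iff ha hS hSi hv hmem).1 (h.pde _ hmem)
    rw [hA hw, h.init y hy, e1, e2, hφI]
    ring
  · intro h
    have hinit : ∀ x ∈ J, v (0, x) = φ x := fun x hx => by
      have := h x x ((hQ.mem_closure_iff x x).2 ⟨hx, hx, le_rfl⟩)
      simp only [charPt_self, intervalIntegral.integral_same] at this
      rw [this]
      ring
    have hzero := eq_zero_of_integral_triangle (J := J)
      (M := fun s => M s - (deriv φ s / 2 + ψ s / (2 * a))) (E := fun w => H w - K w)
      (by fun_prop) (by fun_prop) fun y hy z hz hyz => by
        have hw := (hQ.mem_closure_iff y z).2 ⟨hy, hz, hyz⟩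
        have e1 := hA hw
        have e2 := h y z hw
        have e3 : ∀ q, ∫ s in y..q, (H (s, q) - K (s, q))
            = (∫ s in y..q, H (s, q)) - ∫ s in y..q, K (s, q) := fun q =>
          intervalIntegral.integral_sub
            ((by fun_prop : Continuous fun s => H (s, q)).intervalIntegrable _ _)
            ((by fun_prop : Continuous fun s => K (s, q)).intervalIntegrable _ _)
        simp only [e3]
        rw [intervalIntegral.integral_sub (hM.intervalIntegrable _ _)
          ((by fun_prop : Continuous fun s =>
            deriv φ s / 2 + ψ s / (2 * a)).intervalIntegrable _ _), hφI,
          intervalIntegral.integral_sub ((continuous_integral_fst hH y).intervalIntegrable _ _)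
          ((continuous_integral_fst hK y).intervalIntegrable _ _)]
        rw [hinit y hy] at e1
        linarith
    have hM0 : EqOn (fun s => M s - (deriv φ s / 2 + ψ s / (2 * a))) (fun _ => 0) J :=
      Set.EqOn.of_subset_closure hzero.1 (by fun_prop) (by fun_prop) interior_subset
        hQ.subset_closure_int
    refine ⟨pde_of_dense ha hF.continuousOn hf hS hSi hv subset_closure hSdef.le ?_, hinit,
      fun x hx => ?_⟩
    · intro p hp
      obtain ⟨y, z, rfl⟩ := exists_charPt ha p
      have hmem : charPt a (y, z) ∈ S := subset_closure hp
      obtain ⟨hy, hz, hyz⟩ := (hQ.mem_iff y z).1 hp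
      rw [pde_iff ha hS hSi hv hmem, ← hHv _ hmem, ← hKv _ hmem]
      exact sub_eq_zero.1 (hzero.2 y hy z hz hyz)
    · have e1 := hM0 hx
      simp only [hMv x hx, dz, hdx hinit x hx] at e1
      field_simp at e1
      linarith

end IsCauchyRegion

/-! ### The three regions and the Goursat problem -/

theorem charPt_add {a : ℝ} (ha : 0 < a) (y z : ℝ) :
    (charPt a (y, z)).2 + a * (charPt a (y, z)).1 = z := by
  simp only [charPt]; field_simp; ring

theorem charPt_sub {a : ℝ} (ha : 0 < a) (y z : ℝ) :
    (charPt a (y, z)).2 - a * (charPt a (y, z)).1 = y := by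
  simp only [charPt]; field_simp; ring

theorem charPt_fst_pos {a : ℝ} (ha : 0 < a) (y z : ℝ) : 0 < (charPt a (y, z)).1 ↔ y < z := by
  simp only [charPt]
  rw [div_pos_iff_of_pos_right (by positivity), sub_pos]

theorem charPt_fst_nonneg {a : ℝ} (ha : 0 < a) (y z : ℝ) : 0 ≤ (charPt a (y, z)).1 ↔ y ≤ z := by
  simp only [charPt]
  rw [le_div_iff₀ (by positivity), zero_mul, sub_nonneg]

/-- A closed set is the closure of `Q` if some direction leads from each of its points into `Q`. -/
theorem closure_eq_of_direction {Q S : Set (ℝ × ℝ)} (hS : IsClosed S) (hQS : Q ⊆ S) (d : ℝ × ℝ)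
    (h : ∀ p ∈ S, ∀ ε : ℝ, 0 < ε → p + ε • d ∈ Q) : closure Q = S := by
  refine (closure_minimal hQS hS).antisymm fun p hp => ?_
  have hlim : Filter.Tendsto (fun ε : ℝ => p + ε • d) (nhdsWithin 0 (Ioi 0)) (nhds p) :=
    ((by fun_prop : Continuous fun ε : ℝ => p + ε • d).tendsto' 0 p
      (by simp)).mono_left nhdsWithin_le_nhds
  refine mem_closure_of_tendsto hlim ?_
  filter_upwards [self_mem_nhdsWithin] with ε hε
  exact h p hp ε hε

section regions
variable {a : ℝ}

theorem closure_Q1 (ha : 0 < a) (x₀ : ℝ) :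
    closure (Q1 a x₀) = {p | 0 ≤ p.1 ∧ p.2 + a * p.1 ≤ x₀} := by
  refine closure_eq_of_direction ?_ (fun p hp => ⟨hp.1.le, hp.2.le⟩) (1, -(2 * a)) ?_
  · exact (isClosed_le continuous_const continuous_fst).inter
      (isClosed_le (f := fun p : ℝ × ℝ => p.2 + a * p.1) (by fun_prop) continuous_const)
  · rintro p ⟨h1, h2⟩ ε hε
    have := mul_pos ha hε
    constructor
    · simp; linarith
    · simp; linarith

theorem closure_Q2 (ha : 0 < a) (x₀ : ℝ) :
    closure (Q2 a x₀) = {p | 0 ≤ p.1 ∧ x₀ ≤ p.2 - a * p.1} := by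
  refine closure_eq_of_direction ?_ (fun p hp => ⟨hp.1.le, hp.2.le⟩) (1, 2 * a) ?_
  · exact (isClosed_le continuous_const continuous_fst).inter
      (isClosed_le (g := fun p : ℝ × ℝ => p.2 - a * p.1) continuous_const (by fun_prop))
  · rintro p ⟨h1, h2⟩ ε hε
    have := mul_pos ha hε
    constructor
    · simp; linarith
    · simp; linarith

theorem closure_Q3 (ha : 0 < a) (x₀ : ℝ) : closure (Q3 a x₀) =
    {p | 0 ≤ p.1 ∧ x₀ ≤ p.2 + a * p.1 ∧ p.2 - a * p.1 ≤ x₀} := by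
  refine closure_eq_of_direction ?_ (fun p hp => ⟨hp.1.le, hp.2.1.le, hp.2.2.le⟩) (1, 0) ?_
  · exact (isClosed_le continuous_const continuous_fst).inter
      ((isClosed_le (g := fun p : ℝ × ℝ => p.2 + a * p.1) continuous_const (by fun_prop)).inter
      (isClosed_le (f := fun p : ℝ × ℝ => p.2 - a * p.1) (by fun_prop) continuous_const))
  · rintro p ⟨h1, h2, h3⟩ ε hε
    have := mul_pos ha hε
    refine ⟨?_, ?_, ?_⟩
    · simp; linarith
    · simp; linarith
    · simp; linarith

theorem charPt_mem_closure_Q1 (ha : 0 < a) (x₀ : ℝ) (y z : ℝ) :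
    charPt a (y, z) ∈ closure (Q1 a x₀) ↔ y ≤ z ∧ z ≤ x₀ := by
  rw [closure_Q1 ha, mem_ofPred_eq, charPt_fst_nonneg ha, charPt_add ha]

theorem charPt_mem_closure_Q2 (ha : 0 < a) (x₀ : ℝ) (y z : ℝ) :
    charPt a (y, z) ∈ closure (Q2 a x₀) ↔ y ≤ z ∧ x₀ ≤ y := by
  rw [closure_Q2 ha, mem_ofPred_eq, charPt_fst_nonneg ha, charPt_sub ha]

theorem charPt_mem_closure_Q3 (ha : 0 < a) (x₀ : ℝ) (y z : ℝ) :
    charPt a (y, z) ∈ closure (Q3 a x₀) ↔ y ≤ x₀ ∧ x₀ ≤ z := by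
  rw [closure_Q3 ha, mem_ofPred_eq, charPt_fst_nonneg ha, charPt_sub ha, charPt_add ha]
  exact ⟨fun h => ⟨h.2.2, h.2.1⟩, fun h => ⟨h.1.trans h.2, h.2, h.1⟩⟩

theorem charPt_mem_Q3 (ha : 0 < a) (x₀ : ℝ) (y z : ℝ) :
    charPt a (y, z) ∈ Q3 a x₀ ↔ y < x₀ ∧ x₀ < z := by
  rw [Q3, mem_ofPred_eq, charPt_fst_pos ha, charPt_sub ha, charPt_add ha]
  exact ⟨fun h => ⟨h.2.2, h.2.1⟩, fun h => ⟨h.1.trans h.2, h.2, h.1⟩⟩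

theorem isCauchyRegion_Q1 (ha : 0 < a) (x₀ : ℝ) : IsCauchyRegion a (Iic x₀) (Q1 a x₀) where
  convex := ((convex_Ioi (0 : ℝ)).linear_preimage (LinearMap.fst ℝ ℝ ℝ)).inter
    ((convex_Iio x₀).linear_preimage (LinearMap.snd ℝ ℝ ℝ + a • LinearMap.fst ℝ ℝ ℝ))
  isOpen := (isOpen_lt continuous_const continuous_fst).inter
      (isOpen_lt (f := fun p : ℝ × ℝ => p.2 + a * p.1) (by fun_prop) continuous_const)
  nonempty := ⟨(1, x₀ - 2 * a), by simp only [Q1, mem_ofPred_eq]; constructor <;> linarith⟩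
  mem_iff y z := by
    rw [Q1, mem_ofPred_eq, charPt_fst_pos ha, charPt_add ha, interior_Iic]
    exact ⟨fun h => ⟨h.1.trans h.2, h.2, h.1⟩, fun h => ⟨h.2.2, h.2.1⟩⟩
  mem_closure_iff y z := by
    rw [charPt_mem_closure_Q1 ha]
    exact ⟨fun h => ⟨h.1.trans h.2, h.2, h.1⟩, fun h => ⟨h.2.2, h.2.1⟩⟩
  ordConnected := ordConnected_Iic
  uniqueDiffOn := uniqueDiffOn_Iic x₀
  subset_closure_int := by rw [interior_Iic, closure_Iio]
  exists_retraction := ⟨fun x => min x x₀, by fun_prop, fun _ _ h => min_le_min_right _ h,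
    fun x => mem_Iic.2 (min_le_right x x₀), fun _ h => min_eq_left h⟩

theorem isCauchyRegion_Q2 (ha : 0 < a) (x₀ : ℝ) : IsCauchyRegion a (Ici x₀) (Q2 a x₀) where
  convex := ((convex_Ioi (0 : ℝ)).linear_preimage (LinearMap.fst ℝ ℝ ℝ)).inter
    ((convex_Ioi x₀).linear_preimage (LinearMap.snd ℝ ℝ ℝ - a • LinearMap.fst ℝ ℝ ℝ))
  isOpen := (isOpen_lt continuous_const continuous_fst).inter
      (isOpen_lt (g := fun p : ℝ × ℝ => p.2 - a * p.1) continuous_const (by fun_prop))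
  nonempty := ⟨(1, x₀ + 2 * a), by simp only [Q2, mem_ofPred_eq]; constructor <;> linarith⟩
  mem_iff y z := by
    rw [Q2, mem_ofPred_eq, charPt_fst_pos ha, charPt_sub ha, interior_Ici]
    exact ⟨fun h => ⟨h.2, h.2.trans h.1, h.1⟩, fun h => ⟨h.2.2, h.1⟩⟩
  mem_closure_iff y z := by
    rw [charPt_mem_closure_Q2 ha]
    exact ⟨fun h => ⟨h.2, h.2.trans h.1, h.1⟩, fun h => ⟨h.2.2, h.1⟩⟩
  ordConnected := ordConnected_Ici
  uniqueDiffOn := uniqueDiffOn_Ici x₀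
  subset_closure_int := by rw [interior_Ici, closure_Ioi]
  exists_retraction := ⟨fun x => max x x₀, by fun_prop, fun _ _ h => max_le_max_right _ h,
    fun x => mem_Ici.2 (le_max_right x x₀), fun _ h => max_eq_left h⟩

theorem isOpen_Q3 (x₀ : ℝ) : IsOpen (Q3 a x₀) :=
  (isOpen_lt continuous_const continuous_fst).inter
    ((isOpen_lt (g := fun p : ℝ × ℝ => p.2 + a * p.1) continuous_const (by fun_prop)).inter
    (isOpen_lt (f := fun p : ℝ × ℝ => p.2 - a * p.1) (by fun_prop) continuous_const))

theorem uniqueDiffOn_closure_Q3 (ha : 0 < a) (x₀ : ℝ) : UniqueDiffOn ℝ (closure (Q3 a x₀)) :=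
  uniqueDiffOn_closure (((convex_Ioi (0 : ℝ)).linear_preimage (LinearMap.fst ℝ ℝ ℝ)).inter
    (((convex_Ioi x₀).linear_preimage (LinearMap.snd ℝ ℝ ℝ + a • LinearMap.fst ℝ ℝ ℝ)).inter
    ((convex_Iio x₀).linear_preimage (LinearMap.snd ℝ ℝ ℝ - a • LinearMap.fst ℝ ℝ ℝ))))
    (isOpen_Q3 x₀) ⟨(1, x₀), by simp only [Q3, mem_ofPred_eq]; refine ⟨?_, ?_, ?_⟩ <;> linarith⟩

theorem segmentClosed_Q3 (ha : 0 < a) (x₀ : ℝ) :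
    SegmentClosed (fun _ => x₀) {w | charPt a w ∈ closure (Q3 a x₀)} := by
  intro y z hw
  obtain ⟨h1, h2⟩ := (charPt_mem_closure_Q3 ha x₀ y z).1 hw
  refine ⟨fun s hs => (charPt_mem_closure_Q3 ha x₀ _ _).2 ?_,
    fun s hs => (charPt_mem_closure_Q3 ha x₀ _ _).2 ?_⟩
  · rw [uIcc_of_le h2] at hs
    exact ⟨h1, hs.1⟩
  · rw [uIcc_of_ge h1] at hs
    exact ⟨hs.2, h2⟩

theorem exists_retraction_Q3 (ha : 0 < a) (x₀ : ℝ) :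
    ∃ r : ℝ × ℝ → ℝ × ℝ, Continuous r ∧ (∀ w, charPt a (r w) ∈ closure (Q3 a x₀)) ∧
      ∀ w, charPt a w ∈ closure (Q3 a x₀) → r w = w := by
  refine ⟨fun w => (min w.1 x₀, max w.2 x₀), by fun_prop, fun w =>
    (charPt_mem_closure_Q3 ha x₀ _ _).2 ⟨min_le_right _ _, le_max_right _ _⟩, fun w hw => ?_⟩
  obtain ⟨h1, h2⟩ := (charPt_mem_closure_Q3 ha x₀ w.1 w.2).1 hw
  simp only [min_eq_left h1, max_eq_left h2]

end regions

/-- `v` solves the characteristic (Goursat) problem on the middle region, with data given by `u₁`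
and `u₂` on the two characteristics through `(0, x₀)`. -/
structure SolvesGoursat (a x₀ A c₁ c₂ : ℝ) (F : ℝ × ℝ → ℝ) (f : ℝ × ℝ × ℝ × ℝ × ℝ → ℝ)
    (u₁ u₂ v : ℝ × ℝ → ℝ) : Prop where
  pde : ∀ p ∈ closure (Q3 a x₀),
    box a (closure (Q3 a x₀)) v p + nonlin f (closure (Q3 a x₀)) v p = F p
  goursat₁ : ∀ t : ℝ, 0 ≤ t → v (t, x₀ - a * t) = u₁ (t, x₀ - a * t) + A - c₁
  goursat₂ : ∀ t : ℝ, 0 ≤ t → v (t, x₀ + a * t) = u₂ (t, x₀ + a * t) + A - c₂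

section goursat
variable {a x₀ A c₁ c₂ : ℝ} {F : ℝ × ℝ → ℝ} {f : ℝ × ℝ × ℝ × ℝ × ℝ → ℝ} {u₁ u₂ v : ℝ × ℝ → ℝ}

theorem goursat₁_iff (ha : 0 < a) :
    (∀ t : ℝ, 0 ≤ t → v (t, x₀ - a * t) = u₁ (t, x₀ - a * t) + A - c₁) ↔
      ∀ y ≤ x₀, v (charPt a (y, x₀)) = u₁ (charPt a (y, x₀)) + A - c₁ := by
  constructor
  · intro h y hy
    have := h (charPt a (y, x₀)).1 ((charPt_fst_nonneg ha _ _).2 hy)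
    rwa [show x₀ - a * (charPt a (y, x₀)).1 = (charPt a (y, x₀)).2 by
      linarith [charPt_add ha y x₀]] at this
  · intro h t ht
    have := h (x₀ - 2 * a * t) (by nlinarith [mul_nonneg ha.le ht])
    rwa [show charPt a (x₀ - 2 * a * t, x₀) = (t, x₀ - a * t) by
      rw [← charPt_eq ha t (x₀ - a * t)]; congr 2 <;> ring] at this

theorem goursat₂_iff (ha : 0 < a) :
    (∀ t : ℝ, 0 ≤ t → v (t, x₀ + a * t) = u₂ (t, x₀ + a * t) + A - c₂) ↔
      ∀ z, x₀ ≤ z → v (charPt a (x₀, z)) = u₂ (charPt a (x₀, z)) + A - c₂ := by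
  constructor
  · intro h z hz
    have := h (charPt a (x₀, z)).1 ((charPt_fst_nonneg ha _ _).2 hz)
    rwa [show x₀ + a * (charPt a (x₀, z)).1 = (charPt a (x₀, z)).2 by
      linarith [charPt_sub ha x₀ z]] at this
  · intro h t ht
    have := h (x₀ + 2 * a * t) (by nlinarith [mul_nonneg ha.le ht])
    rwa [show charPt a (x₀, x₀ + 2 * a * t) = (t, x₀ + a * t) by
      rw [← charPt_eq ha t (x₀ + a * t)]; congr 2 <;> ring] at this

/-- The parallelogram identity for a `C²` function on the middle region. -/
theorem eq_integral_goursat (ha : 0 < a) (hv : ContDiffOn ℝ 2 v (closure (Q3 a x₀)))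
    {H : ℝ × ℝ → ℝ} (hHv : ∀ w, charPt a w ∈ closure (Q3 a x₀) →
      H w = dy a (closure (Q3 a x₀)) (dz a (closure (Q3 a x₀)) v) (charPt a w))
    (hH : Continuous H) {y z : ℝ} (hw : charPt a (y, z) ∈ closure (Q3 a x₀)) :
    v (charPt a (y, z)) = v (charPt a (y, x₀)) + v (charPt a (x₀, z)) - v (charPt a (x₀, x₀))
      + ∫ s in x₀..y, ∫ r in x₀..z, H (s, r) := by
  have hS := uniqueDiffOn_closure_Q3 ha x₀
  have hSi := closure_subset_closure_interior (isOpen_Q3 (a := a) x₀)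
  have hseg := segmentClosed_Q3 ha x₀
  have hmem := charPt_mem_closure_Q3 ha x₀
  set S := closure (Q3 a x₀)
  have hdy := contDiffOn_dy hS hv (a := a) (m := 1) (by norm_num)
  have hcomm : EqOn (dz a S (dy a S v)) (dy a S (dz a S v)) S := fun p hp =>
    (box_eq ha hS hSi hv hp).2
  obtain ⟨h1, h2⟩ := (hmem y z).1 hw
  have e1 := integral_dy (hv.differentiableOn two_ne_zero) hdy.continuousOn (hseg y z hw).2
  have hw0 := (hmem y x₀).2 ⟨h1, le_rfl⟩
  have e0 := integral_dy (hv.differentiableOn two_ne_zero) hdy.continuousOn (hseg y x₀ hw0).2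
  have e2 : ∀ s ∈ uIcc x₀ y, dy a S v (charPt a (s, z))
      = dy a S v (charPt a (s, x₀)) + ∫ r in x₀..z, H (s, r) := by
    intro s hs
    have hsz := (hseg y z hw).2 s hs
    have e3 := integral_dz (hdy.differentiableOn one_ne_zero)
      ((continuousOn_dy_dz hS hv).congr hcomm) (hseg s z hsz).1
    have e4 : ∫ r in x₀..z, H (s, r) = ∫ r in x₀..z, dz a S (dy a S v) (charPt a (s, r)) :=
      intervalIntegral.integral_congr fun r hr => by
        have := (hseg s z hsz).1 r hr
        simp only [hHv _ this]
        exact (hcomm this).symm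
    rw [e4, e3]
    ring
  have hHc : Continuous fun s => ∫ r in x₀..z, H (s, r) :=
    continuous_integral_param (f := fun q : ℝ × ℝ => H (q.1, q.2)) (by fun_prop) (by fun_prop)
      (by fun_prop)
  have hdyc : ContinuousOn (fun s => dy a S v (charPt a (s, x₀))) (uIcc x₀ y) :=
    hdy.continuousOn.comp (by fun_prop) (hseg y x₀ hw0).2
  rw [intervalIntegral.integral_congr e2, intervalIntegral.integral_add
    hdyc.intervalIntegrable (hHc.intervalIntegrable _ _), e0] at e1
  linarith

/-- A continuous function whose integral over every rectangle `[y, x₀] × [x₀, z]` vanishes is zero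
on the quadrant `y < x₀ < z`: differentiate in each coordinate of the corner `(y, z)`. -/
theorem eq_zero_of_integral_rectangle {E : ℝ × ℝ → ℝ} (hE : Continuous E)
    (h : ∀ y z, y ≤ x₀ → x₀ ≤ z → ∫ s in x₀..y, ∫ r in x₀..z, E (s, r) = 0) {y z : ℝ}
    (hy : y < x₀) (hz : x₀ < z) : E (y, z) = 0 := by
  have hFTC : ∀ {k : ℝ → ℝ} (_ : Continuous k) (b c : ℝ),
      HasDerivAt (fun z => ∫ s in b..z, k s) (k c) c := fun hk b c => by
    simpa using hasDerivAt_integral_add_const hk 0 b c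
  have h1 : ∀ z, x₀ < z → ∫ r in x₀..z, E (y, r) = 0 := by
    intro z hz
    have e1 := hFTC (k := fun s => ∫ r in x₀..z, E (s, r)) (continuous_integral_param
      (f := fun q : ℝ × ℝ => E (q.1, q.2)) (by fun_prop) (by fun_prop) (by fun_prop)) x₀ y
    refine (e1.congr_of_eventuallyEq ?_).unique (hasDerivAt_const y (0 : ℝ))
    filter_upwards [gt_mem_nhds hy] with y' hy'
    exact (h y' z hy'.le hz.le).symm
  have e1 := hFTC (k := fun r => E (y, r)) (by fun_prop) x₀ z
  refine (e1.congr_of_eventuallyEq ?_).unique (hasDerivAt_const z (0 : ℝ))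
  filter_upwards [lt_mem_nhds hz] with z' hz'
  exact (h1 z' hz').symm

/-- The representation on the middle region in characteristic coordinates. -/
theorem parallelogram_iff {φ₁ φ₂ : ℝ → ℝ} (ha : 0 < a) {K : ℝ × ℝ → ℝ}
    (hKv : ∀ w, charPt a w ∈ closure (Q3 a x₀) →
      K w = (nonlin f (closure (Q3 a x₀)) v (charPt a w) - F (charPt a w)) / (4 * a ^ 2)) :
    Parallelogram a x₀ A φ₁ φ₂ F f (closure (Q3 a x₀)) u₁ u₂ v ↔
      ∀ y z, charPt a (y, z) ∈ closure (Q3 a x₀) →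
        v (charPt a (y, z)) = u₁ (charPt a (y, x₀)) + A - φ₁ x₀ - φ₂ x₀ + u₂ (charPt a (x₀, z))
          + ∫ s in x₀..y, ∫ r in x₀..z, K (s, r) := by
  have hseg := segmentClosed_Q3 ha x₀
  set S := closure (Q3 a x₀)
  have key : ∀ y z, charPt a (y, z) ∈ S →
      -(1 / (4 * a ^ 2) * ∫ s in x₀..y, ∫ r in x₀..z,
        (F ((r - s) / (2 * a), (r + s) / 2) - nonlin f S v ((r - s) / (2 * a), (r + s) / 2)))
      = ∫ s in x₀..y, ∫ r in x₀..z, K (s, r) := by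
    intro y z hw
    simp only [← intervalIntegral.integral_const_mul, ← intervalIntegral.integral_neg]
    refine intervalIntegral.integral_congr fun s hs => intervalIntegral.integral_congr
      fun r hr => ?_
    have hsr := (hseg s z ((hseg y z hw).2 s hs)).1 r hr
    simp only [hKv _ hsr]
    change _ = (nonlin f S v (charPt a (s, r)) - F (charPt a (s, r))) / (4 * a ^ 2)
    change -(1 / (4 * a ^ 2) * (F (charPt a (s, r)) - nonlin f S v (charPt a (s, r)))) = _
    ring
  have harg : ∀ t x, ((x₀ + a * t - x) / (2 * a), (x₀ - a * t + x) / 2)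
        = charPt a (x - a * t, x₀) ∧
      ((a * t + x - x₀) / (2 * a), (a * t + x + x₀) / 2) = charPt a (x₀, x + a * t) := fun t x => by
    constructor <;> ext <;> simp only [charPt] <;> ring
  constructor
  · intro h y z hw
    have h1 := h (charPt a (y, z)).1 (charPt a (y, z)).2 hw
    rw [(harg _ _).1, (harg _ _).2, charPt_add ha, charPt_sub ha] at h1
    rw [← key y z hw, ← sub_eq_add_neg]
    exact h1
  · intro h t x hp
    have hp' : charPt a (x - a * t, x + a * t) ∈ S := by rwa [charPt_eq ha]
    have h1 := h (x - a * t) (x + a * t) hp'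
    rw [charPt_eq ha, ← key _ _ hp', ← sub_eq_add_neg] at h1
    rw [(harg t x).1, (harg t x).2]
    exact h1

/-- The Goursat problem is equivalent to the parallelogram representation, provided `u₁` and `u₂`
have the right values at the corner `(0, x₀)`. -/
theorem solvesGoursat_iff_parallelogram {φ₁ φ₂ : ℝ → ℝ} (ha : 0 < a) (hF : Continuous F)
    (hf : Continuous f) (h₁ : u₁ (0, x₀) = φ₁ x₀) (h₂ : u₂ (0, x₀) = φ₂ x₀)
    (hv : ContDiffOn ℝ 2 v (closure (Q3 a x₀))) :
    SolvesGoursat a x₀ A (φ₁ x₀) (φ₂ x₀) F f u₁ u₂ v ↔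
      Parallelogram a x₀ A φ₁ φ₂ F f (closure (Q3 a x₀)) u₁ u₂ v := by
  obtain ⟨r, hrc, hrS, hrid⟩ := exists_retraction_Q3 ha x₀
  have hS := uniqueDiffOn_closure_Q3 ha x₀
  have hSi := closure_subset_closure_interior (isOpen_Q3 (a := a) x₀)
  have hmem := charPt_mem_closure_Q3 ha x₀
  have hmem' := charPt_mem_Q3 ha x₀
  have hseg := segmentClosed_Q3 ha x₀
  let S := closure (Q3 a x₀)
  let H : ℝ × ℝ → ℝ := fun w => dy a S (dz a S v) (charPt a (r w))
  let K : ℝ × ℝ → ℝ := fun w => (nonlin f S v (charPt a (r w)) - F (charPt a (r w))) / (4 * a ^ 2)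
  have hH : Continuous H := continuous_comp_charPt (continuousOn_dy_dz hS hv) hrc hrS
  have hK : Continuous K :=
    ((continuous_comp_charPt (continuousOn_nonlin hf hS hv) hrc hrS).sub
      (hF.comp (by fun_prop))).div_const _
  have hHv : ∀ w, charPt a w ∈ S → H w = dy a S (dz a S v) (charPt a w) := fun w hw => by
    simp only [H, hrid w hw]
  have hKv : ∀ w, charPt a w ∈ S →
      K w = (nonlin f S v (charPt a w) - F (charPt a w)) / (4 * a ^ 2) := fun w hw => by
    simp only [K, hrid w hw]
  have hA := fun {y z : ℝ} (hw : charPt a (y, z) ∈ S) => eq_integral_goursat ha hv hHv hH hw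
  rw [parallelogram_iff ha hKv]
  constructor
  · intro h y z hw
    obtain ⟨hy, hz⟩ := (hmem y z).1 hw
    have g1 := (goursat₁_iff ha).1 h.goursat₁
    have g2 := (goursat₂_iff ha).1 h.goursat₂
    have e2 : ∫ s in x₀..y, ∫ q in x₀..z, H (s, q) = ∫ s in x₀..y, ∫ q in x₀..z, K (s, q) := by
      refine intervalIntegral.integral_congr fun s hs => intervalIntegral.integral_congr
        fun q hq => ?_
      have hsq : charPt a (s, q) ∈ S := (hseg s z ((hseg y z hw).2 s hs)).1 q hq
      simp only [hHv _ hsq, hKv _ hsq]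
      exact (pde_iff ha hS hSi hv hsq).1 (h.pde _ hsq)
    have g3 := g1 x₀ le_rfl
    rw [charPt_self, h₁] at g3
    rw [hA hw, e2, g1 y hy, g2 z hz, charPt_self, g3]
    ring
  · intro h
    have g1 : ∀ y ≤ x₀, v (charPt a (y, x₀)) = u₁ (charPt a (y, x₀)) + A - φ₁ x₀ := fun y hy => by
      have := h y x₀ ((hmem _ _).2 ⟨hy, le_rfl⟩)
      simp only [charPt_self, intervalIntegral.integral_same, intervalIntegral.integral_zero,
        h₂] at this
      rw [this]
      ring
    have g2 : ∀ z, x₀ ≤ z → v (charPt a (x₀, z)) = u₂ (charPt a (x₀, z)) + A - φ₂ x₀ :=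
      fun z hz => by
        have := h x₀ z ((hmem _ _).2 ⟨le_rfl, hz⟩)
        simp only [charPt_self, intervalIntegral.integral_same, h₁] at this
        rw [this]
        ring
    refine ⟨pde_of_dense ha hF.continuousOn hf hS hSi hv subset_closure le_rfl ?_,
      (goursat₁_iff ha).2 g1, (goursat₂_iff ha).2 g2⟩
    intro p hp
    obtain ⟨y, z, rfl⟩ := exists_charPt ha p
    have hw : charPt a (y, z) ∈ S := subset_closure hp
    obtain ⟨hy, hz⟩ := (hmem' y z).1 hp
    rw [pde_iff ha hS hSi hv hw, ← hHv _ hw, ← hKv _ hw]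
    refine sub_eq_zero.1 (eq_zero_of_integral_rectangle (E := fun w => H w - K w) (by fun_prop)
      (fun y z hy hz => ?_) hy hz)
    have hw := (hmem y z).2 ⟨hy, hz⟩
    have e1 := hA hw
    have e2 := h y z hw
    have g3 := g1 x₀ le_rfl
    rw [charPt_self, h₁] at g3
    rw [g1 y hy, g2 z hz, charPt_self, g3] at e1
    have e3 : ∀ s, ∫ q in x₀..z, (H (s, q) - K (s, q))
        = (∫ q in x₀..z, H (s, q)) - ∫ q in x₀..z, K (s, q) := fun s =>
      intervalIntegral.integral_sub
        ((by fun_prop : Continuous fun q => H (s, q)).intervalIntegrable _ _)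
        ((by fun_prop : Continuous fun q => K (s, q)).intervalIntegrable _ _)
    have hc : ∀ {k : ℝ × ℝ → ℝ}, Continuous k → Continuous fun s => ∫ q in x₀..z, k (s, q) :=
      fun {k} hk => continuous_integral_param (f := fun q : ℝ × ℝ => k (q.1, q.2)) (by fun_prop)
        (by fun_prop) (by fun_prop)
    simp only [e3]
    rw [intervalIntegral.integral_sub ((hc hH).intervalIntegrable _ _)
      ((hc hK).intervalIntegrable _ _)]
    linarith

end goursat

section uniqueness

variable {a Λ : ℝ} {F : ℝ × ℝ → ℝ} {f : ℝ × ℝ × ℝ × ℝ × ℝ → ℝ} {v v' : ℝ × ℝ → ℝ}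

theorem SolvesCauchy.eqOn {J : Set ℝ} {Q : Set (ℝ × ℝ)} {φ ψ : ℝ → ℝ} (hQ : IsCauchyRegion a J Q)
    (ha : 0 < a) (hΛ : 0 ≤ Λ) (hg : LipschitzTail Λ (charRhs a F f)) (hφ : ContDiff ℝ 2 φ)
    (hv : ContDiffOn ℝ 2 v (closure Q)) (hv' : ContDiffOn ℝ 2 v' (closure Q))
    (h : SolvesCauchy a φ ψ F f J (closure Q) v) (h' : SolvesCauchy a φ ψ F f J (closure Q) v') :
    EqOn v v' (closure Q) := by
  obtain ⟨r, hrc, hrS, hrid⟩ := hQ.exists_retraction_prod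
  have hJ : ∀ y, charPt a (y, y) ∈ closure Q → y ∈ J := fun y hy =>
    ((hQ.mem_closure_iff y y).1 hy).1
  refine eqOn_of_data (c := id) (m := 0) ha hQ.uniqueDiffOn_region hQ.subset_closure_interior
    continuous_id (fun _ => le_rfl) (fun K hK => ⟨_, isWeight_cauchy hK⟩) hQ.segmentClosed hrc hrS
    hrid hΛ hg hv hv' h.pde h'.pde (fun y hy => ?_) (fun y hy => ?_) (fun y hy => ?_)
  all_goals
    have hyJ := hJ y hy
    simp only [id, charPt_self]
  · rw [h.init y hyJ, h'.init y hyJ]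
  · rw [dy, dy, hQ.dx_init hv hφ h.init hyJ, hQ.dx_init hv' hφ h'.init hyJ, h.init_dt y hyJ,
      h'.init_dt y hyJ]
  · rw [dz, dz, hQ.dx_init hv hφ h.init hyJ, hQ.dx_init hv' hφ h'.init hyJ, h.init_dt y hyJ,
      h'.init_dt y hyJ]

theorem SolvesGoursat.eqOn {x₀ A c₁ c₂ : ℝ} {u₁ u₂ u₁' u₂' : ℝ × ℝ → ℝ} (ha : 0 < a) (hΛ : 0 ≤ Λ)
    (hg : LipschitzTail Λ (charRhs a F f))
    (hv : ContDiffOn ℝ 2 v (closure (Q3 a x₀))) (hv' : ContDiffOn ℝ 2 v' (closure (Q3 a x₀)))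
    (h₁ : EqOn u₁ u₁' (closure (Q1 a x₀))) (h₂ : EqOn u₂ u₂' (closure (Q2 a x₀)))
    (h : SolvesGoursat a x₀ A c₁ c₂ F f u₁ u₂ v)
    (h' : SolvesGoursat a x₀ A c₁ c₂ F f u₁' u₂' v') : EqOn v v' (closure (Q3 a x₀)) := by
  obtain ⟨r, hrc, hrS, hrid⟩ := exists_retraction_Q3 ha x₀
  have hmem := charPt_mem_closure_Q3 ha x₀
  have e1 : ∀ y ∈ Iic x₀, v (charPt a (y, x₀)) = v' (charPt a (y, x₀)) := fun y hy => by
    rw [(goursat₁_iff ha).1 h.goursat₁ y hy, (goursat₁_iff ha).1 h'.goursat₁ y hy,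
      h₁ ((charPt_mem_closure_Q1 ha x₀ y x₀).2 ⟨hy, le_rfl⟩)]
  have e2 : ∀ z ∈ Ici x₀, v (charPt a (x₀, z)) = v' (charPt a (x₀, z)) := fun z hz => by
    rw [(goursat₂_iff ha).1 h.goursat₂ z hz, (goursat₂_iff ha).1 h'.goursat₂ z hz,
      h₂ ((charPt_mem_closure_Q2 ha x₀ x₀ z).2 ⟨hz, le_rfl⟩)]
  have hd := hv.differentiableOn two_ne_zero
  have hd' := hv'.differentiableOn two_ne_zero
  have hy1 : ∀ y ≤ x₀, charPt a (y, x₀) ∈ closure (Q3 a x₀) := fun y hy => (hmem _ _).2 ⟨hy, le_rfl⟩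
  have hz1 : ∀ z, x₀ ≤ z → charPt a (x₀, z) ∈ closure (Q3 a x₀) :=
    fun z hz => (hmem _ _).2 ⟨le_rfl, hz⟩
  refine eqOn_of_data (c := fun _ => x₀) (m := x₀) ha (uniqueDiffOn_closure_Q3 ha x₀)
    (closure_subset_closure_interior (isOpen_Q3 x₀)) continuous_const (fun _ => by simp)
    (fun K hK => ⟨_, isWeight_goursat hK x₀⟩) (segmentClosed_Q3 ha x₀) hrc hrS
    hrid hΛ hg hv hv' h.pde h'.pde (fun y hy => ?_) (fun y hy => ?_) (fun z hz => ?_)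
  · exact e1 y ((hmem _ _).1 hy).1
  · have hy0 := ((hmem _ _).1 hy).1
    exact (uniqueDiffOn_Iic x₀ y hy0).eq_deriv _ ((hasDerivWithinAt_charPt_fst hd hy).mono hy1)
      (((hasDerivWithinAt_charPt_fst hd' hy).mono hy1).congr e1 (e1 y hy0))
  · have hz0 := ((hmem _ _).1 hz).2
    exact (uniqueDiffOn_Ici x₀ z hz0).eq_deriv _ ((hasDerivWithinAt_charPt_snd hd hz).mono hz1)
      (((hasDerivWithinAt_charPt_snd hd' hz).mono hz1).congr e2 (e2 z hz0))

end uniqueness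

/-! ### Classical solutions for data on the whole space -/

section global

variable {a : ℝ} {S : Set (ℝ × ℝ)} {q : ℝ × ℝ → ℝ}

/-- For a function differentiable on the whole plane the relative derivative is the ordinary one. -/
theorem dy_eq_of_hasDerivAt (hS : UniqueDiffOn ℝ S) (hq : Differentiable ℝ q) {y z d : ℝ}
    (hp : charPt a (y, z) ∈ S) (h : HasDerivAt (fun s => q (charPt a (s, z))) d y) :
    dy a S q (charPt a (y, z)) = d := by
  have h1 := hasDerivWithinAt_charPt_fst (a := a) (S := univ) (y := y) (z := z)
    hq.differentiableOn (mem_univ _)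
  simp only [mem_univ, ofPred_true, hasDerivWithinAt_univ] at h1
  rw [← h1.unique h, dy, dy, dx, dx, dt, dt, fderivWithin_univ,
    (hq _).fderivWithin (hS _ hp)]

theorem dz_eq_of_hasDerivAt (hS : UniqueDiffOn ℝ S) (hq : Differentiable ℝ q) {y z d : ℝ}
    (hp : charPt a (y, z) ∈ S) (h : HasDerivAt (fun s => q (charPt a (y, s))) d z) :
    dz a S q (charPt a (y, z)) = d := by
  have h1 := hasDerivWithinAt_charPt_snd (a := a) (S := univ) (y := y) (z := z)
    hq.differentiableOn (mem_univ _)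
  simp only [mem_univ, ofPred_true, hasDerivWithinAt_univ] at h1
  rw [← h1.unique h, dz, dz, dx, dx, dt, dt, fderivWithin_univ,
    (hq _).fderivWithin (hS _ hp)]

/-- A function of the characteristic coordinates, as a function of `(t, x)`. -/
def fromChar (a : ℝ) (V : ℝ × ℝ → ℝ) (p : ℝ × ℝ) : ℝ := V (p.2 - a * p.1, p.2 + a * p.1)

theorem fromChar_charPt (ha : 0 < a) (V : ℝ × ℝ → ℝ) (w : ℝ × ℝ) :
    fromChar a V (charPt a w) = V w := by
  rw [fromChar, charPt_sub ha w.1 w.2, charPt_add ha w.1 w.2]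

theorem contDiff_fromChar {V : ℝ × ℝ → ℝ} {n : WithTop ℕ∞} (hV : ContDiff ℝ n V) :
    ContDiff ℝ n (fromChar a V) := by
  unfold fromChar
  fun_prop

variable {F : ℝ × ℝ → ℝ} {f : ℝ × ℝ × ℝ × ℝ × ℝ → ℝ} {V P Q : ℝ × ℝ → ℝ}

theorem SolvesChar.dy_dz (h : SolvesChar (charRhs a F f) V P Q) (ha : 0 < a)
    (hS : UniqueDiffOn ℝ S) {w : ℝ × ℝ} (hw : charPt a w ∈ S) :
    dy a S (fromChar a V) (charPt a w) = P w ∧ dz a S (fromChar a V) (charPt a w) = Q w := by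
  have hV := (contDiff_fromChar (a := a) h.contDiff).differentiable two_ne_zero
  have h1 : HasDerivAt (fun s : ℝ => (s, w.2)) ((1 : ℝ), (0 : ℝ)) w.1 :=
    (hasDerivAt_id _).prodMk (hasDerivAt_const _ _)
  have h2 : HasDerivAt (fun s : ℝ => (w.1, s)) ((0 : ℝ), (1 : ℝ)) w.2 :=
    (hasDerivAt_const _ _).prodMk (hasDerivAt_id _)
  constructor
  · refine dy_eq_of_hasDerivAt hS hV hw ?_
    simp only [fromChar_charPt ha]
    refine HasDerivAt.congr_deriv ((h.hasFDerivAt w).comp_hasDerivAt w.1 h1) ?_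
    simp
  · refine dz_eq_of_hasDerivAt hS hV hw ?_
    simp only [fromChar_charPt ha]
    refine HasDerivAt.congr_deriv ((h.hasFDerivAt w).comp_hasDerivAt w.2 h2) ?_
    simp

theorem SolvesChar.pde (h : SolvesChar (charRhs a F f) V P Q) (ha : 0 < a)
    (hS : UniqueDiffOn ℝ S) (hSi : S ⊆ closure (interior S)) :
    ∀ p ∈ S, box a S (fromChar a V) p + nonlin f S (fromChar a V) p = F p := by
  intro p hp
  obtain ⟨y, z, rfl⟩ := exists_charPt ha p
  rw [pde_iff ha hS hSi (contDiff_fromChar h.contDiff).contDiffOn hp, nonlin_sub_eq_charRhs ha,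
    (h.dy_dz ha hS hp).1, (h.dy_dz ha hS hp).2, fromChar_charPt ha]
  have h1 : EqOn (dz a S (fromChar a V)) (fromChar a Q) S := fun p hp => by
    obtain ⟨y, z, rfl⟩ := exists_charPt ha p
    rw [(h.dy_dz ha hS hp).2, fromChar_charPt ha]
  have h2 : dy a S (dz a S (fromChar a V)) (charPt a (y, z))
      = dy a S (fromChar a Q) (charPt a (y, z)) := by
    rw [dy, dy, dx, dx, dt, dt, fderivWithin_congr h1 (h1 hp)]
  rw [h2]
  refine dy_eq_of_hasDerivAt hS
    ((contDiff_fromChar h.contDiff_snd).differentiable one_ne_zero) hp ?_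
  simp only [fromChar_charPt ha]
  exact h.hasDerivAt y z

end global

section classical

variable {a x₀ A : ℝ} {φ₁ φ₂ ψ₁ ψ₂ : ℝ → ℝ} {F : ℝ × ℝ → ℝ} {f : ℝ × ℝ × ℝ × ℝ × ℝ → ℝ}
  {u u₁ u₂ u₃ : ℝ × ℝ → ℝ}

/-- If `u` agrees with `v` on a short time segment above `(0, x)`, its one-sided time derivative
there is that of `v` relative to `S`. -/
theorem hasDerivWithinAt_time {S : Set (ℝ × ℝ)} {v : ℝ × ℝ → ℝ} (hv : DifferentiableOn ℝ v S)
    {x δ : ℝ} (hδ : 0 < δ) (hmem : ∀ t ∈ Icc 0 δ, (t, x) ∈ S)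
    (huv : ∀ t ∈ Icc 0 δ, u (t, x) = v (t, x)) :
    HasDerivWithinAt (fun t => u (t, x)) (dt S v (0, x)) (Ici 0) 0 := by
  have h0 : (0 : ℝ) ∈ Icc 0 δ := left_mem_Icc.2 hδ.le
  have h1 : HasDerivAt (fun s : ℝ => (s, x)) ((1 : ℝ), (0 : ℝ)) 0 :=
    (hasDerivAt_id _).prodMk (hasDerivAt_const _ _)
  have h2 : HasDerivWithinAt (fun t => v (t, x)) (dt S v (0, x)) (Icc 0 δ) 0 :=
    (hv _ (hmem 0 h0)).hasFDerivWithinAt.comp_hasDerivWithinAt 0 h1.hasDerivWithinAt hmem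
  exact (h2.congr huv (huv 0 h0)).mono_of_mem_nhdsWithin (Icc_mem_nhdsGE hδ)

theorem mem_Qstar1 (ha : 0 < a) {y z : ℝ} (hyz : y ≤ z) (hz : z < x₀) :
    charPt a (y, z) ∈ Qstar1 a x₀ :=
  ⟨(charPt_mem_closure_Q1 ha x₀ y z).2 ⟨hyz, hz.le⟩, fun h =>
    ((charPt_mem_closure_Q3 ha x₀ y z).1 h).2.not_gt hz⟩

theorem mem_Qstar2 (ha : 0 < a) {y z : ℝ} (hyz : y ≤ z) (hy : x₀ < y) :
    charPt a (y, z) ∈ Qstar2 a x₀ :=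
  ⟨(charPt_mem_closure_Q2 ha x₀ y z).2 ⟨hyz, hy.le⟩, fun h =>
    ((charPt_mem_closure_Q3 ha x₀ y z).1 h).1.not_gt hy⟩

theorem subset_closure_Qstar1 (ha : 0 < a) : closure (Q1 a x₀) ⊆ closure (Qstar1 a x₀) := by
  refine closure_mono fun p hp => ?_
  obtain ⟨y, z, rfl⟩ := exists_charPt ha p
  obtain ⟨-, h2, h3⟩ := ((isCauchyRegion_Q1 ha x₀).mem_iff y z).1 hp
  exact mem_Qstar1 ha h3.le (by simpa using h2)

theorem subset_closure_Qstar2 (ha : 0 < a) : closure (Q2 a x₀) ⊆ closure (Qstar2 a x₀) := by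
  refine closure_mono fun p hp => ?_
  obtain ⟨y, z, rfl⟩ := exists_charPt ha p
  obtain ⟨h1, -, h3⟩ := ((isCauchyRegion_Q2 ha x₀).mem_iff y z).1 hp
  exact mem_Qstar2 ha h3.le (by simpa using h1)

theorem mem_Qstar1_time (ha : 0 < a) {x t : ℝ} (hx : x < x₀) (ht : t ∈ Icc 0 ((x₀ - x) / (2 * a))) :
    (t, x) ∈ Qstar1 a x₀ := by
  have h1 := mul_nonneg ha.le ht.1
  have h2 := (le_div_iff₀ (by positivity)).1 ht.2
  rw [← charPt_eq ha t x]
  exact mem_Qstar1 ha (by linarith) (by linarith)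

theorem mem_Qstar2_time (ha : 0 < a) {x t : ℝ} (hx : x₀ < x) (ht : t ∈ Icc 0 ((x - x₀) / (2 * a))) :
    (t, x) ∈ Qstar2 a x₀ := by
  have h1 := mul_nonneg ha.le ht.1
  have h2 := (le_div_iff₀ (by positivity)).1 ht.2
  rw [← charPt_eq ha t x]
  exact mem_Qstar2 ha (by linarith) (by linarith)

theorem HasC2Pieces.hasDerivWithinAt_left (h : HasC2Pieces a x₀ u u₁ u₂ u₃) (ha : 0 < a) {x : ℝ}
    (hx : x < x₀) :
    HasDerivWithinAt (fun t => u (t, x)) (dt (closure (Q1 a x₀)) u₁ (0, x)) (Ici 0) 0 :=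
  hasDerivWithinAt_time (h.smooth₁.differentiableOn two_ne_zero)
    (div_pos (sub_pos.2 hx) (by positivity : 0 < 2 * a))
    (fun _ ht => (mem_Qstar1_time ha hx ht).1) fun _ ht => h.eq₁ (mem_Qstar1_time ha hx ht)

theorem HasC2Pieces.hasDerivWithinAt_right (h : HasC2Pieces a x₀ u u₁ u₂ u₃) (ha : 0 < a) {x : ℝ}
    (hx : x₀ < x) :
    HasDerivWithinAt (fun t => u (t, x)) (dt (closure (Q2 a x₀)) u₂ (0, x)) (Ici 0) 0 :=
  hasDerivWithinAt_time (h.smooth₂.differentiableOn two_ne_zero)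
    (div_pos (sub_pos.2 hx) (by positivity : 0 < 2 * a))
    (fun _ ht => (mem_Qstar2_time ha hx ht).1) fun _ ht => h.eq₂ (mem_Qstar2_time ha hx ht)

/-- Initial conditions on the interior of `J` extend to `J`. -/
theorem solvesCauchy_of_interior {J : Set ℝ} {Q : Set (ℝ × ℝ)} {φ ψ : ℝ → ℝ} {v : ℝ × ℝ → ℝ}
    (hQ : IsCauchyRegion a J Q) (hφ : Continuous φ) (hψ : Continuous ψ)
    (hv : ContDiffOn ℝ 2 v (closure Q))
    (hpde : ∀ p ∈ closure Q, box a (closure Q) v p + nonlin f (closure Q) v p = F p)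
    (h0 : ∀ x ∈ interior J, v (0, x) = φ x)
    (h1 : ∀ x ∈ interior J, dt (closure Q) v (0, x) = ψ x) :
    SolvesCauchy a φ ψ F f J (closure Q) v where
  pde := hpde
  init := Set.EqOn.of_subset_closure (s := interior J) h0
    (hv.continuousOn.comp (by fun_prop) fun _ hx => hQ.zero_mem hx) hφ.continuousOn
    interior_subset hQ.subset_closure_int
  init_dt := Set.EqOn.of_subset_closure (s := interior J) h1
    ((contDiffOn_dt hQ.uniqueDiffOn_region hv (m := 1) (by norm_num)).continuousOn.comp
      (by fun_prop) fun _ hx => hQ.zero_mem hx) hψ.continuousOn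
    interior_subset hQ.subset_closure_int

/-- A classical solution amounts to two Cauchy problems on the outer regions, coupled to a Goursat
problem on the middle one. -/
theorem isClassicalSolutionWith_iff (ha : 0 < a) (hφ₁ : Continuous φ₁) (hφ₂ : Continuous φ₂)
    (hψ₁ : Continuous ψ₁) (hψ₂ : Continuous ψ₂) (hF : Continuous F) (hf : Continuous f)
    (hC : HasC2Pieces a x₀ u u₁ u₂ u₃) :
    IsClassicalSolutionWith a x₀ A φ₁ φ₂ ψ₁ ψ₂ F f u u₁ u₂ u₃ ↔
      SolvesCauchy a φ₁ ψ₁ F f (Iic x₀) (closure (Q1 a x₀)) u₁ ∧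
      SolvesCauchy a φ₂ ψ₂ F f (Ici x₀) (closure (Q2 a x₀)) u₂ ∧
      SolvesGoursat a x₀ A (φ₁ x₀) (φ₂ x₀) F f u₁ u₂ u₃ := by
  have R1 := isCauchyRegion_Q1 ha x₀
  have R2 := isCauchyRegion_Q2 ha x₀
  have hu1 : ∀ x < x₀, u (0, x) = u₁ (0, x) := fun x hx =>
    hC.eq₁ (by rw [← charPt_self a]; exact mem_Qstar1 ha le_rfl hx)
  have hu2 : ∀ x, x₀ < x → u (0, x) = u₂ (0, x) := fun x hx =>
    hC.eq₂ (by rw [← charPt_self a]; exact mem_Qstar2 ha le_rfl hx)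
  constructor
  · intro h
    refine ⟨solvesCauchy_of_interior R1 hφ₁ hψ₁ hC.smooth₁ ?_ ?_ ?_,
      solvesCauchy_of_interior R2 hφ₂ hψ₂ hC.smooth₂ ?_ ?_ ?_, h.pde₃, h.goursat₁, h.goursat₂⟩
    · exact pde_of_dense ha hF.continuousOn hf R1.uniqueDiffOn_region R1.subset_closure_interior
        hC.smooth₁ sdiff_subset (subset_closure_Qstar1 ha) h.pde₁
    · intro x hx
      rw [interior_Iic, mem_Iio] at hx
      rw [← hu1 x hx, h.init, phi, if_pos hx]
    · intro x hx
      rw [interior_Iic, mem_Iio] at hx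
      have := h.init_dt x hx.ne
      rw [psi, if_pos hx] at this
      exact (uniqueDiffWithinAt_Ici 0).eq_deriv _ (hC.hasDerivWithinAt_left ha hx) this
    · exact pde_of_dense ha hF.continuousOn hf R2.uniqueDiffOn_region R2.subset_closure_interior
        hC.smooth₂ sdiff_subset (subset_closure_Qstar2 ha) h.pde₂
    · intro x hx
      rw [interior_Ici, mem_Ioi] at hx
      rw [← hu2 x hx, h.init, phi, if_neg hx.not_gt, if_neg hx.ne']
    · intro x hx
      rw [interior_Ici, mem_Ioi] at hx
      have := h.init_dt x hx.ne'
      rw [psi, if_neg hx.not_gt] at this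
      exact (uniqueDiffWithinAt_Ici 0).eq_deriv _ (hC.hasDerivWithinAt_right ha hx) this
  · rintro ⟨h1, h2, h3⟩
    refine ⟨hC, fun p hp => h1.pde p hp.1, fun p hp => h2.pde p hp.1, h3.pde, fun x => ?_,
      fun x hx => ?_, h3.goursat₁, h3.goursat₂⟩
    · rcases lt_trichotomy x x₀ with hx | rfl | hx
      · rw [hu1 x hx, h1.init x hx.le, phi, if_pos hx]
      · have e1 : u (0, x) = u₃ (0, x) := hC.eq₃ (by
          rw [← charPt_self a]
          exact (charPt_mem_closure_Q3 ha x x x).2 ⟨le_rfl, le_rfl⟩)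
        have e2 := h3.goursat₁ 0 le_rfl
        rw [mul_zero, sub_zero, h1.init x (mem_Iic.2 le_rfl)] at e2
        rw [e1, e2, phi, if_neg (lt_irrefl x), if_pos rfl]
        ring
      · rw [hu2 x hx, h2.init x hx.le, phi, if_neg hx.not_gt, if_neg hx.ne']
    · rcases lt_or_gt_of_ne hx with hx | hx
      · rw [psi, if_pos hx, ← h1.init_dt x hx.le]
        exact hC.hasDerivWithinAt_left ha hx
      · rw [psi, if_neg hx.not_gt, ← h2.init_dt x hx.le]
        exact hC.hasDerivWithinAt_right ha hx

/-- For data defined and smooth on the whole space, the classical and the integral formulations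
are equivalent. -/
theorem classical_iff_represented (ha : 0 < a) (hφ₁ : ContDiff ℝ 2 φ₁) (hφ₂ : ContDiff ℝ 2 φ₂)
    (hψ₁ : Continuous ψ₁) (hψ₂ : Continuous ψ₂) (hF : Continuous F) (hf : Continuous f) :
    IsClassicalSolutionWith a x₀ A φ₁ φ₂ ψ₁ ψ₂ F f u u₁ u₂ u₃ ↔
      IsRepresentedBy a x₀ A φ₁ φ₂ ψ₁ ψ₂ F f u u₁ u₂ u₃ := by
  have R1 := isCauchyRegion_Q1 ha x₀
  have R2 := isCauchyRegion_Q2 ha x₀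
  have key : ∀ hC : HasC2Pieces a x₀ u u₁ u₂ u₃, IsClassicalSolutionWith a x₀ A φ₁ φ₂ ψ₁ ψ₂ F f
      u u₁ u₂ u₃ ↔ DAlembert a φ₁ ψ₁ F f (closure (Q1 a x₀)) u₁ ∧
        DAlembert a φ₂ ψ₂ F f (closure (Q2 a x₀)) u₂ ∧
        Parallelogram a x₀ A φ₁ φ₂ F f (closure (Q3 a x₀)) u₁ u₂ u₃ := by
    intro hC
    rw [isClassicalSolutionWith_iff ha hφ₁.continuous hφ₂.continuous hψ₁ hψ₂ hF hf hC,
      ← R1.solvesCauchy_iff_dAlembert ha hφ₁ hψ₁ hF hf hC.smooth₁,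
      ← R2.solvesCauchy_iff_dAlembert ha hφ₂ hψ₂ hF hf hC.smooth₂]
    refine and_congr_right fun h1 => and_congr_right fun h2 => ?_
    exact solvesGoursat_iff_parallelogram ha hF hf (h1.init x₀ (mem_Iic.2 le_rfl))
      (h2.init x₀ (mem_Ici.2 le_rfl)) hC.smooth₃
  constructor
  · intro h
    obtain ⟨h1, h2, h3⟩ := (key h.toHasC2Pieces).1 h
    exact ⟨h.toHasC2Pieces, h1, h2, h3⟩
  · intro h
    exact (key h.toHasC2Pieces).2 ⟨h.rep₁, h.rep₂, h.rep₃⟩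

theorem IsClassicalSolution.eqOn {Λ : ℝ} {v : ℝ × ℝ → ℝ} (ha : 0 < a) (hφ₁ : ContDiff ℝ 2 φ₁)
    (hφ₂ : ContDiff ℝ 2 φ₂) (hψ₁ : Continuous ψ₁) (hψ₂ : Continuous ψ₂) (hF : Continuous F)
    (hf : Continuous f) (hΛ : 0 ≤ Λ) (hg : LipschitzTail Λ (charRhs a F f))
    (hu : IsClassicalSolution a x₀ A φ₁ φ₂ ψ₁ ψ₂ F f u)
    (hv : IsClassicalSolution a x₀ A φ₁ φ₂ ψ₁ ψ₂ F f v) : EqOn u v Qbar := by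
  obtain ⟨u₁, u₂, u₃, hu⟩ := hu
  obtain ⟨v₁, v₂, v₃, hv⟩ := hv
  obtain ⟨hu1, hu2, hu3⟩ := (isClassicalSolutionWith_iff ha hφ₁.continuous hφ₂.continuous hψ₁ hψ₂
    hF hf hu.toHasC2Pieces).1 hu
  obtain ⟨hv1, hv2, hv3⟩ := (isClassicalSolutionWith_iff ha hφ₁.continuous hφ₂.continuous hψ₁ hψ₂
    hF hf hv.toHasC2Pieces).1 hv
  have e1 := hu1.eqOn (isCauchyRegion_Q1 ha x₀) ha hΛ hg hφ₁ hu.smooth₁ hv.smooth₁ hv1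
  have e2 := hu2.eqOn (isCauchyRegion_Q2 ha x₀) ha hΛ hg hφ₂ hu.smooth₂ hv.smooth₂ hv2
  have e3 := hu3.eqOn ha hΛ hg hu.smooth₃ hv.smooth₃ e1 e2 hv3
  intro p hp
  obtain ⟨y, z, rfl⟩ := exists_charPt ha p
  have hyz := (charPt_fst_nonneg ha y z).1 hp
  by_cases hz : z < x₀
  · have hm := mem_Qstar1 ha hyz hz
    rw [hu.eq₁ hm, hv.eq₁ hm, e1 hm.1]
  by_cases hy : x₀ < y
  · have hm := mem_Qstar2 ha hyz hy
    rw [hu.eq₂ hm, hv.eq₂ hm, e2 hm.1]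
  · have hm : charPt a (y, z) ∈ closure (Q3 a x₀) :=
      (charPt_mem_closure_Q3 ha x₀ y z).2 ⟨not_lt.1 hy, not_lt.1 hz⟩
    rw [hu.eq₃ hm, hv.eq₃ hm, e3 hm]

/-- One function on the whole plane solves the Cauchy problem on every region over an interval. -/
theorem exists_solvesCauchy {Λ : ℝ} {φ ψ : ℝ → ℝ} (ha : 0 < a) (hφ : ContDiff ℝ 2 φ)
    (hψ : ContDiff ℝ 1 ψ) (hg : ContDiff ℝ 1 (charRhs a F f)) (hΛ : 0 ≤ Λ)
    (hL : LipschitzTail Λ (charRhs a F f)) :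
    ∃ V : ℝ × ℝ → ℝ, ContDiff ℝ 2 V ∧ ∀ J Q, IsCauchyRegion a J Q →
      SolvesCauchy a φ ψ F f J (closure Q) (fromChar a V) := by
  obtain ⟨V, P, Z, hV, hdata⟩ := exists_solvesChar_cauchy hg hΛ hL hφ (hψ.div_const (2 * a))
  refine ⟨V, hV.contDiff, fun J Q hQ => ⟨hV.pde ha hQ.uniqueDiffOn_region
    hQ.subset_closure_interior, fun x _ => ?_, fun x hx => ?_⟩⟩
  · rw [← charPt_self a, fromChar_charPt ha, (hdata x).1]
  · have hm := hQ.zero_mem hx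
    rw [← charPt_self a] at hm ⊢
    rw [dt_eq ha, (hV.dy_dz ha hQ.uniqueDiffOn_region hm).1,
      (hV.dy_dz ha hQ.uniqueDiffOn_region hm).2, (hdata x).2.1, (hdata x).2.2]
    field_simp
    ring

theorem exists_isClassicalSolution {Λ : ℝ} (ha : 0 < a) (hφ₁ : ContDiff ℝ 2 φ₁)
    (hφ₂ : ContDiff ℝ 2 φ₂) (hψ₁ : ContDiff ℝ 1 ψ₁) (hψ₂ : ContDiff ℝ 1 ψ₂) (hF : ContDiff ℝ 1 F)
    (hf : ContDiff ℝ 1 f) (hΛ : 0 ≤ Λ) (hL : LipschitzTail Λ (charRhs a F f)) :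
    ∃ u, IsClassicalSolution a x₀ A φ₁ φ₂ ψ₁ ψ₂ F f u := by
  classical
  have hg := contDiff_charRhs (a := a) hF hf
  obtain ⟨V₁, hV₁, h1⟩ := exists_solvesCauchy ha hφ₁ hψ₁ hg hΛ hL
  obtain ⟨V₂, hV₂, h2⟩ := exists_solvesCauchy ha hφ₂ hψ₂ hg hΛ hL
  have h1 := h1 _ _ (isCauchyRegion_Q1 ha x₀)
  have h2 := h2 _ _ (isCauchyRegion_Q2 ha x₀)
  have e1 := h1.init x₀ (mem_Iic.2 le_rfl)
  have e2 := h2.init x₀ (mem_Ici.2 le_rfl)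
  rw [← charPt_self a, fromChar_charPt ha] at e1 e2
  obtain ⟨V₃, P, Z, hV₃, hα, hβ⟩ := exists_solvesChar_goursat hg hΛ hL
    (α := fun y => V₁ (y, x₀) + A - φ₁ x₀) (β := fun z => V₂ (x₀, z) + A - φ₂ x₀)
    (by fun_prop) (by fun_prop) x₀ (by rw [e1, e2]; ring)
  have h3 : SolvesGoursat a x₀ A (φ₁ x₀) (φ₂ x₀) F f (fromChar a V₁) (fromChar a V₂)
      (fromChar a V₃) := by
    refine ⟨hV₃.pde ha (uniqueDiffOn_closure_Q3 ha x₀)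
      (closure_subset_closure_interior (isOpen_Q3 x₀)), (goursat₁_iff ha).2 fun y _ => ?_,
      (goursat₂_iff ha).2 fun z _ => ?_⟩
    · rw [fromChar_charPt ha, fromChar_charPt ha, hα]
    · rw [fromChar_charPt ha, fromChar_charPt ha, hβ]
  let u : ℝ × ℝ → ℝ := fun p => if p ∈ closure (Q3 a x₀) then fromChar a V₃ p
    else if p ∈ closure (Q1 a x₀) then fromChar a V₁ p else fromChar a V₂ p
  have hC : HasC2Pieces a x₀ u (fromChar a V₁) (fromChar a V₂) (fromChar a V₃) := by
    refine ⟨fun p hp => ?_, fun p hp => ?_, fun p hp => if_pos hp,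
      (contDiff_fromChar hV₁).contDiffOn, (contDiff_fromChar hV₂).contDiffOn,
      (contDiff_fromChar hV₃.contDiff).contDiffOn⟩
    · simp only [u, if_neg hp.2, if_pos hp.1]
    · have hp1 : p ∉ closure (Q1 a x₀) := by
        intro hp1
        obtain ⟨y, z, rfl⟩ := exists_charPt ha p
        have m1 := (charPt_mem_closure_Q1 ha x₀ y z).1 hp1
        have m2 := (charPt_mem_closure_Q2 ha x₀ y z).1 hp.1
        exact hp.2 ((charPt_mem_closure_Q3 ha x₀ y z).2 ⟨m1.1.trans m1.2, m2.2.trans m2.1⟩)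
      simp only [u, if_neg hp.2, if_neg hp1]
  exact ⟨u, _, _, _, (isClassicalSolutionWith_iff ha hφ₁.continuous hφ₂.continuous
    hψ₁.continuous hψ₂.continuous hF.continuous hf.continuous hC).2 ⟨h1, h2, h3⟩⟩

end classical

/-! ### Extension of the data -/

section extension

/-- A `C¹` function on an interval extends to a `C¹` function on the line, by extending its
derivative continuously. -/
theorem exists_contDiff_one_extension {J : Set ℝ} (hJ : J.OrdConnected) (hJu : UniqueDiffOn ℝ J)
    {ρ : ℝ → ℝ} (hρ : Continuous ρ) (hρJ : ∀ x, ρ x ∈ J) (hρid : ∀ x ∈ J, ρ x = x)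
    {k : ℝ → ℝ} (hk : ContDiffOn ℝ 1 k J) : ∃ k' : ℝ → ℝ, ContDiff ℝ 1 k' ∧ EqOn k' k J := by
  have hd : ContinuousOn (derivWithin k J) J := hk.continuousOn_derivWithin hJu le_rfl
  have hc : Continuous fun s => derivWithin k J (ρ s) := hd.comp_continuous hρ hρJ
  refine ⟨fun x => k (ρ 0) + ∫ s in ρ 0..x, derivWithin k J (ρ s), ?_, fun x hx => ?_⟩
  · have h := hasDerivAt_integral_add_const hc (k (ρ 0)) (ρ 0)
    rw [contDiff_one_iff_deriv]
    refine ⟨fun x => (h x).differentiableAt, ?_⟩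
    rwa [funext fun x => (h x).deriv]
  · have hsub := hJ.uIcc_subset (hρJ 0) hx
    have h1 : ∫ s in ρ 0..x, derivWithin k J (ρ s) = k x - k (ρ 0) :=
      integral_eq_sub_of_hasDerivWithinAt_uIcc (fun s hs => by
        rw [hρid s (hsub hs)]
        exact ((hk.differentiableOn one_ne_zero s (hsub hs)).hasDerivWithinAt).mono hsub)
        hc.continuousOn
    simp only [h1]
    ring

/-- The `C²` analogue: integrate the `C¹` extension of the derivative. -/
theorem exists_contDiff_two_extension {J : Set ℝ} (hJ : J.OrdConnected) (hJu : UniqueDiffOn ℝ J)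
    {ρ : ℝ → ℝ} (hρ : Continuous ρ) (hρJ : ∀ x, ρ x ∈ J) (hρid : ∀ x ∈ J, ρ x = x)
    {k : ℝ → ℝ} (hk : ContDiffOn ℝ 2 k J) : ∃ k' : ℝ → ℝ, ContDiff ℝ 2 k' ∧ EqOn k' k J := by
  obtain ⟨χ, hχ, hχk⟩ := exists_contDiff_one_extension hJ hJu hρ hρJ hρid
    (hk.derivWithin hJu (m := 1) (by norm_num))
  have h := hasDerivAt_integral_add_const hχ.continuous (k (ρ 0)) (ρ 0)
  refine ⟨fun x => k (ρ 0) + ∫ s in ρ 0..x, χ s, ?_, fun x hx => ?_⟩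
  · rw [show (2 : WithTop ℕ∞) = 1 + 1 by norm_num, contDiff_succ_iff_deriv]
    refine ⟨fun x => (h x).differentiableAt, by simp, ?_⟩
    rwa [funext fun x => (h x).deriv]
  · have hsub := hJ.uIcc_subset (hρJ 0) hx
    have h1 : ∫ s in ρ 0..x, χ s = k x - k (ρ 0) :=
      integral_eq_sub_of_hasDerivWithinAt_uIcc (fun s hs => by
        rw [hχk (hsub hs)]
        exact ((hk.differentiableOn two_ne_zero s (hsub hs)).hasDerivWithinAt).mono hsub)
        hχ.continuous.continuousOn
    simp only [h1]
    ring

/-- The extension of `f` from the half-space `0 ≤ t` by odd reflection about its boundary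
values. -/
noncomputable def reflectExt {E : Type*} (f : ℝ × E → ℝ) (q : ℝ × E) : ℝ :=
  if 0 ≤ q.1 then f q else 2 * f (0, q.2) - f (-q.1, q.2)

/-- The reflection keeps both the values and the first derivatives continuous across `t = 0`. -/
theorem contDiff_reflectExt {E : Type*} [NormedAddCommGroup E] [NormedSpace ℝ E] {f : ℝ × E → ℝ}
    (hf : ContDiffOn ℝ 1 f {q | 0 ≤ q.1}) : ContDiff ℝ 1 (reflectExt f) := by
  have hS : UniqueDiffOn ℝ {q : ℝ × E | 0 ≤ q.1} := by
    have := (uniqueDiffOn_Ici (0 : ℝ)).prod (uniqueDiffOn_univ (𝕜 := ℝ) (E := E))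
    convert this using 1
    ext q
    simp
  let f' : ℝ × E → ℝ × E →L[ℝ] ℝ := fderivWithin ℝ f {q | 0 ≤ q.1}
  have hf'c : ContinuousOn f' {q | 0 ≤ q.1} := hf.continuousOn_fderivWithin hS le_rfl
  have hf' : ∀ q : ℝ × E, 0 ≤ q.1 → HasFDerivWithinAt f (f' q) {q | 0 ≤ q.1} q := fun q hq =>
    (hf.differentiableOn one_ne_zero q hq).hasFDerivWithinAt
  let π : ℝ × E →L[ℝ] ℝ × E := (0 : ℝ × E →L[ℝ] ℝ).prod (ContinuousLinearMap.snd ℝ ℝ E)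
  let R : ℝ × E →L[ℝ] ℝ × E :=
    (-ContinuousLinearMap.fst ℝ ℝ E).prod (ContinuousLinearMap.snd ℝ ℝ E)
  -- `D₁` and `D₂` are the derivatives on the two closed half-spaces, extended continuously
  let D₁ : ℝ × E → ℝ × E →L[ℝ] ℝ := fun q => f' (max q.1 0, q.2)
  let D₂ : ℝ × E → ℝ × E →L[ℝ] ℝ := fun q =>
    (2 : ℝ) • (f' (0, q.2)).comp π - (f' (max (-q.1) 0, q.2)).comp R
  have hD₁ : Continuous D₁ := hf'c.comp_continuous (by fun_prop) fun q =>
    show (0 : ℝ) ≤ max _ _ from le_max_right _ _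
  have hD₂ : Continuous D₂ := by
    have c1 : Continuous fun q : ℝ × E => f' (0, q.2) :=
      hf'c.comp_continuous (by fun_prop) fun q => le_refl (0 : ℝ)
    have c2 : Continuous fun q : ℝ × E => f' (max (-q.1) 0, q.2) :=
      hf'c.comp_continuous (by fun_prop) fun q =>
        show (0 : ℝ) ≤ max _ _ from le_max_right _ _
    exact ((c1.clm_comp continuous_const).const_smul (2 : ℝ)).sub (c2.clm_comp continuous_const)
  have hD : ∀ q : ℝ × E, q.1 = 0 → D₁ q = D₂ q := by
    rintro ⟨t, e⟩ ht
    obtain rfl : t = 0 := ht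
    simp only [D₁, D₂, neg_zero, max_self]
    refine ContinuousLinearMap.ext fun v => ?_
    change f' (0, e) v = (2 : ℝ) • f' (0, e) (π v) - f' (0, e) (R v)
    rw [← map_smul, ← map_sub]
    congr 1
    ext
    · simp [π, R]
    · simp [π, R, two_smul]
  have h1 : ∀ q : ℝ × E, 0 ≤ q.1 →
      HasFDerivWithinAt (reflectExt f) (D₁ q) {q | 0 ≤ q.1} q := fun q hq => by
    have := (hf' q hq).congr (f₁ := reflectExt f) (fun p hp => if_pos hp) (if_pos hq)
    simpa only [D₁, max_eq_left hq] using this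
  have hle : ∀ p : ℝ × E, p.1 ≤ 0 → reflectExt f p = 2 * f (π p) - f (R p) := by
    rintro ⟨t, e⟩ hp
    rcases (show t ≤ 0 from hp).lt_or_eq with h | h
    · simp [reflectExt, h.not_ge, π, R]
    · simp [reflectExt, h, π, R]
      ring
  have h2 : ∀ q : ℝ × E, q.1 ≤ 0 →
      HasFDerivWithinAt (reflectExt f) (D₂ q) {q | q.1 ≤ 0} q := fun q hq => by
    have a1 : HasFDerivWithinAt (fun p => f (π p)) ((f' (π q)).comp π) {q | q.1 ≤ 0} q :=
      (hf' (π q) le_rfl).comp q π.hasFDerivAt.hasFDerivWithinAt fun p _ => le_refl (0 : ℝ)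
    have a2 : HasFDerivWithinAt (fun p => f (R p)) ((f' (R q)).comp R) {q | q.1 ≤ 0} q :=
      (hf' (R q) (neg_nonneg.2 hq)).comp q R.hasFDerivAt.hasFDerivWithinAt
        fun p hp => show 0 ≤ -p.1 from neg_nonneg.2 hp
    have a3 := ((a1.const_mul 2).sub a2).congr (f₁ := reflectExt f) (fun p hp => hle p hp)
      (hle q hq)
    have a4 : D₂ q = (2 : ℝ) • (f' (π q)).comp π - (f' (R q)).comp R := by
      simp only [D₂, max_eq_left (neg_nonneg.2 hq)]
      rfl
    rw [a4]
    exact a3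
  have h3 : ∀ q : ℝ × E, HasFDerivAt (reflectExt f) (if 0 ≤ q.1 then D₁ q else D₂ q) q := by
    intro q
    rcases lt_trichotomy q.1 0 with h | h | h
    · rw [if_neg h.not_ge]
      exact (h2 q h.le).hasFDerivAt (Filter.mem_of_superset
        ((isOpen_lt continuous_fst continuous_const).mem_nhds h) fun p (hp : p.1 < 0) => hp.le)
    · rw [if_pos h.ge]
      have := (h1 q h.ge).union ((hD q h).symm ▸ h2 q h.le)
      rwa [show {q : ℝ × E | 0 ≤ q.1} ∪ {q | q.1 ≤ 0} = univ from
        eq_univ_of_forall fun p => le_total 0 p.1, hasFDerivWithinAt_univ] at this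
    · rw [if_pos h.le]
      exact (h1 q h.le).hasFDerivAt (Filter.mem_of_superset
        ((isOpen_lt continuous_const continuous_fst).mem_nhds h) fun p (hp : 0 < p.1) => hp.le)
  rw [contDiff_one_iff_fderiv]
  refine ⟨fun q => (h3 q).differentiableAt, ?_⟩
  rw [funext fun q => (h3 q).fderiv]
  exact Continuous.if_le hD₁ hD₂ continuous_const continuous_fst fun q hq => hD q hq.symm

theorem lipschitzTail_reflectExt {L : ℝ} (hL : 0 ≤ L) {f : ℝ × ℝ × ℝ × ℝ × ℝ → ℝ}
    (h : ∀ t x z₁ z₂ z₃ w₁ w₂ w₃ : ℝ, 0 ≤ t → |f (t, x, z₁, z₂, z₃) - f (t, x, w₁, w₂, w₃)|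
        ≤ L * (|z₁ - w₁| + |z₂ - w₂| + |z₃ - w₃|)) : LipschitzTail (3 * L) (reflectExt f) := by
  intro t x u p q u' p' q'
  have hpos : 0 ≤ L * (|u - u'| + |p - p'| + |q - q'|) := by positivity
  by_cases ht : 0 ≤ t
  · simp only [reflectExt, if_pos ht]
    linarith [h t x u p q u' p' q' ht]
  · simp only [reflectExt, if_neg ht]
    have b1 := abs_le.1 (h 0 x u p q u' p' q' le_rfl)
    have b2 := abs_le.1 (h (-t) x u p q u' p' q' (by linarith))
    rw [abs_le]
    constructor <;> linarith [b1.1, b1.2, b2.1, b2.2]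

end extension

section congruence

variable {a x₀ A : ℝ} {φ₁ φ₂ ψ₁ ψ₂ φ₁' φ₂' ψ₁' ψ₂' : ℝ → ℝ} {F F' : ℝ × ℝ → ℝ}
  {f f' : ℝ × ℝ × ℝ × ℝ × ℝ → ℝ} {u u₁ u₂ u₃ : ℝ × ℝ → ℝ}

theorem closure_subset_Qbar (ha : 0 < a) : closure (Q1 a x₀) ⊆ Qbar ∧ closure (Q2 a x₀) ⊆ Qbar ∧
    closure (Q3 a x₀) ⊆ Qbar := by
  rw [closure_Q1 ha, closure_Q2 ha, closure_Q3 ha]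
  exact ⟨fun p hp => hp.1, fun p hp => hp.1, fun p hp => hp.1⟩

theorem nonlin_congr (hf : EqOn f f' {q | 0 ≤ q.1}) {S : Set (ℝ × ℝ)} {v : ℝ × ℝ → ℝ} {p : ℝ × ℝ}
    (hp : p ∈ Qbar) : nonlin f S v p = nonlin f' S v p :=
  hf (x := (p.1, p.2, v p, dt S v p, dx S v p)) hp

theorem phi_congr (h₁ : EqOn φ₁ φ₁' (Iic x₀)) (h₂ : EqOn φ₂ φ₂' (Ici x₀)) (x : ℝ) :
    phi x₀ A φ₁ φ₂ x = phi x₀ A φ₁' φ₂' x := by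
  unfold phi
  split_ifs with h h'
  · exact h₁ h.le
  · rfl
  · exact h₂ (not_lt.1 h)

theorem psi_congr (h₁ : EqOn ψ₁ ψ₁' (Iic x₀)) (h₂ : EqOn ψ₂ ψ₂' (Ici x₀)) (x : ℝ) :
    psi x₀ ψ₁ ψ₂ x = psi x₀ ψ₁' ψ₂' x := by
  unfold psi
  split_ifs with h
  · exact h₁ h.le
  · exact h₂ (not_lt.1 h)

theorem IsClassicalSolutionWith.congr (ha : 0 < a) (hφ₁ : EqOn φ₁ φ₁' (Iic x₀))
    (hφ₂ : EqOn φ₂ φ₂' (Ici x₀)) (hψ₁ : EqOn ψ₁ ψ₁' (Iic x₀)) (hψ₂ : EqOn ψ₂ ψ₂' (Ici x₀))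
    (hF : EqOn F F' Qbar) (hf : EqOn f f' {q | 0 ≤ q.1})
    (h : IsClassicalSolutionWith a x₀ A φ₁ φ₂ ψ₁ ψ₂ F f u u₁ u₂ u₃) :
    IsClassicalSolutionWith a x₀ A φ₁' φ₂' ψ₁' ψ₂' F' f' u u₁ u₂ u₃ := by
  obtain ⟨s1, s2, s3⟩ := closure_subset_Qbar (x₀ := x₀) ha
  refine ⟨h.toHasC2Pieces, fun p hp => ?_, fun p hp => ?_, fun p hp => ?_, fun x => ?_,
    fun x hx => ?_, fun t ht => ?_, fun t ht => ?_⟩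
  · rw [← nonlin_congr hf (s1 hp.1), ← hF (s1 hp.1), h.pde₁ p hp]
  · rw [← nonlin_congr hf (s2 hp.1), ← hF (s2 hp.1), h.pde₂ p hp]
  · rw [← nonlin_congr hf (s3 hp), ← hF (s3 hp), h.pde₃ p hp]
  · rw [h.init, phi_congr hφ₁ hφ₂]
  · rw [← psi_congr hψ₁ hψ₂]
    exact h.init_dt x hx
  · rw [h.goursat₁ t ht, hφ₁ (mem_Iic.2 le_rfl)]
  · rw [h.goursat₂ t ht, hφ₂ (mem_Ici.2 le_rfl)]

theorem IsCauchyRegion.dAlembert_congr {J : Set ℝ} {Q : Set (ℝ × ℝ)} {φ φ' ψ ψ' : ℝ → ℝ}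
    {v : ℝ × ℝ → ℝ} (hQ : IsCauchyRegion a J Q) (ha : 0 < a) (hφ : EqOn φ φ' J) (hψ : EqOn ψ ψ' J)
    (hF : EqOn F F' Qbar) (hf : EqOn f f' {q | 0 ≤ q.1})
    (h : DAlembert a φ ψ F f (closure Q) v) : DAlembert a φ' ψ' F' f' (closure Q) v := by
  intro t x hp
  have h0 := hp
  rw [← charPt_eq ha t x, hQ.mem_closure_iff] at h0
  obtain ⟨h1, h2, h3⟩ := h0
  have ht : 0 ≤ t := by nlinarith
  have e1 : ∫ ξ in (x - a * t)..(x + a * t), ψ ξ = ∫ ξ in (x - a * t)..(x + a * t), ψ' ξ :=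
    intervalIntegral.integral_congr fun ξ hξ => hψ (hQ.ordConnected.uIcc_subset h1 h2 hξ)
  rw [h t x hp, hφ h1, hφ h2, e1]
  congr 2
  refine intervalIntegral.integral_congr fun τ hτ => intervalIntegral.integral_congr fun ξ _ => ?_
  rw [uIcc_of_le ht] at hτ
  have hm : ((τ, ξ) : ℝ × ℝ) ∈ Qbar := hτ.1
  simp only [hF hm, nonlin_congr hf hm]

theorem parallelogram_congr {v : ℝ × ℝ → ℝ} (ha : 0 < a) (hφ₁ : φ₁ x₀ = φ₁' x₀)
    (hφ₂ : φ₂ x₀ = φ₂' x₀) (hF : EqOn F F' Qbar) (hf : EqOn f f' {q | 0 ≤ q.1})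
    (h : Parallelogram a x₀ A φ₁ φ₂ F f (closure (Q3 a x₀)) u₁ u₂ v) :
    Parallelogram a x₀ A φ₁' φ₂' F' f' (closure (Q3 a x₀)) u₁ u₂ v := by
  intro t x hp
  rw [h t x hp, hφ₁, hφ₂]
  congr 2
  refine intervalIntegral.integral_congr fun y hy => intervalIntegral.integral_congr fun z hz => ?_
  rw [closure_Q3 ha] at hp
  obtain ⟨-, h1, h2⟩ := hp
  rw [uIcc_of_ge h2] at hy
  rw [uIcc_of_le h1] at hz
  have hm : ((z - y) / (2 * a), (z + y) / 2) ∈ Qbar :=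
    (charPt_fst_nonneg ha y z).2 (hy.2.trans hz.1)
  simp only [hF hm, nonlin_congr hf hm]

theorem IsRepresentedBy.congr (ha : 0 < a) (hφ₁ : EqOn φ₁ φ₁' (Iic x₀))
    (hφ₂ : EqOn φ₂ φ₂' (Ici x₀)) (hψ₁ : EqOn ψ₁ ψ₁' (Iic x₀)) (hψ₂ : EqOn ψ₂ ψ₂' (Ici x₀))
    (hF : EqOn F F' Qbar) (hf : EqOn f f' {q | 0 ≤ q.1})
    (h : IsRepresentedBy a x₀ A φ₁ φ₂ ψ₁ ψ₂ F f u u₁ u₂ u₃) :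
    IsRepresentedBy a x₀ A φ₁' φ₂' ψ₁' ψ₂' F' f' u u₁ u₂ u₃ :=
  ⟨h.toHasC2Pieces, (isCauchyRegion_Q1 ha x₀).dAlembert_congr ha hφ₁ hψ₁ hF hf h.rep₁,
    (isCauchyRegion_Q2 ha x₀).dAlembert_congr ha hφ₂ hψ₂ hF hf h.rep₂,
    parallelogram_congr ha (hφ₁ (mem_Iic.2 le_rfl)) (hφ₂ (mem_Ici.2 le_rfl)) hF hf h.rep₃⟩

end congruence

end QLWave

theorem theorem1 (a x₀ A L : ℝ) (ha : 0 < a)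
    (φ₁ φ₂ ψ₁ ψ₂ : ℝ → ℝ) (F : ℝ × ℝ → ℝ) (f : ℝ × ℝ × ℝ × ℝ × ℝ → ℝ)
    (hF : ContDiffOn ℝ 1 F QLWave.Qbar)
    (hf : ContDiffOn ℝ 1 f {q | 0 ≤ q.1})
    (hφ₁ : ContDiffOn ℝ 2 φ₁ (Set.Iic x₀)) (hφ₂ : ContDiffOn ℝ 2 φ₂ (Set.Ici x₀))
    (hψ₁ : ContDiffOn ℝ 1 ψ₁ (Set.Iic x₀)) (hψ₂ : ContDiffOn ℝ 1 ψ₂ (Set.Ici x₀))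
    (hLip : ∀ t x z₁ z₂ z₃ w₁ w₂ w₃ : ℝ, 0 ≤ t →
      |f (t, x, z₁, z₂, z₃) - f (t, x, w₁, w₂, w₃)|
        ≤ L * (|z₁ - w₁| + |z₂ - w₂| + |z₃ - w₃|)) :
    -- existence
    (∃ u, QLWave.IsClassicalSolution a x₀ A φ₁ φ₂ ψ₁ ψ₂ F f u) ∧
    -- uniqueness on the closed half-plane
    (∀ u v, QLWave.IsClassicalSolution a x₀ A φ₁ φ₂ ψ₁ ψ₂ F f u →
      QLWave.IsClassicalSolution a x₀ A φ₁ φ₂ ψ₁ ψ₂ F f v → Set.EqOn u v QLWave.Qbar) ∧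
    -- the solution is determined by the integro-differential representations
    (∀ u u₁ u₂ u₃,
      QLWave.IsClassicalSolutionWith a x₀ A φ₁ φ₂ ψ₁ ψ₂ F f u u₁ u₂ u₃ ↔
        QLWave.IsRepresentedBy a x₀ A φ₁ φ₂ ψ₁ ψ₂ F f u u₁ u₂ u₃) := by
  have hL : 0 ≤ L := by
    have := (abs_nonneg _).trans (hLip 0 0 1 0 0 0 0 0 le_rfl)
    simpa using this
  obtain ⟨ρ₁, c1, -, m1, i1⟩ := (QLWave.isCauchyRegion_Q1 ha x₀).exists_retraction
  obtain ⟨ρ₂, c2, -, m2, i2⟩ := (QLWave.isCauchyRegion_Q2 ha x₀).exists_retraction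
  obtain ⟨φ₁', sφ₁, eφ₁⟩ := QLWave.exists_contDiff_two_extension Set.ordConnected_Iic
    (uniqueDiffOn_Iic x₀) c1 m1 i1 hφ₁
  obtain ⟨φ₂', sφ₂, eφ₂⟩ := QLWave.exists_contDiff_two_extension Set.ordConnected_Ici
    (uniqueDiffOn_Ici x₀) c2 m2 i2 hφ₂
  obtain ⟨ψ₁', sψ₁, eψ₁⟩ := QLWave.exists_contDiff_one_extension Set.ordConnected_Iic
    (uniqueDiffOn_Iic x₀) c1 m1 i1 hψ₁
  obtain ⟨ψ₂', sψ₂, eψ₂⟩ := QLWave.exists_contDiff_one_extension Set.ordConnected_Ici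
    (uniqueDiffOn_Ici x₀) c2 m2 i2 hψ₂
  have sF := QLWave.contDiff_reflectExt (f := F) hF
  have sf := QLWave.contDiff_reflectExt (f := f) hf
  have eF : Set.EqOn (QLWave.reflectExt F) F QLWave.Qbar := fun p hp => if_pos hp
  have ef : Set.EqOn (QLWave.reflectExt f) f {q | 0 ≤ q.1} := fun p hp => if_pos hp
  have hg := QLWave.lipschitzTail_charRhs (F := QLWave.reflectExt F) ha
    (by positivity : 0 ≤ 3 * L) (QLWave.lipschitzTail_reflectExt hL hLip)
  have hΛ : 0 ≤ 3 * L * (1 + a) / (4 * a ^ 2) := by positivity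
  have toExt : ∀ u u₁ u₂ u₃,
      QLWave.IsClassicalSolutionWith a x₀ A φ₁ φ₂ ψ₁ ψ₂ F f u u₁ u₂ u₃ ↔
      QLWave.IsClassicalSolutionWith a x₀ A φ₁' φ₂' ψ₁' ψ₂' (QLWave.reflectExt F)
        (QLWave.reflectExt f) u u₁ u₂ u₃ := fun u u₁ u₂ u₃ =>
    ⟨fun h => h.congr ha eφ₁.symm eφ₂.symm eψ₁.symm eψ₂.symm eF.symm ef.symm,
      fun h => h.congr ha eφ₁ eφ₂ eψ₁ eψ₂ eF ef⟩
  have toExt' : ∀ u, QLWave.IsClassicalSolution a x₀ A φ₁ φ₂ ψ₁ ψ₂ F f u ↔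
      QLWave.IsClassicalSolution a x₀ A φ₁' φ₂' ψ₁' ψ₂' (QLWave.reflectExt F)
        (QLWave.reflectExt f) u := fun u => by
    simp only [QLWave.IsClassicalSolution, toExt]
  refine ⟨?_, fun u v hu hv => ?_, fun u u₁ u₂ u₃ => ?_⟩
  · simp only [toExt']
    exact QLWave.exists_isClassicalSolution ha sφ₁ sφ₂ sψ₁ sψ₂ sF sf hΛ hg
  · exact QLWave.IsClassicalSolution.eqOn ha sφ₁ sφ₂ sψ₁.continuous sψ₂.continuous sF.continuous
      sf.continuous hΛ hg ((toExt' u).1 hu) ((toExt' v).1 hv)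
  · rw [toExt, QLWave.classical_iff_represented ha sφ₁ sφ₂ sψ₁.continuous sψ₂.continuous
      sF.continuous sf.continuous]
    exact ⟨fun h => h.congr ha eφ₁ eφ₂ eψ₁ eψ₂ eF ef,
      fun h => h.congr ha eφ₁.symm eφ₂.symm eψ₁.symm eψ₂.symm eF.symm ef.symm⟩
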